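/- Let $V$ be a $\mathbb{Z}_{\ge 0}$-graded vertex algebra over $\mathbb{C}$ with products $a_{(m)}b$ ($m\in\mathbb{Z}$), vacuum $\mathbf 1$ and translation operator $Ta=a_{(-2)}\mathbf 1$. Let $\tau$ be a point of the upper half plane, $\Lambda=\mathbb{Z}+\mathbb{Z}\tau$, $E=\mathbb{C}/\Lambda$, $X=E\setminus\{0\}$ (an affine algebraic curve with coordinates $u=\wp(x)$, $v=\wp'(x)$), and let $\Gamma_n$ be the coordinate ring of the configuration space $F(X,n)=\{(x_1,\dots,x_n)\in X^n : x_i\ne x_j \text{ for } i\neq j\}$, with derivations $\partial_i=\partial/\partial x_i$. For $n\ge 0$ put $$\widetilde C_n=\Gamma_n\otimes V^{\otimes n+1},\qquad C_n=\widetilde C_n\Big/\sum_{i=1}^n(\partial_i+T_i)\widetilde C_n ,$$ where $T_i$ is $T$ acting on the $i$-th tensor factor. (1) Let $f\in\Gamma_n$, $n\ge 1$, and $i\ne j$. Then $f$ has a unique Laurent expansion $f=\sum_{m}f^{(m)}\,(x_i-x_j)^m$ along $x_i=x_j$ and a unique Laurent expansion $f=\sum_m f^{[m]}\,x_i^m$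 along $x_i=0$, whose coefficients $f^{(m)}$, respectively $f^{[m]}$, are functions of the remaining variables, belong to $\Gamma_{n-1}$ (after relabelling the remaining variables as $x_1,\dots,x_{n-1}$), and vanish for all sufficiently negative $m$. (2) Consequently there are unique linear maps $d:\widetilde C_n\to\widetilde C_{n-1}$ ($n\ge1$) with $$d=\sum_{1\le i<j\le n}(-1)^{n-i}d^{(ij)}+\sum_{1\le i\le n}(-1)^{n-i}p^{(i)}$$ where, on $f\,a^1\otimes\cdots\otimes a^n\otimes b$ and up to the above relabelling, $d^{(ij)}$ is the residue along $x_i=x_j$ of $f\,a^1\otimes\cdots\widehat{a^i}\cdots\otimes Y(a^i,x_i-x_j)a^j\otimes\cdots\otimes a^n\otimes b$, that is $$\sum_m f^{(m)}\,a^1\otimes\cdots\widehat{a^i}\cdots\otimes a^i_{(m)}a^j\otimes\cdots\otimes a^n\otimes b ,$$ and $p^{(i)}$ is the residue along $x_i=0$ of $f\,a^1\otimes\cdots\widehat{a^i}\cdots\otimes a^n\otimes Y(a^i,x_i)b$, that is $$\sum_m f^{[m]}\,a^1\otimes\cdots\widehat{a^i}\cdots\otimes a^n\otimes a^i_{(m)}b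 .$$ Both sums are finite. (3) The maps $d$ descend to linear maps $d:C_n\to C_{n-1}$, and these satisfy $d\circ d=0$; that is, $(C_\bullet,d)$ is a complex. -/

import Mathlib

open Filter Topology
open scoped TensorProduct UpperHalfPlane

/-! ### Vertex algebras -/

/-- A vertex algebra over `ℂ`: `nprod n a b` is the `n`-th product `a_(n) b`. -/
class VertexAlgebra (V : Type*) [AddCommGroup V] [Module ℂ V] where
  nprod : ℤ → V →ₗ[ℂ] V →ₗ[ℂ] V
  vac : V
  vac_ne_zero : vac ≠ 0
  /-- quantum field property -/
  field : ∀ a b : V, ∃ N : ℤ, ∀ n : ℤ, N ≤ n → nprod n a b = 0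
  /-- `Y(𝟏, z) = id` -/
  vac_nprod : ∀ (n : ℤ) (a : V), nprod n vac a = if n = -1 then a else 0
  /-- `Y(a, z) 𝟏` has no negative powers of `z` -/
  nprod_vac : ∀ (a : V) (n : ℤ), 0 ≤ n → nprod n a vac = 0
  /-- `Y(a, z) 𝟏` has constant term `a` -/
  nprod_neg_one_vac : ∀ a : V, nprod (-1) a vac = a
  /-- Borcherds identity; both sums have finite support by the quantum field property -/
  borcherds : ∀ (a b c : V) (m n k : ℤ),
    ∑ᶠ j : ℕ, Ring.choose m j • nprod (m + k - j) (nprod (n + j) a b) c =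
      ∑ᶠ j : ℕ, ((-1 : ℤ) ^ j * Ring.choose n j) •
        (nprod (n + m - j) a (nprod (k + j) b c)
          - (n.negOnePow : ℤ) • nprod (n + k - j) b (nprod (m + j) a c))

namespace VertexAlgebra

/-- The translation operator `T a = a_(-2) 𝟏`. -/
def translation (V : Type*) [AddCommGroup V] [Module ℂ V] [VertexAlgebra V] : V →ₗ[ℂ] V :=
  (nprod (-2)).flip vac

end VertexAlgebra

/-- A `ℤ_{≥ 0}`-graded vertex algebra. -/
class GradedVertexAlgebra (V : Type*) [AddCommGroup V] [Module ℂ V] extends VertexAlgebra V where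
  gr : ℕ → Submodule ℂ V
  isInternal : DirectSum.IsInternal gr
  vac_mem : vac ∈ gr 0
  translation_mem : ∀ (n : ℕ) (a : V), a ∈ gr n → VertexAlgebra.translation V a ∈ gr (n + 1)
  nprod_mem : ∀ (p q k : ℕ) (n : ℤ) (a b : V), a ∈ gr p → b ∈ gr q →
    (k : ℤ) = p + q - n - 1 → nprod n a b ∈ gr k
  nprod_eq_zero : ∀ (p q : ℕ) (n : ℤ) (a b : V), a ∈ gr p → b ∈ gr q →
    (p + q - n - 1 : ℤ) < 0 → nprod n a b = 0

noncomputable section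

namespace ChiralHomology

/-! ### The elliptic curve `E = ℂ / (ℤ + ℤ τ)` and its configuration spaces -/

/-- The pair of periods `(1, τ)`. -/
def periods (τ : ℍ) : PeriodPair where
  ω₁ := 1
  ω₂ := τ
  indep := by
    rw [LinearIndependent.pair_iff]
    intro s t h
    have him := congrArg Complex.im h
    have hre := congrArg Complex.re h
    simp at him hre
    have ht : t = 0 := him.resolve_right τ.im_ne_zero
    subst ht
    simpa using hre

/-- The lattice `Λ = ℤ + ℤ τ`. -/
def lattice (τ : ℍ) : Set ℂ := (periods τ).lattice

/-- The preimage in `ℂ ^ n` of the configuration space `F(X, n)`, where `X = E \ {0}`. -/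
def conf (τ : ℍ) (n : ℕ) : Set (Fin n → ℂ) :=
  {x | (∀ i, x i ∉ lattice τ) ∧ ∀ i j, i ≠ j → x i - x j ∉ lattice τ}

/-- The affine coordinates `u_i = ℘(x_i)` (left summand), `v_i = ℘'(x_i)` (right summand)
of the point of `X ^ n` determined by `x`. -/
def coords (τ : ℍ) {n : ℕ} (x : Fin n → ℂ) : Fin n ⊕ Fin n → ℂ :=
  Sum.elim (fun i => (periods τ).weierstrassP (x i)) (fun i => (periods τ).derivWeierstrassP (x i))

/-- Value at `x` of a polynomial in the `u_i, v_i`. -/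
def polyEval (τ : ℍ) {n : ℕ} (g : MvPolynomial (Fin n ⊕ Fin n) ℂ) (x : Fin n → ℂ) : ℂ :=
  MvPolynomial.eval (coords τ x) g

/-- Regular functions on the variety `F(X, n)`: near each point, in the Zariski topology, a
quotient of two polynomials in the affine coordinates `u_i, v_i`. -/
def IsRegular (τ : ℍ) {n : ℕ} (f : conf τ n → ℂ) : Prop :=
  ∀ p : conf τ n, ∃ g h : MvPolynomial (Fin n ⊕ Fin n) ℂ, polyEval τ h p ≠ 0 ∧
    ∀ q : conf τ n, polyEval τ h q ≠ 0 → f q = polyEval τ g q / polyEval τ h q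

/-- The coordinate ring `Γ_n` of `F(X, n)`. -/
def Gam (τ : ℍ) (n : ℕ) : Subalgebra ℂ (conf τ n → ℂ) where
  carrier := {f | IsRegular τ f}
  mul_mem' := by
    intro f₁ f₂ h₁ h₂ p
    obtain ⟨g₁, k₁, hk₁, e₁⟩ := h₁ p
    obtain ⟨g₂, k₂, hk₂, e₂⟩ := h₂ p
    refine ⟨g₁ * g₂, k₁ * k₂, ?_, fun q hq => ?_⟩
    · simpa [polyEval] using ⟨hk₁, hk₂⟩
    · simp only [polyEval, map_mul] at hq e₁ e₂ ⊢
      rw [Pi.mul_apply, e₁ q (left_ne_zero_of_mul hq), e₂ q (right_ne_zero_of_mul hq),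
        div_mul_div_comm]
  add_mem' := by
    intro f₁ f₂ h₁ h₂ p
    obtain ⟨g₁, k₁, hk₁, e₁⟩ := h₁ p
    obtain ⟨g₂, k₂, hk₂, e₂⟩ := h₂ p
    refine ⟨g₁ * k₂ + k₁ * g₂, k₁ * k₂, ?_, fun q hq => ?_⟩
    · simpa [polyEval] using ⟨hk₁, hk₂⟩
    · simp only [polyEval, map_mul, map_add] at hq e₁ e₂ ⊢
      rw [Pi.add_apply, e₁ q (left_ne_zero_of_mul hq), e₂ q (right_ne_zero_of_mul hq),
        div_add_div _ _ (left_ne_zero_of_mul hq) (right_ne_zero_of_mul hq)]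
  algebraMap_mem' := by
    intro r p
    exact ⟨MvPolynomial.C r, 1, by simp [polyEval], fun q _ => by simp [polyEval]⟩

/-! ### The derivations `∂_i` -/

/-- `℘'' = 6 ℘² - g₂ / 2` away from the lattice. -/
theorem hasDerivAt_derivWeierstrassP (L : PeriodPair) {z : ℂ} (hz : z ∉ L.lattice) :
    HasDerivAt L.derivWeierstrassP (6 * L.weierstrassP z ^ 2 - L.g₂ / 2) z := by
  have hopen : IsOpen ((L.lattice : Set ℂ)ᶜ) := L.isClosed_lattice.isOpen_compl
  have hP : ∀ w ∉ L.lattice, HasDerivAt L.weierstrassP (L.derivWeierstrassP w) w := by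
    intro w hw
    have := (L.analyticOnNhd_weierstrassP w hw).differentiableAt.hasDerivAt
    rwa [L.deriv_weierstrassP] at this
  have hPA := L.analyticOnNhd_weierstrassP
  have hQA := L.analyticOnNhd_derivWeierstrassP
  have hconn : IsPreconnected ((L.lattice : Set ℂ)ᶜ) := by
    refine (Set.Countable.isConnected_compl_of_one_lt_rank (by simp) ?_).2
    exact countable_of_Lindelof_of_discrete (X := L.lattice)
  have hzero : Set.EqOn (fun w => 2 * L.derivWeierstrassP w *
      (deriv L.derivWeierstrassP w - (6 * L.weierstrassP w ^ 2 - L.g₂ / 2)))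
      0 (L.lattice : Set ℂ)ᶜ := by
    intro w hw
    have hQ := (hQA w hw).differentiableAt.hasDerivAt
    have h1 := hQ.pow 2
    have h2 := (((hP w hw).pow 3).const_mul 4).sub (((hP w hw).const_mul L.g₂))
    have h2' := h2.sub_const L.g₃
    have heq : (fun w => L.derivWeierstrassP w ^ 2) =ᶠ[𝓝 w]
        fun w => 4 * L.weierstrassP w ^ 3 - L.g₂ * L.weierstrassP w - L.g₃ := by
      filter_upwards [hopen.mem_nhds hw] with y hy using L.derivWeierstrassP_sq y hy
    have h3 := (HasDerivAt.congr_of_eventuallyEq h2' heq).unique h1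
    simp only [Nat.cast_ofNat, Nat.add_one_sub_one, pow_one, Pi.zero_apply] at h3 ⊢
    linear_combination -h3
  have hBA : AnalyticOnNhd ℂ (fun w => deriv L.derivWeierstrassP w -
      (6 * L.weierstrassP w ^ 2 - L.g₂ / 2)) (L.lattice : Set ℂ)ᶜ := by
    intro w hw
    have h1 := (hQA w hw).deriv
    have h2 := hPA w hw
    fun_prop
  have hAA : AnalyticOnNhd ℂ (fun w => 2 * L.derivWeierstrassP w) (L.lattice : Set ℂ)ᶜ := by
    intro w hw
    have h1 := hQA w hw
    fun_prop
  have key : deriv L.derivWeierstrassP z - (6 * L.weierstrassP z ^ 2 - L.g₂ / 2) = 0 := by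
    rcases AnalyticOnNhd.eq_zero_or_eq_zero_of_mul_eq_zero hAA hBA
      (fun w hw => hzero hw) hconn with h | h
    · exfalso
      -- then `℘` is constant off the lattice, contradicting its pole at `0`
      have hc : ∀ w ∉ L.lattice, L.weierstrassP w = L.weierstrassP z := by
        intro w hw
        refine hopen.is_const_of_deriv_eq_zero hconn
          (fun y hy => (hPA y hy).differentiableAt.differentiableWithinAt) ?_ hw hz
        intro y hy
        have := h y hy
        rw [L.deriv_weierstrassP]
        simpa using this
      have ho := L.order_weierstrassP 0 (zero_mem _)
      have hev : L.weierstrassP =ᶠ[𝓝[≠] 0] fun _ => L.weierstrassP z := by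
        have := L.compl_lattice_sdiff_singleton_mem_nhds 0
        filter_upwards [mem_nhdsWithin_of_mem_nhds this, self_mem_nhdsWithin] with w hw hw0
        refine hc w fun hw' => hw ⟨hw', hw0⟩
      rw [meromorphicOrderAt_congr hev] at ho
      have hge : (0 : WithTop ℤ) ≤ meromorphicOrderAt (fun _ : ℂ => L.weierstrassP z) 0 :=
        (analyticAt_const).meromorphicOrderAt_nonneg
      rw [ho] at hge
      exact absurd hge (by decide)
    · exact h z hz
  have := (hQA z hz).differentiableAt.hasDerivAt
  rwa [sub_eq_zero.mp key] at this

/-- The derivation of the polynomial ring inducing `∂_i`: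
`u_i ↦ v_i`, `v_i ↦ P'(u_i) / 2 = 6 u_i² - g₂ / 2`. -/
def polyDeriv (τ : ℍ) {n : ℕ} (i : Fin n) :
    Derivation ℂ (MvPolynomial (Fin n ⊕ Fin n) ℂ) (MvPolynomial (Fin n ⊕ Fin n) ℂ) :=
  MvPolynomial.mkDerivation ℂ (Sum.elim
    (fun k => if k = i then MvPolynomial.X (Sum.inr i) else 0)
    (fun k => if k = i then 6 * MvPolynomial.X (Sum.inl i) ^ 2
      - MvPolynomial.C ((periods τ).g₂ / 2) else 0))

theorem hasDerivAt_polyEval (τ : ℍ) {n : ℕ} (i : Fin n) (g : MvPolynomial (Fin n ⊕ Fin n) ℂ)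
    {x : Fin n → ℂ} (hx : x ∈ conf τ n) :
    HasDerivAt (fun s => polyEval τ g (Function.update x i s)) (polyEval τ (polyDeriv τ i g) x)
      (x i) := by
  have hxi : x i ∉ (periods τ).lattice := hx.1 i
  induction g using MvPolynomial.induction_on with
  | C a => simpa [polyEval, polyDeriv] using hasDerivAt_const (x i) a
  | add p q hp hq =>
    simp only [polyEval, map_add] at hp hq ⊢
    exact hp.add hq
  | mul_X p k hp =>
    have hk : HasDerivAt (fun s => coords τ (Function.update x i s) k)
        (polyEval τ (polyDeriv τ i (MvPolynomial.X k)) x) (x i) := by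
      rcases k with k | k
      · by_cases h : k = i
        · subst h
          have h0 := ((periods τ).analyticOnNhd_weierstrassP (x k) hxi).differentiableAt.hasDerivAt
          rw [(periods τ).deriv_weierstrassP] at h0
          simpa [polyEval, polyDeriv, coords] using h0
        · simpa [polyEval, polyDeriv, coords, h] using
            hasDerivAt_const (x i) ((periods τ).weierstrassP (x k))
      · by_cases h : k = i
        · subst h
          have h0 := hasDerivAt_derivWeierstrassP (periods τ) hxi
          simpa [polyEval, polyDeriv, coords] using h0
        · simpa [polyEval, polyDeriv, coords, h] using
            hasDerivAt_const (x i) ((periods τ).derivWeierstrassP (x k))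
    have := hp.mul hk
    simp only [polyEval, map_mul, MvPolynomial.eval_X, Derivation.leibniz, map_add,
      smul_eq_mul, Function.update_eq_self] at this ⊢
    refine this.congr_deriv ?_
    ring

/-- `f` extended by zero to `ℂ ^ n`. -/
def ext (τ : ℍ) {n : ℕ} (f : conf τ n → ℂ) : (Fin n → ℂ) → ℂ :=
  Function.extend Subtype.val f 0

/-- The partial derivative with respect to `x_i`. -/
def partialDeriv (τ : ℍ) {n : ℕ} (i : Fin n) (f : conf τ n → ℂ) : conf τ n → ℂ :=
  fun x => deriv (fun s => ext τ f (Function.update x.1 i s)) (x.1 i)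

theorem eventually_update_mem_conf (τ : ℍ) {n : ℕ} (i : Fin n) {x : Fin n → ℂ}
    (hx : x ∈ conf τ n) : ∀ᶠ s in 𝓝 (x i), Function.update x i s ∈ conf τ n := by
  have hopen : IsOpen ((lattice τ)ᶜ) := (periods τ).isClosed_lattice.isOpen_compl
  have hc : ∀ k : Fin n, ContinuousAt (fun s => Function.update x i s k) (x i) := by
    intro k
    have : Continuous (fun s => Function.update x i s) := continuous_const.update i continuous_id
    exact ((continuous_apply k).comp this).continuousAt
  have h1 : ∀ᶠ s in 𝓝 (x i), ∀ k, Function.update x i s k ∉ lattice τ := by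
    rw [eventually_all]
    intro k
    refine (hc k).eventually_mem (hopen.mem_nhds ?_)
    simpa using hx.1 k
  have h2 : ∀ᶠ s in 𝓝 (x i), ∀ k l, k ≠ l →
      Function.update x i s k - Function.update x i s l ∉ lattice τ := by
    rw [eventually_all]; intro k
    rw [eventually_all]; intro l
    by_cases hkl : k = l
    · simp [hkl]
    · have := ((hc k).sub (hc l)).eventually_mem (hopen.mem_nhds (by simpa using hx.2 k l hkl))
      filter_upwards [this] with s hs _ using hs
  filter_upwards [h1, h2] with s hs1 hs2 using ⟨hs1, hs2⟩

/-- Regular functions are differentiable in each variable, with the expected derivative. -/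
theorem hasDerivAt_of_quot (τ : ℍ) {n : ℕ} (i : Fin n) {f : conf τ n → ℂ}
    {g h : MvPolynomial (Fin n ⊕ Fin n) ℂ}
    (e : ∀ q : conf τ n, polyEval τ h q ≠ 0 → f q = polyEval τ g q / polyEval τ h q)
    (x : conf τ n) (hx : polyEval τ h x ≠ 0) :
    HasDerivAt (fun s => ext τ f (Function.update x.1 i s))
      (polyEval τ (polyDeriv τ i g * h - g * polyDeriv τ i h) x / polyEval τ (h ^ 2) x)
      (x.1 i) := by
  have hg := hasDerivAt_polyEval τ i g x.2
  have hh := hasDerivAt_polyEval τ i h x.2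
  have hq := hg.div hh (by simpa using hx)
  have heq : (fun s => ext τ f (Function.update x.1 i s)) =ᶠ[𝓝 (x.1 i)]
      (fun s => polyEval τ g (Function.update x.1 i s)) /
        fun s => polyEval τ h (Function.update x.1 i s) := by
    filter_upwards [eventually_update_mem_conf τ i x.2,
      hh.continuousAt.eventually_ne (by simpa using hx)] with s hs hs'
    have := e ⟨_, hs⟩ hs'
    simp only [Pi.div_apply]
    rw [← this]
    exact Function.Injective.extend_apply Subtype.val_injective f 0 ⟨_, hs⟩
  refine (hq.congr_of_eventuallyEq heq).congr_deriv ?_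
  simp [polyEval]

theorem exists_hasDerivAt (τ : ℍ) {n : ℕ} (i : Fin n) {f : conf τ n → ℂ} (hf : IsRegular τ f)
    (x : conf τ n) :
    DifferentiableAt ℂ (fun s => ext τ f (Function.update x.1 i s)) (x.1 i) := by
  obtain ⟨g, h, hh, e⟩ := hf x
  exact (hasDerivAt_of_quot τ i e x hh).differentiableAt

theorem isRegular_partialDeriv (τ : ℍ) {n : ℕ} (i : Fin n) {f : conf τ n → ℂ}
    (hf : IsRegular τ f) : IsRegular τ (partialDeriv τ i f) := by
  intro p
  obtain ⟨g, h, hh, e⟩ := hf p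
  refine ⟨polyDeriv τ i g * h - g * polyDeriv τ i h, h ^ 2, ?_, fun q hq => ?_⟩
  · simpa [polyEval] using hh
  · exact (hasDerivAt_of_quot τ i e q (by simpa [polyEval] using hq)).deriv

/-- The derivation `∂_i = ∂ / ∂ x_i` of `Γ_n`, as a linear map. -/
def partialGam (τ : ℍ) {n : ℕ} (i : Fin n) : Gam τ n →ₗ[ℂ] Gam τ n where
  toFun f := ⟨partialDeriv τ i f.1, isRegular_partialDeriv τ i f.2⟩
  map_add' f g := by
    ext x
    have hfg : (fun s => ext τ (f.1 + g.1) (Function.update x.1 i s)) =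
        (fun s => ext τ f.1 (Function.update x.1 i s)) +
          fun s => ext τ g.1 (Function.update x.1 i s) := by
      funext s
      simp only [ext, Pi.add_apply]
      have := Function.extend_add (Subtype.val : conf τ n → _) f.1 g.1 0 0
      simpa using congrFun this (Function.update x.1 i s)
    have := deriv_add (exists_hasDerivAt τ i f.2 x) (exists_hasDerivAt τ i g.2 x)
    rw [← hfg] at this
    exact this
  map_smul' c f := by
    ext x
    have hcf : (fun s => ext τ (c • f.1) (Function.update x.1 i s)) =
        c • fun s => ext τ f.1 (Function.update x.1 i s) := by
      funext s
      simp only [ext]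
      have := Function.extend_smul c (Subtype.val : conf τ n → _) f.1 0
      simpa using congrFun this (Function.update x.1 i s)
    have := deriv_const_smul c (exists_hasDerivAt τ i f.2 x)
    rw [← hcf] at this
    exact this

/-! ### Laurent expansions along `x_i = x_j` and `x_i = 0` -/

/-- `g m`, `m ∈ ℤ`, are the coefficients of the Laurent expansion of `f ∈ Γ_{n+1}`, as a function
of the `i`-th variable, around the point `center y` depending on the remaining variables `y`:
`f = ∑_m g m (y) t ^ m` with `t = x_i - center y`. All coefficients belong to `Γ_n`, and the order
of the pole is bounded independently of `y`. -/
def IsLaurentExpansion (τ : ℍ) {n : ℕ} (f : Gam τ (n + 1)) (i : Fin (n + 1))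
    (center : (Fin n → ℂ) → ℂ) (g : ℤ → Gam τ n) : Prop :=
  (∃ N : ℤ, ∀ m < N, g m = 0) ∧
  ∀ y : conf τ n, ∀ᶠ t in 𝓝[≠] (0 : ℂ),
    ∃ hx : i.insertNth (α := fun _ => ℂ) (center y.1 + t) y.1 ∈ conf τ (n + 1),
      HasSum (fun m : ℤ => (g m).1 y * t ^ m) (f.1 ⟨_, hx⟩)

open Classical in
/-- The Laurent coefficients of `f` (zero if there is no Laurent expansion). -/
def laurentCoeff (τ : ℍ) {n : ℕ} (f : Gam τ (n + 1)) (i : Fin (n + 1))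
    (center : (Fin n → ℂ) → ℂ) : ℤ → Gam τ n :=
  if h : ∃ g, IsLaurentExpansion τ f i center g then h.choose else 0

/-! ### The spaces `C̃_n` and `C_n` -/

section Complex

variable (τ : ℍ) (V : Type*) [AddCommGroup V] [Module ℂ V]

/-- `C̃_n = Γ_n ⊗ V^{⊗ n+1}`. The tensor slots are indexed by `Fin (n + 1)`: the slot `i.castSucc`
belongs to the variable `x_i`, `i : Fin n`, and the slot `Fin.last n` holds the last factor `b`. -/
abbrev CTilde (n : ℕ) : Type _ := Gam τ n ⊗[ℂ] (PiTensorProduct ℂ fun _ : Fin (n + 1) => V)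

instance instAddCommGroupCTilde (n : ℕ) : AddCommGroup (CTilde τ V n) := TensorProduct.addCommGroup

variable [VertexAlgebra V]

/-- The translation operator acting on the tensor factor belonging to `x_i`. -/
def translationAt (n : ℕ) (i : Fin n) :
    (PiTensorProduct ℂ fun _ : Fin (n + 1) => V) →ₗ[ℂ]
      (PiTensorProduct ℂ fun _ : Fin (n + 1) => V) :=
  PiTensorProduct.map (Function.update (fun _ => LinearMap.id) i.castSucc
    (VertexAlgebra.translation V))

/-- The operator `∂_i + T_i` on `C̃_n`. -/
def totalDeriv (n : ℕ) (i : Fin n) : CTilde τ V n →ₗ[ℂ] CTilde τ V n :=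
  (partialGam τ i).rTensor _ + (translationAt V n i).lTensor _

/-- The subspace `∑_i (∂_i + T_i) C̃_n`. -/
def relations (n : ℕ) : Submodule ℂ (CTilde τ V n) :=
  ⨆ i : Fin n, LinearMap.range (totalDeriv τ V n i)

/-- `C_n = C̃_n / ∑_i (∂_i + T_i) C̃_n`. -/
abbrev C (n : ℕ) : Type _ := CTilde τ V n ⧸ relations τ V n

variable {V}

/-- Remove the tensor factor `a^i` and replace the factor `b` in slot `k` of the remaining ones by
`a^i_(m) b`. -/
def merge {n : ℕ} (a : Fin (n + 2) → V) (i : Fin (n + 1)) (k : Fin (n + 1)) (m : ℤ) :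
    Fin (n + 1) → V :=
  Function.update (i.castSucc.removeNth a) k
    (VertexAlgebra.nprod m (a i.castSucc) (i.castSucc.removeNth a k))

/-- `d^{(ij)}(f ⊗ a)`: the residue `∑_m f^{(m)} ⊗ (… a^i_(m) a^j …)` along `x_i = x_j`. Here
`j = i.succAbove k`, so that `k` is the index of `x_j` after relabelling. -/
def dTerm {n : ℕ} (f : Gam τ (n + 1)) (a : Fin (n + 2) → V) (i : Fin (n + 1)) (k : Fin n) :
    CTilde τ V n :=
  ∑ᶠ m : ℤ, laurentCoeff τ f i (fun y => y k) m ⊗ₜ[ℂ]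
    PiTensorProduct.tprod ℂ (merge a i k.castSucc m)

/-- `p^{(i)}(f ⊗ a)`: the residue `∑_m f^{(m)} ⊗ (… ⊗ a^i_(m) b)` along `x_i = 0`. -/
def pTerm {n : ℕ} (f : Gam τ (n + 1)) (a : Fin (n + 2) → V) (i : Fin (n + 1)) :
    CTilde τ V n :=
  ∑ᶠ m : ℤ, laurentCoeff τ f i (fun _ => 0) m ⊗ₜ[ℂ]
    PiTensorProduct.tprod ℂ (merge a i (Fin.last n) m)

/-- The linear maps `δ n : C̃_{n+1} → C̃_n` are given on pure tensors by
`∑_{i<j} (-1)^{n+1-i} d^{(ij)} + ∑_i (-1)^{n+1-i} p^{(i)}` (indices `i, j` starting from `1`;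
in the code they start from `0`). -/
def IsChiralDifferential (δ : ∀ n : ℕ, CTilde τ V (n + 1) →ₗ[ℂ] CTilde τ V n) : Prop :=
  ∀ (n : ℕ) (f : Gam τ (n + 1)) (a : Fin (n + 2) → V),
    δ n (f ⊗ₜ[ℂ] PiTensorProduct.tprod ℂ a) =
      (∑ i : Fin (n + 1), ∑ k : Fin n with i < i.succAbove k,
        (-1 : ℂ) ^ (n - (i : ℕ)) • dTerm τ f a i k) +
      ∑ i : Fin (n + 1), (-1 : ℂ) ^ (n - (i : ℕ)) • pTerm τ f a i

end Complex

end ChiralHomology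

end

/-!
A Laurent expansion of a regular function around `x_i = x_j` or `x_i = 0` always exists and is
unique, point by point in the remaining variables; what has to be shown is that its coefficients
are regular. For this the coordinate ring of the configuration space is described by generators.
Besides `u_i = ℘(x_i)` and `v_i = ℘'(x_i)`, it contains the secant slopes
`(v_i + v_j) / (u_i - u_j) = 2 (ζ(x_i - x_j) - ζ(x_i) + ζ(x_j))`, which are regular also where
`x_i + x_j ∈ Λ` (`PeriodPair.secant_mul_sub`, `PeriodPair.sub_mul_secant`), and by the
Nullstellensatz these functions generate it (`aeval_gens_surjective`): a common zero of all the
denominators of a regular function would be a point of the configuration space. The generators have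
expansions with regular coefficients, because `ζ' = -℘` and because the Taylor coefficients of a
regular function in one variable are its divided derivatives. Expansions with regular coefficients
form an algebra, and the proof carries along their compatibility with all derivations
(`Expandable`, `expandable`).

A residue pairs the Laurent coefficients with the products `a_(m) b`; the sum is finite since the
former vanish for `m` very negative and the latter for large `m`. Residues commute with the
operators `∂_l + T_l` in the remaining variables and kill the image of `∂_i + T_i`. Both facts are
summation by parts, from `(T a)_(m) = -m a_(m-1)` and `[T, a_(m)] = -m a_(m-1)`
(`residue_comp_totalDeriv_self`, `residue_comp_totalDeriv_succAbove`), and so the differential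
descends.

The differential is the alternating sum of the faces `face i`, the residues of `x_i` at the later
variables and at the origin, so it squares to zero if the faces satisfy the simplicial identities.
These follow (`face_comp_face`) from a commutator formula, `residue_comp_residue`: the residues of
two variables commute if their centers differ, and otherwise their commutator is the residue at the
common center following the residue of one variable at the other. To prove it, fix the remaining
variables. Near the codimension two stratum a regular function is a finite sum of products
`h₁(s) h₂(t) h₃(s - t)` of Laurent series in the displacements `s`, `t` of the two variables and in
`s - t` (`separable`); this too is clear on generators. The three iterated residues expand one
factor each by the binomial series, in the domains `|t| < |s|`, `|s| < |t|` and `|s - t| < |t|`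
(`iterated_residue`), and the formula becomes the Borcherds identity for each triple of exponents
(`borcherds_kernel`). At different centers `h₃` is holomorphic, so that its two expansions agree,
and the two products act on different tensor factors.
-/


noncomputable section

/-! ### The Weierstrass zeta function -/

namespace PeriodPair

variable (L : PeriodPair)

/-- The regular part `ζ(z) - 1 / z` of the Weierstrass zeta function at the origin. -/
def zetaExcept (z : ℂ) : ℂ :=
  ∑' l : L.lattice, if l.1 = 0 then 0 else (1 / (z - l) + 1 / l + z / l ^ 2)

/-- The Weierstrass zeta function, with the value `0` at the origin. -/
def zeta (z : ℂ) : ℂ := L.zetaExcept z + 1 / z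

theorem hasSumLocallyUniformly_zetaExcept :
    HasSumLocallyUniformly (fun (l : L.lattice) (z : ℂ) ↦
      if l.1 = 0 then 0 else (1 / (z - l) + 1 / l + z / l ^ 2)) L.zetaExcept := by
  refine L.hasSumLocallyUniformly_aux (u := fun r l => (2 * r ^ 2) * ‖l‖ ^ (-3 : ℝ)) _
    (fun _ _ ↦ (ZLattice.summable_norm_rpow _ _ (by simp; norm_num)).mul_left _) fun r hr ↦
    Filter.eventually_atTop.mpr ⟨2 * r, ?_⟩
  rintro _ h s hs l rfl
  split_ifs with h0
  · simp only [norm_zero]; positivity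
  have hl : (0 : ℝ) < ‖l.1‖ := norm_pos_iff.mpr h0
  have hsl : s - l.1 ≠ 0 := by
    intro e
    rw [sub_eq_zero.mp e] at hs
    linarith
  have e1 : 1 / (s - l.1) + 1 / l.1 + s / l.1 ^ 2 = s ^ 2 / ((s - l.1) * l.1 ^ 2) := by
    field_simp
    ring
  have hb : ‖l.1‖ / 2 ≤ ‖s - l.1‖ := by
    rw [norm_sub_rev]
    exact .trans (by linarith) (norm_sub_norm_le l.1 s)
  rw [e1, norm_div, norm_mul, norm_pow, norm_pow]
  have e2 : 2 * r ^ 2 * ‖l‖ ^ (-3 : ℝ) = r ^ 2 / (‖l.1‖ / 2 * ‖l.1‖ ^ 2) := by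
    rw [Real.rpow_neg (norm_nonneg _)]
    have : ‖l‖ = ‖l.1‖ := rfl
    rw [this]
    norm_cast
    field_simp
  rw [e2]
  gcongr

theorem differentiableOn_zetaExcept :
    DifferentiableOn ℂ L.zetaExcept (L.lattice \ {0})ᶜ := by
  refine L.hasSumLocallyUniformly_zetaExcept.hasSumLocallyUniformlyOn.differentiableOn
    (.of_forall fun s ↦ .fun_sum fun i hi ↦ ?_) L.isOpen_compl_lattice_sdiff
  split_ifs with h
  · simp
  · exact .add (.add (.div (by fun_prop) (by fun_prop) (by
      intro x hx e
      exact hx ⟨by rw [sub_eq_zero.mp e]; exact i.2, by rw [sub_eq_zero.mp e]; exact h⟩))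
      (by fun_prop)) (by fun_prop)

theorem deriv_zetaExcept {z : ℂ} (hz : z ∈ ((L.lattice : Set ℂ) \ {0})ᶜ) :
    deriv L.zetaExcept z = -L.weierstrassPExcept 0 z := by
  have key : Set.EqOn (deriv L.zetaExcept) (fun z => -L.weierstrassPExcept 0 z)
      ((L.lattice : Set ℂ) \ {0})ᶜ := by
    refine (L.hasSumLocallyUniformly_zetaExcept.tendstoLocallyUniformlyOn.deriv
      (.of_forall fun s ↦ ?_) L.isOpen_compl_lattice_sdiff).unique ?_
    · refine .fun_sum fun i hi ↦ ?_
      split_ifs with h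
      · simp
      · exact .add (.add (.div (by fun_prop) (by fun_prop) (by
          intro x hx e
          exact hx ⟨by rw [sub_eq_zero.mp e]; exact i.2, by rw [sub_eq_zero.mp e]; exact h⟩))
          (by fun_prop)) (by fun_prop)
    · refine TendstoLocallyUniformlyOn.congr (f := fun z => -L.weierstrassPExcept 0 z)
        (F := fun (s : Finset L.lattice) z => -∑ l ∈ s,
          if l.1 = 0 then 0 else (1 / (z - l.1) ^ 2 - 1 / l.1 ^ 2)) ?_ ?_
      · exact (L.hasSumLocallyUniformly_weierstrassPExcept 0).tendstoLocallyUniformlyOn.neg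
      intro s w hw
      have hd : ∀ l ∈ s, HasDerivAt (fun z : ℂ =>
          if l.1 = 0 then 0 else (1 / (z - l.1) + 1 / l.1 + z / l.1 ^ 2))
          (-(if l.1 = 0 then 0 else (1 / (w - l.1) ^ 2 - 1 / l.1 ^ 2))) w := by
        intro l _
        split_ifs with h
        · simpa using hasDerivAt_const w (0 : ℂ)
        · have hwl : w - l.1 ≠ 0 := fun e =>
            hw ⟨by rw [sub_eq_zero.mp e]; exact l.2, by rw [sub_eq_zero.mp e]; exact h⟩
          have h1 := ((hasDerivAt_id w).sub_const l.1).inv hwl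
          have h2 := (hasDerivAt_id w).div_const (l.1 ^ 2)
          have := (h1.add_const (1 / l.1)).add h2
          refine (this.congr_deriv ?_).congr_of_eventuallyEq ?_
          · simp; ring
          · filter_upwards with z
            simp
      have := (HasDerivAt.fun_sum hd).deriv
      simp only [Finset.sum_neg_distrib] at this
      simpa [Function.comp_def] using this.symm
  exact key hz

theorem analyticAt_zetaExcept {z : ℂ} (hz : z ∈ ((L.lattice : Set ℂ) \ {0})ᶜ) :
    AnalyticAt ℂ L.zetaExcept z :=
  L.differentiableOn_zetaExcept.analyticOnNhd L.isOpen_compl_lattice_sdiff z hz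

theorem analyticAt_zetaExcept_zero : AnalyticAt ℂ L.zetaExcept 0 :=
  L.analyticAt_zetaExcept (by simp)

theorem zetaExcept_zero : L.zetaExcept 0 = 0 := by
  simp [zetaExcept]

theorem zeta_zero : L.zeta 0 = 0 := by
  simp [zeta, zetaExcept_zero]

theorem zetaExcept_neg (z : ℂ) : L.zetaExcept (-z) = -L.zetaExcept z := by
  simp only [zetaExcept]
  rw [← (Equiv.neg L.lattice).tsum_eq, ← tsum_neg]
  congr with l
  simp only [Equiv.neg_apply, NegMemClass.coe_neg, neg_eq_zero]
  split_ifs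
  · simp
  · have : -z - -(l : ℂ) = -(z - l) := by ring
    rw [this]
    simp only [one_div, inv_neg, neg_sq]
    ring

theorem zeta_neg (z : ℂ) : L.zeta (-z) = -L.zeta z := by
  simp [zeta, zetaExcept_neg]
  ring

theorem weierstrassP_eq_except_zero (z : ℂ) :
    L.weierstrassP z = L.weierstrassPExcept 0 z + 1 / z ^ 2 := by
  have := L.weierstrassPExcept_add 0 z
  simp only [ZeroMemClass.coe_zero, sub_zero] at this
  rw [← this]
  simp

theorem derivWeierstrassP_eq_except_zero (z : ℂ) :
    L.derivWeierstrassP z = L.derivWeierstrassPExcept 0 z - 2 / z ^ 3 := by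
  have := L.derivWeierstrassPExcept_def 0 z
  simp only [ZeroMemClass.coe_zero, sub_zero] at this
  rw [this]
  ring

theorem ne_zero_of_notMem {z : ℂ} (hz : z ∉ L.lattice) : z ≠ 0 := by
  rintro rfl
  exact hz (zero_mem _)

theorem neg_notMem {z : ℂ} (hz : z ∉ L.lattice) : -z ∉ L.lattice := by
  simpa using hz

theorem hasDerivAt_zeta {z : ℂ} (hz : z ∉ L.lattice) :
    HasDerivAt L.zeta (-L.weierstrassP z) z := by
  have h0 := L.ne_zero_of_notMem hz
  have hz' : z ∈ ((L.lattice : Set ℂ) \ {0})ᶜ := fun h => hz h.1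
  have h1 := (L.analyticAt_zetaExcept hz').differentiableAt.hasDerivAt
  rw [L.deriv_zetaExcept hz'] at h1
  have h2 := h1.add (hasDerivAt_inv h0)
  refine (h2.congr_deriv ?_).congr_of_eventuallyEq ?_
  · rw [weierstrassP_eq_except_zero]; simp; ring
  · filter_upwards with w
    simp [zeta]

theorem analyticAt_zeta {z : ℂ} (hz : z ∉ L.lattice) : AnalyticAt ℂ L.zeta z := by
  have hd : DifferentiableOn ℂ L.zeta (L.lattice : Set ℂ)ᶜ := fun w hw =>
    (L.hasDerivAt_zeta hw).differentiableAt.differentiableWithinAt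
  exact hd.analyticOnNhd L.isClosed_lattice.isOpen_compl z hz

theorem meromorphicAt_zeta_zero : MeromorphicAt L.zeta 0 := by
  have := L.analyticAt_zetaExcept_zero.meromorphicAt
  change MeromorphicAt (fun z => L.zetaExcept z + 1 / z) 0
  fun_prop

theorem hasDerivAt_weierstrassP {z : ℂ} (hz : z ∉ L.lattice) :
    HasDerivAt L.weierstrassP (L.derivWeierstrassP z) z := by
  have := (L.analyticOnNhd_weierstrassP z hz).differentiableAt.hasDerivAt
  rwa [L.deriv_weierstrassP] at this

theorem hasDerivAt_derivWeierstrassP {z : ℂ} (hz : z ∉ L.lattice) :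
    HasDerivAt L.derivWeierstrassP (6 * L.weierstrassP z ^ 2 - L.g₂ / 2) z :=
  ChiralHomology.hasDerivAt_derivWeierstrassP L hz

theorem countable_lattice : (L.lattice : Set ℂ).Countable :=
  countable_of_Lindelof_of_discrete (X := L.lattice)

/-- Poles of functions of `x` with poles at lattice points and translates by `y` do not
disconnect the plane. -/
theorem isPreconnected_compl_two (y : ℂ) :
    IsPreconnected {x : ℂ | x ∉ L.lattice ∧ x - y ∉ L.lattice} := by
  have h2 : ({x : ℂ | x - y ∈ L.lattice}).Countable :=
    L.countable_lattice.preimage (sub_left_injective (b := y))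
  have := ((L.countable_lattice.union h2).isConnected_compl_of_one_lt_rank (by simp)).2
  convert this using 1
  ext x
  simp

theorem isOpen_compl_two (y : ℂ) :
    IsOpen {x : ℂ | x ∉ L.lattice ∧ x - y ∉ L.lattice} := by
  have h := L.isClosed_lattice.isOpen_compl
  exact h.inter (h.preimage (by fun_prop : Continuous fun x : ℂ => x - y))

theorem eventually_nhdsNE_zero_notMem : ∀ᶠ z in 𝓝[≠] (0 : ℂ), z ∉ L.lattice := by
  filter_upwards [mem_nhdsWithin_of_mem_nhds (L.compl_lattice_sdiff_singleton_mem_nhds 0),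
    self_mem_nhdsWithin] with w hw hw0 hw'
  exact hw ⟨hw', hw0⟩

theorem eventually_notMem {c : ℂ} (hc : c ∉ L.lattice) : ∀ᶠ z in 𝓝 c, z ∉ L.lattice :=
  L.isClosed_lattice.isOpen_compl.mem_nhds hc

/-! ### Secant slopes and the addition theorem -/

/-- The secant slope `(℘'(x) + ℘'(y)) / (℘(x) - ℘(y))` in its zeta function form: as a function on
the configuration space it is regular, including at `x = -y`, and its only pole off the lattice
is along `x = y`. -/
def secant (x y : ℂ) : ℂ := 2 * (L.zeta (x - y) - L.zeta x + L.zeta y)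

/-- The Weierstrass function is not constant near its pole. -/
theorem eventually_weierstrassP_ne (c : ℂ) : ∀ᶠ z in 𝓝[≠] (0 : ℂ), L.weierstrassP z ≠ c := by
  have h0 : AnalyticAt ℂ (L.weierstrassPExcept 0) 0 := L.analyticAt_weierstrassPExcept 0
  have hc : ContinuousAt (fun z : ℂ => z ^ 2 * (L.weierstrassPExcept 0 z - c) + 1) 0 := by
    have := h0.continuousAt
    fun_prop
  have hne := hc.eventually_ne (y := 0) (by simp)
  filter_upwards [mem_nhdsWithin_of_mem_nhds hne, self_mem_nhdsWithin] with z hz hz0 e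
  apply hz
  have hz0 : z ≠ 0 := hz0
  rw [weierstrassP_eq_except_zero] at e
  field_simp at e
  linear_combination e

/-- The zeta function form of the addition theorem. -/
theorem secant_mul_sub {x y : ℂ} (hx : x ∉ L.lattice) (hy : y ∉ L.lattice)
    (hxy : x - y ∉ L.lattice) :
    (L.weierstrassP x - L.weierstrassP y) * L.secant x y =
      L.derivWeierstrassP x + L.derivWeierstrassP y := by
  -- Fix `w = x - y` and let `x` vary: `Q x = W x - U x * Z x` vanishes identically.
  obtain ⟨w, rfl⟩ : ∃ w, y = x - w := ⟨x - y, by ring⟩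
  have hw : w ∉ L.lattice := by simpa using hxy
  have hw' : -w ∉ L.lattice := L.neg_notMem hw
  set U : ℂ → ℂ := fun x => L.weierstrassP x - L.weierstrassP (x - w) with hU
  set W : ℂ → ℂ := fun x => L.derivWeierstrassP x + L.derivWeierstrassP (x - w) with hW
  set Z : ℂ → ℂ := fun x => 2 * (L.zeta w - L.zeta x + L.zeta (x - w)) with hZ
  set Ω : Set ℂ := {x : ℂ | x ∉ L.lattice ∧ x - w ∉ L.lattice} with hΩ
  have hsub : ∀ z : ℂ, HasDerivAt (fun x : ℂ => x - w) 1 z := fun z =>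
    (hasDerivAt_id z).sub_const w
  have dU : ∀ z ∈ Ω, HasDerivAt U (W z - 2 * L.derivWeierstrassP (z - w)) z := by
    intro z hz
    have h1 := (L.hasDerivAt_weierstrassP hz.2).comp z (hsub z)
    exact ((L.hasDerivAt_weierstrassP hz.1).sub h1).congr_deriv (by simp [hW]; ring)
  have dW : ∀ z ∈ Ω, HasDerivAt W (6 * L.weierstrassP z ^ 2 + 6 * L.weierstrassP (z - w) ^ 2
      - L.g₂) z := by
    intro z hz
    have h1 := (L.hasDerivAt_derivWeierstrassP hz.2).comp z (hsub z)
    exact ((L.hasDerivAt_derivWeierstrassP hz.1).add h1).congr_deriv (by ring)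
  have dZ : ∀ z ∈ Ω, HasDerivAt Z (2 * U z) z := by
    intro z hz
    have h1 := (L.hasDerivAt_zeta hz.2).comp z (hsub z)
    have h2 := (((L.hasDerivAt_zeta hz.1).const_sub (L.zeta w)).add h1).const_mul 2
    exact h2.congr_deriv (by simp [hU]; ring)
  have hΩo : IsOpen Ω := L.isOpen_compl_two w
  have hQan : AnalyticOnNhd ℂ (fun x => W x - U x * Z x) Ω := by
    have : DifferentiableOn ℂ (fun x => W x - U x * Z x) Ω := fun z hz =>
      ((dW z hz).sub ((dU z hz).mul (dZ z hz))).differentiableAt.differentiableWithinAt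
    exact this.analyticOnNhd hΩo
  -- `z² U` and `z² Q` are analytic at the origin
  set a : ℂ → ℂ := fun z => 1 + z ^ 2 * (L.weierstrassPExcept 0 z - L.weierstrassP (z - w))
  set q : ℂ → ℂ := fun z => z ^ 2 * (L.derivWeierstrassPExcept 0 z + L.derivWeierstrassP (z - w))
    + 2 * z * (L.weierstrassPExcept 0 z - L.weierstrassP (z - w))
    - 2 * a z * (L.zeta w - L.zetaExcept z + L.zeta (z - w))
  have hΩ0 : ∀ᶠ z in 𝓝[≠] (0 : ℂ), z ∈ Ω := by
    have h2 : ∀ᶠ z in 𝓝 (0 : ℂ), z - w ∉ L.lattice :=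
      ContinuousAt.eventually_mem (f := fun z : ℂ => z - w) (by fun_prop)
        (L.isClosed_lattice.isOpen_compl.mem_nhds (by simpa using hw))
    filter_upwards [L.eventually_nhdsNE_zero_notMem, mem_nhdsWithin_of_mem_nhds h2] with z h1 h2
      using ⟨h1, h2⟩
  have haU : ∀ z : ℂ, z ≠ 0 → a z = z ^ 2 * U z := by
    intro z hz
    simp only [a, hU, L.weierstrassP_eq_except_zero z]
    field_simp
    ring
  have hqQ : ∀ z : ℂ, z ≠ 0 → q z = z ^ 2 * (W z - U z * Z z) := by
    intro z hz
    have e1 : z ^ 2 * U z = a z := (haU z hz).symm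
    have e2 : z ^ 2 * (W z - U z * Z z) = z ^ 2 * W z - a z * Z z := by rw [← e1]; ring
    rw [e2]
    simp only [q, hW, hZ, zeta, L.derivWeierstrassP_eq_except_zero z]
    simp only [a]
    field_simp
    ring
  have aP : AnalyticAt ℂ (L.weierstrassPExcept 0) 0 := L.analyticAt_weierstrassPExcept 0
  have aP' : AnalyticAt ℂ (L.derivWeierstrassPExcept 0) 0 := L.analyticAt_derivWeierstrassPExcept 0
  have aZ := L.analyticAt_zetaExcept_zero
  have bP : AnalyticAt ℂ (fun z => L.weierstrassP (z - w)) 0 :=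
    AnalyticAt.fun_comp_of_eq (L.analyticOnNhd_weierstrassP (-w) hw') (by fun_prop) (by simp)
  have bP' : AnalyticAt ℂ (fun z => L.derivWeierstrassP (z - w)) 0 :=
    AnalyticAt.fun_comp_of_eq (L.analyticOnNhd_derivWeierstrassP (-w) hw') (by fun_prop) (by simp)
  have bZ : AnalyticAt ℂ (fun z => L.zeta (z - w)) 0 :=
    AnalyticAt.fun_comp_of_eq (L.analyticAt_zeta hw') (by fun_prop) (by simp)
  have ha : AnalyticAt ℂ a 0 := by fun_prop
  have hq : AnalyticAt ℂ q 0 := by fun_prop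
  have ha0 : a 0 ≠ 0 := by simp [a]
  have hq0 : q 0 = 0 := by simp [q, zetaExcept_zero, zeta_neg]
  have hr : AnalyticAt ℂ (fun z => q z / a z) 0 := hq.div ha ha0
  -- `q / a` has derivative zero in a punctured neighbourhood, by the differential equations
  have hdr : ∀ᶠ z in 𝓝[≠] (0 : ℂ), deriv (fun z => q z / a z) z = 0 := by
    have hane := ha.continuousAt.eventually_ne ha0
    rw [eventually_nhdsWithin_iff]
    have h1 := hane.eventually_nhds
    have h2 := (eventually_nhdsWithin_iff.mp hΩ0)
    filter_upwards [h1, h2] with z hz1 hz2 hz0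
    have hzΩ := hz2 hz0
    have hz0 : z ≠ 0 := hz0
    have hUz : U z ≠ 0 := by
      have := hz1.self_of_nhds
      rw [haU z hz0] at this
      exact right_ne_zero_of_mul this
    have hev : (fun z => q z / a z) =ᶠ[𝓝 z] fun z => W z / U z - Z z := by
      filter_upwards [hz1, isOpen_ne.mem_nhds hz0] with x hx hx0
      have hx0 : x ≠ 0 := hx0
      have hUx : U x ≠ 0 := by
        rw [haU x hx0] at hx
        exact right_ne_zero_of_mul hx
      rw [hqQ x hx0, haU x hx0]
      field_simp
    rw [hev.deriv_eq]
    have := (((dW z hzΩ).div (dU z hzΩ) hUz).sub (dZ z hzΩ)).deriv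
    refine (this.trans ?_)
    have r1 := L.derivWeierstrassP_sq z hzΩ.1
    have r2 := L.derivWeierstrassP_sq (z - w) hzΩ.2
    rw [sub_eq_zero, div_eq_iff (pow_ne_zero 2 hUz)]
    simp only [hU, hW]
    linear_combination -r1 + r2
  have hr0 : ∀ᶠ z in 𝓝 (0 : ℂ), q z / a z = 0 := by
    have hd0 : ∀ᶠ z in 𝓝 (0 : ℂ), deriv (fun z => q z / a z) z = 0 :=
      hr.deriv.frequently_zero_iff_eventually_zero.mp hdr.frequently
    obtain ⟨ε, hε, hball⟩ := Metric.eventually_nhds_iff_ball.mp (hd0.and hr.eventually_analyticAt)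
    filter_upwards [Metric.ball_mem_nhds (0 : ℂ) hε] with z hz
    have := Metric.isOpen_ball.is_const_of_deriv_eq_zero (convex_ball (0 : ℂ) ε).isPreconnected
      (fun x hx => (hball x hx).2.differentiableAt.differentiableWithinAt)
      (fun x hx => (hball x hx).1) hz (Metric.mem_ball_self hε)
    simpa [hq0] using this
  have hQ0 : ∀ᶠ z in 𝓝[≠] (0 : ℂ), W z - U z * Z z = 0 := by
    filter_upwards [mem_nhdsWithin_of_mem_nhds hr0, mem_nhdsWithin_of_mem_nhds
      (ha.continuousAt.eventually_ne ha0), self_mem_nhdsWithin] with z h1 h2 h3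
    have h3 : z ≠ 0 := h3
    have := (div_eq_zero_iff.mp h1).resolve_right h2
    rw [hqQ z h3] at this
    exact (mul_eq_zero.mp this).resolve_left (pow_ne_zero 2 h3)
  obtain ⟨z₀, hz₀, hz₀Ω, hne⟩ := ((eventually_nhdsWithin_of_eventually_nhds
    (eventually_nhdsWithin_iff.mp hQ0).eventually_nhds).and
    (hΩ0.and self_mem_nhdsWithin)).exists
  have hz₀' : ∀ᶠ z in 𝓝 z₀, W z - U z * Z z = 0 := by
    filter_upwards [hz₀, isOpen_ne.mem_nhds hne] with z h1 h2 using h1 h2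
  have := hQan.eqOn_of_preconnected_of_eventuallyEq (g := fun _ => 0) (fun _ _ => analyticAt_const)
    (L.isPreconnected_compl_two w) hz₀Ω hz₀'
  have := this (show x ∈ Ω from ⟨hx, hy⟩)
  simp only [hU, hW, hZ, secant] at this ⊢
  rw [sub_sub_cancel]
  linear_combination -this

/-- The second presentation of the secant slope, valid also where `℘(x) = ℘(y)`. -/
theorem sub_mul_secant {x y : ℂ} (hx : x ∉ L.lattice) (hy : y ∉ L.lattice)
    (hxy : x - y ∉ L.lattice) :
    (L.derivWeierstrassP x - L.derivWeierstrassP y) * L.secant x y =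
      4 * (L.weierstrassP x ^ 2 + L.weierstrassP x * L.weierstrassP y + L.weierstrassP y ^ 2)
        - L.g₂ := by
  set Ω : Set ℂ := {x : ℂ | x ∉ L.lattice ∧ x - y ∉ L.lattice} with hΩ
  have hA : AnalyticOnNhd ℂ (fun x => L.weierstrassP x - L.weierstrassP y) Ω := fun z hz =>
    (L.analyticOnNhd_weierstrassP z hz.1).sub analyticAt_const
  have hB : AnalyticOnNhd ℂ (fun x => (L.derivWeierstrassP x - L.derivWeierstrassP y) *
      L.secant x y - (4 * (L.weierstrassP x ^ 2 + L.weierstrassP x * L.weierstrassP y +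
        L.weierstrassP y ^ 2) - L.g₂)) Ω := by
    intro z hz
    have h1 := L.analyticOnNhd_weierstrassP z hz.1
    have h2 := L.analyticOnNhd_derivWeierstrassP z hz.1
    have h3 := L.analyticAt_zeta hz.1
    have h4 : AnalyticAt ℂ (fun x => L.zeta (x - y)) z :=
      AnalyticAt.fun_comp_of_eq (L.analyticAt_zeta hz.2) (by fun_prop) rfl
    unfold secant
    fun_prop
  have hAB : ∀ z ∈ Ω, (L.weierstrassP z - L.weierstrassP y) *
      ((L.derivWeierstrassP z - L.derivWeierstrassP y) * L.secant z y -
        (4 * (L.weierstrassP z ^ 2 + L.weierstrassP z * L.weierstrassP y +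
          L.weierstrassP y ^ 2) - L.g₂)) = 0 := by
    intro z hz
    have e := L.secant_mul_sub hz.1 hy hz.2
    have r1 := L.derivWeierstrassP_sq z hz.1
    have r2 := L.derivWeierstrassP_sq y hy
    linear_combination (L.derivWeierstrassP z - L.derivWeierstrassP y) * e + r1 - r2
  rcases AnalyticOnNhd.eq_zero_or_eq_zero_of_mul_eq_zero hA hB (fun z hz => hAB z hz)
    (L.isPreconnected_compl_two y) with h | h
  · exfalso
    have h0 : ∀ᶠ z in 𝓝[≠] (0 : ℂ), z - y ∉ L.lattice :=
      mem_nhdsWithin_of_mem_nhds (ContinuousAt.eventually_mem (f := fun z : ℂ => z - y)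
        (by fun_prop) (L.isClosed_lattice.isOpen_compl.mem_nhds (by simpa using hy)))
    obtain ⟨z, h1, h2, h3⟩ := ((L.eventually_weierstrassP_ne (L.weierstrassP y)).and
      (L.eventually_nhdsNE_zero_notMem.and h0)).exists
    exact h1 (sub_eq_zero.mp (h z ⟨h2, h3⟩))
  · exact sub_eq_zero.mp (h x ⟨hx, hxy⟩)

/-! ### Uniformization of the affine cubic -/

/-- The affine Weierstrass cubic is smooth: the two partial derivatives do not vanish together. -/
theorem smooth_weierstrass {x : ℂ} (hx : x ∉ L.lattice) (h0 : L.derivWeierstrassP x = 0) :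
    12 * L.weierstrassP x ^ 2 - L.g₂ ≠ 0 := by
  intro h1
  have hA := L.analyticOnNhd_derivWeierstrassP x hx
  have hev := L.eventually_notMem hx
  -- `℘''' = 12 ℘ ℘'`, so a double zero of `℘'` would have infinite order
  have hd1 : deriv L.derivWeierstrassP =ᶠ[𝓝 x] fun z => 6 * L.weierstrassP z ^ 2 - L.g₂ / 2 := by
    filter_upwards [hev] with z hz using (L.hasDerivAt_derivWeierstrassP hz).deriv
  have hd2 : deriv (deriv L.derivWeierstrassP) =ᶠ[𝓝 x]
      fun z => 12 * L.weierstrassP z * L.derivWeierstrassP z := by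
    filter_upwards [hd1.eventuallyEq_nhds, hev] with z hz hz'
    rw [hz.deriv_eq]
    have := ((((L.hasDerivAt_weierstrassP hz').pow 2).const_mul 6).sub_const (L.g₂ / 2)).deriv
    refine Eq.trans ?_ (this.trans ?_)
    · rfl
    · simp; ring
  have o1 := hA.analyticOrderAt_deriv_add_one
  have o2 := hA.deriv.analyticOrderAt_deriv_add_one
  rw [analyticOrderAt_congr hd2] at o2
  have e1 : deriv L.derivWeierstrassP x = 0 := by
    rw [hd1.self_of_nhds]
    linear_combination h1 / 2
  simp only [h0, e1, sub_zero] at o1 o2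
  have hP := L.analyticOnNhd_weierstrassP x hx
  have o3 : analyticOrderAt (fun z => 12 * L.weierstrassP z * L.derivWeierstrassP z) x =
      analyticOrderAt (fun z => 12 * L.weierstrassP z) x +
        analyticOrderAt L.derivWeierstrassP x :=
    analyticOrderAt_mul (by fun_prop) hA
  rw [o3] at o2
  have htop : analyticOrderAt L.derivWeierstrassP x = ⊤ := by
    change _ = analyticOrderAt L.derivWeierstrassP x at o1
    change _ = analyticOrderAt (deriv L.derivWeierstrassP) x at o2
    generalize analyticOrderAt L.derivWeierstrassP x = A at *
    generalize analyticOrderAt (deriv L.derivWeierstrassP) x = B at *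
    generalize analyticOrderAt (fun z => 12 * L.weierstrassP z) x = D at *
    by_contra hA
    subst o1
    induction B using ENat.recTopCoe with
    | top => simp at hA
    | coe b =>
      induction D using ENat.recTopCoe with
      | top => simp at o2
      | coe d =>
        norm_cast at o2
        omega
  have hz := analyticOrderAt_eq_top.mp htop
  have hconn : IsPreconnected ((L.lattice : Set ℂ)ᶜ) :=
    (L.countable_lattice.isConnected_compl_of_one_lt_rank (by simp)).2
  have hv := L.analyticOnNhd_derivWeierstrassP.eqOn_of_preconnected_of_eventuallyEq
    (g := fun _ => 0) (fun _ _ => analyticAt_const) hconn hx hz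
  obtain ⟨z, h2, h3⟩ := ((L.eventually_weierstrassP_ne (L.weierstrassP x)).and
    L.eventually_nhdsNE_zero_notMem).exists
  refine h2 (L.isClosed_lattice.isOpen_compl.is_const_of_deriv_eq_zero hconn
    L.differentiableOn_weierstrassP (fun w hw => ?_) h3 hx)
  rw [L.deriv_weierstrassP]
  exact hv hw

theorem exists_weierstrassP_eq (c : ℂ) : ∃ z ∉ L.lattice, L.weierstrassP z = c := by
  classical
  -- otherwise `1 / (℘ - c)` would be a bounded entire function
  by_contra! hne
  set g : ℂ → ℂ := fun z => if z ∈ L.lattice then 0 else (L.weierstrassP z - c)⁻¹ with hg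
  have hper : ∀ z, ∀ w ∈ L.lattice, g (z + w) = g z := by
    intro z w hw
    have h1 : z + w ∈ L.lattice ↔ z ∈ L.lattice := L.lattice.add_mem_iff_left hw
    simp only [hg, h1]
    rw [L.weierstrassP_add_coe z ⟨w, hw⟩]
  have h0 : DifferentiableAt ℂ g 0 := by
    have h0 : AnalyticAt ℂ (L.weierstrassPExcept 0) 0 := L.analyticAt_weierstrassPExcept 0
    have hd : DifferentiableAt ℂ
        (fun z : ℂ => z ^ 2 / (z ^ 2 * (L.weierstrassPExcept 0 z - c) + 1)) 0 := by
      have := h0.differentiableAt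
      refine .div (by fun_prop) (by fun_prop) (by simp)
    refine hd.congr_of_eventuallyEq ?_
    have := L.eventually_nhdsNE_zero_notMem
    rw [eventually_nhdsWithin_iff] at this
    filter_upwards [this] with z hz
    by_cases hz0 : z = 0
    · simp [hg, hz0]
    · have h1 := hz hz0
      have h2 := sub_ne_zero.mpr (hne z h1)
      simp only [hg, h1, if_false]
      have e : z ^ 2 * (L.weierstrassPExcept 0 z - c) + 1 = z ^ 2 * (L.weierstrassP z - c) := by
        rw [weierstrassP_eq_except_zero]
        field_simp
        ring
      rw [e]
      field_simp
  have hdiff : Differentiable ℂ g := by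
    intro z
    by_cases hz : z ∈ L.lattice
    · have : g = fun x => g (x - z) := by
        funext x
        rw [sub_eq_add_neg, hper x _ (neg_mem hz)]
      rw [this]
      exact DifferentiableAt.fun_comp' z (by simpa using h0) (by fun_prop)
    · have h1 : DifferentiableAt ℂ (fun x => (L.weierstrassP x - c)⁻¹) z :=
        ((L.hasDerivAt_weierstrassP hz).differentiableAt.sub_const c).inv
          (sub_ne_zero.mpr (hne z hz))
      refine h1.congr_of_eventuallyEq ?_
      filter_upwards [L.eventually_notMem hz] with x hx
      simp [hg, hx]
  obtain ⟨z, hz⟩ := L.eventually_nhdsNE_zero_notMem.exists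
  have := hdiff.apply_eq_apply_of_bounded (IsZLattice.isCompact_range_of_periodic L.lattice _
    hdiff.continuous hper).isBounded z 0
  simp only [hg, hz, if_false, zero_mem, if_true, inv_eq_zero] at this
  exact hne z hz (sub_eq_zero.mp this)

/-- Every point of the affine cubic is uniformized by `(℘, ℘')`. -/
theorem exists_uniformization {u v : ℂ} (h : v ^ 2 = 4 * u ^ 3 - L.g₂ * u - L.g₃) :
    ∃ z ∉ L.lattice, L.weierstrassP z = u ∧ L.derivWeierstrassP z = v := by
  obtain ⟨z, hz, rfl⟩ := L.exists_weierstrassP_eq u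
  rw [← L.derivWeierstrassP_sq z hz] at h
  rcases sq_eq_sq_iff_eq_or_eq_neg.mp h with h | h
  · exact ⟨z, hz, rfl, h.symm⟩
  · exact ⟨-z, L.neg_notMem hz, by simp, by simp [h]⟩

theorem sub_mem_of_coords_eq {x y : ℂ} (hx : x ∉ L.lattice) (hy : y ∉ L.lattice)
    (hu : L.weierstrassP x = L.weierstrassP y)
    (hv : L.derivWeierstrassP x = L.derivWeierstrassP y) :
    x - y ∈ L.lattice := by
  by_contra hxy
  have h1 := L.secant_mul_sub hx hy hxy
  have h2 := L.sub_mul_secant hx hy hxy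
  rw [hu, hv, sub_self, zero_mul] at h1
  rw [hu, hv, sub_self, zero_mul] at h2
  exact L.smooth_weierstrass hy (by linear_combination -h1 / 2) (by linear_combination -h2)

theorem secant_comm (x y : ℂ) : L.secant y x = -L.secant x y := by
  have : y - x = -(x - y) := by ring
  simp only [secant, this, zeta_neg]
  ring

theorem weierstrassP_eq_of_sub_mem {x y : ℂ} (h : x - y ∈ L.lattice) :
    L.weierstrassP x = L.weierstrassP y := by
  have := L.weierstrassP_add_coe y ⟨x - y, h⟩
  simpa using this

theorem derivWeierstrassP_eq_of_sub_mem {x y : ℂ} (h : x - y ∈ L.lattice) :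
    L.derivWeierstrassP x = L.derivWeierstrassP y := by
  have := L.derivWeierstrassP_add_coe y ⟨x - y, h⟩
  simpa using this

end PeriodPair

/-! ### Laurent series of germs at the origin -/

namespace ChiralHomology

/-- On a punctured neighbourhood of the origin, `φ t = t ^ (-N) * ∑_k p_k t ^ k`. -/
def HasLaurent (φ : ℂ → ℂ) (N : ℕ) (p : PowerSeries ℂ) : Prop :=
  ∀ᶠ t in 𝓝[≠] (0 : ℂ), HasSum (fun k : ℕ => PowerSeries.coeff k p * t ^ k) (t ^ N * φ t)

/-- The coefficient of `t ^ m` in the Laurent series `t ^ (-N) * p`. -/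
def laurentAt {R : Type*} [Semiring R] (N : ℕ) (p : PowerSeries R) (m : ℤ) : R :=
  if 0 ≤ m + N then PowerSeries.coeff (m + N).toNat p else 0

theorem laurentAt_sub {R : Type*} [Semiring R] (N : ℕ) (p : PowerSeries R) (k : ℕ) :
    laurentAt N p (k - N) = PowerSeries.coeff k p := by
  simp [laurentAt]

theorem laurentAt_of_lt {R : Type*} [Semiring R] {N : ℕ} (p : PowerSeries R) {m : ℤ}
    (h : m < -N) : laurentAt N p m = 0 := by
  rw [laurentAt, if_neg (by omega)]

theorem laurentAt_map {R S : Type*} [Semiring R] [Semiring S] (f : R →+* S) (N : ℕ)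
    (p : PowerSeries R) (m : ℤ) : laurentAt N (p.map f) m = f (laurentAt N p m) := by
  simp only [laurentAt]
  split_ifs <;> simp

theorem laurentAt_X_pow_mul {R : Type*} [Semiring R] (N M : ℕ) (p : PowerSeries R) (m : ℤ) :
    laurentAt (N + M) (PowerSeries.X ^ M * p) m = laurentAt N p m := by
  simp only [laurentAt]
  rw [PowerSeries.coeff_X_pow_mul']
  split_ifs with h1 h2 h3 h3 h4
  · congr 2; omega
  · omega
  · omega
  · rfl
  · omega
  · rfl

/-- The Cauchy product; the interval `[-K, T]` is any one containing the support of the sum. -/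
theorem laurentAt_mul {R : Type*} [Semiring R] (N M : ℕ) (p q : PowerSeries R) (r : ℤ)
    {K T : ℤ} (hN : N ≤ K) (hT : r + M ≤ T) :
    laurentAt (N + M) (p * q) r =
      ∑ m ∈ Finset.Icc (-K) T, laurentAt N p m * laurentAt M q (r - m) := by
  by_cases h : 0 ≤ r + (N + M : ℕ)
  · obtain ⟨k, hk⟩ := Int.eq_ofNat_of_zero_le h
    rw [show r = k - (N + M : ℕ) by omega, laurentAt_sub, PowerSeries.coeff_mul]
    rw [Finset.Nat.sum_antidiagonal_eq_sum_range_succ_mk]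
    have hinj : Function.Injective fun i : ℕ => (i : ℤ) - N := fun a b h => by simpa using h
    trans ∑ m ∈ (Finset.range k.succ).map ⟨_, hinj⟩,
      laurentAt N p m * laurentAt M q ((k - (N + M : ℕ) : ℤ) - m)
    · rw [Finset.sum_map]
      refine Finset.sum_congr rfl fun i hi => ?_
      have hi := Finset.mem_range_succ_iff.mp hi
      simp only [Function.Embedding.coeFn_mk, laurentAt_sub]
      rw [show ((k : ℤ) - (N + M : ℕ) - (i - N)) = (k - i : ℕ) - M by push_cast [hi]; ring,
        laurentAt_sub]
    · refine Finset.sum_subset ?_ ?_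
      · intro m hm
        simp only [Finset.mem_map, Finset.mem_range, Function.Embedding.coeFn_mk] at hm
        obtain ⟨i, hi, rfl⟩ := hm
        rw [Finset.mem_Icc]
        push_cast at hk
        omega
      · intro m _ hm
        by_cases h1 : m < -N
        · rw [laurentAt_of_lt _ h1, zero_mul]
        · rw [laurentAt_of_lt q, mul_zero]
          by_contra h2
          refine hm ?_
          simp only [Finset.mem_map, Finset.mem_range, Function.Embedding.coeFn_mk]
          refine ⟨(m + N).toNat, ?_, ?_⟩ <;> push_cast at * <;> omega
  · rw [laurentAt_of_lt _ (by omega)]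
    symm
    refine Finset.sum_eq_zero fun m _ => ?_
    by_cases hm : m < -N
    · rw [laurentAt_of_lt _ hm, zero_mul]
    · rw [laurentAt_of_lt (m := r - m) _ (by push_cast at h; omega), mul_zero]

theorem hasSum_of_eq {ι : Type*} {f g : ι → ℂ} {a b : ℂ} (h : HasSum f a) (e : ∀ i, g i = f i)
    (e' : b = a) : HasSum g b := by
  rwa [e', funext e]

theorem tendsto_mul_nhdsNE_zero {α : ℂ} (hα : α ≠ 0) :
    Tendsto (fun t : ℂ => α * t) (𝓝[≠] 0) (𝓝[≠] 0) := by
  refine tendsto_nhdsWithin_iff.mpr ⟨?_, ?_⟩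
  · have : Continuous fun t : ℂ => α * t := by fun_prop
    exact (by simpa using this.tendsto 0 :
      Tendsto (fun t : ℂ => α * t) (𝓝 0) (𝓝 0)).mono_left nhdsWithin_le_nhds
  · filter_upwards [self_mem_nhdsWithin] with t ht
    exact mul_ne_zero hα ht

theorem tendsto_const_add_nhds_zero (c : ℂ) : Tendsto (fun t : ℂ => c + t) (𝓝 0) (𝓝 c) := by
  have : Continuous fun t : ℂ => c + t := by fun_prop
  simpa using this.tendsto 0

namespace HasLaurent

variable {φ ψ : ℂ → ℂ} {N M : ℕ} {p q : PowerSeries ℂ}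

theorem congr (h : HasLaurent φ N p) (e : ∀ᶠ t in 𝓝[≠] (0 : ℂ), ψ t = φ t) :
    HasLaurent ψ N p := by
  filter_upwards [h, e] with t h1 h2
  rwa [h2]

theorem add (h : HasLaurent φ N p) (h' : HasLaurent ψ N q) :
    HasLaurent (fun t => φ t + ψ t) N (p + q) := by
  filter_upwards [h, h'] with t h1 h2
  simpa [add_mul, mul_add] using h1.add h2

theorem mul (h : HasLaurent φ N p) (h' : HasLaurent ψ M q) :
    HasLaurent (fun t => φ t * ψ t) (N + M) (p * q) := by
  filter_upwards [h, h'] with t h1 h2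
  have s1 := summable_norm_iff.mpr h1.summable
  have s2 := summable_norm_iff.mpr h2.summable
  have h3 := summable_norm_sum_mul_antidiagonal_of_summable_norm s1 s2
  have h4 := tsum_mul_tsum_eq_tsum_sum_antidiagonal_of_summable_norm s1 s2
  have h5 := (summable_norm_iff.mp h3).hasSum
  rw [← h4, h1.tsum_eq, h2.tsum_eq] at h5
  refine hasSum_of_eq h5 ?_ ?_
  · intro k
    rw [PowerSeries.coeff_mul, Finset.sum_mul]
    refine Finset.sum_congr rfl fun x hx => ?_
    rw [← Finset.HasAntidiagonal.mem_antidiagonal.mp hx, pow_add]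
    ring
  · ring

theorem const (c : ℂ) : HasLaurent (fun _ => c) 0 (PowerSeries.C c) := by
  filter_upwards with t
  have := hasSum_single (f := fun k : ℕ => PowerSeries.coeff k (PowerSeries.C c) * t ^ k) 0
    (fun k hk => by simp [PowerSeries.coeff_C, hk])
  simpa using this

theorem const_mul (h : HasLaurent φ N p) (c : ℂ) :
    HasLaurent (fun t => c * φ t) N (PowerSeries.C c * p) := by
  simpa using (const c).mul h

theorem neg (h : HasLaurent φ N p) : HasLaurent (fun t => -φ t) N (-p) := by
  simpa using h.const_mul (-1)

theorem sub (h : HasLaurent φ N p) (h' : HasLaurent ψ N q) :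
    HasLaurent (fun t => φ t - ψ t) N (p - q) := by
  simpa [sub_eq_add_neg] using h.add h'.neg

/-- An expansion can be normalized by a larger power of `t`. -/
theorem raise (h : HasLaurent φ N p) (M : ℕ) :
    HasLaurent φ (N + M) (PowerSeries.X ^ M * p) := by
  filter_upwards [h] with t h1
  have h2 := h1.mul_left (t ^ M)
  rw [← Function.Injective.hasSum_iff (add_left_injective M)]
  · refine hasSum_of_eq h2 ?_ ?_
    · intro k
      simp only [Function.comp_apply, PowerSeries.coeff_X_pow_mul]
      ring
    · ring
  · intro k hk
    have : ¬ M ≤ k := fun h => hk ⟨k - M, by simp; omega⟩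
    rw [PowerSeries.coeff_X_pow_mul', if_neg this, zero_mul]

theorem comp_neg (h : HasLaurent φ N p) :
    HasLaurent (fun t => φ (-t)) N ((-1) ^ N * PowerSeries.rescale (-1) p) := by
  have ht : Tendsto (fun t : ℂ => -t) (𝓝[≠] 0) (𝓝[≠] 0) := by
    simpa using tendsto_mul_nhdsNE_zero (neg_ne_zero.mpr (one_ne_zero (α := ℂ)))
  filter_upwards [ht.eventually h] with t h1
  have h2 := h1.mul_left ((-1) ^ N)
  refine hasSum_of_eq h2 ?_ ?_
  · intro k
    have : ((-1) ^ N : PowerSeries ℂ) = PowerSeries.C ((-1) ^ N) := by simp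
    rw [this, PowerSeries.coeff_C_mul, PowerSeries.coeff_rescale, neg_pow t k]
    ring
  · rw [neg_pow t N, ← mul_assoc, ← mul_assoc, ← mul_pow]
    simp

/-- The germ `t ^ N * φ t`, extended over the origin, is analytic. -/
theorem hasFPowerSeriesAt (h : HasLaurent φ N p) :
    HasFPowerSeriesAt (Function.update (fun t => t ^ N * φ t) 0 (PowerSeries.coeff 0 p))
      (FormalMultilinearSeries.ofScalars ℂ fun k => PowerSeries.coeff k p) 0 := by
  rw [hasFPowerSeriesAt_iff]
  rw [HasLaurent, eventually_nhdsWithin_iff] at h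
  filter_upwards [h] with t ht
  by_cases ht0 : t = 0
  · subst ht0
    simpa [FormalMultilinearSeries.coeff_ofScalars] using hasSum_single
      (f := fun k : ℕ => (0 : ℂ) ^ k * PowerSeries.coeff k p) 0 (fun k hk => by simp [hk])
  · have := ht ht0
    simpa [FormalMultilinearSeries.coeff_ofScalars, ht0, mul_comm] using this

theorem of_hasFPowerSeriesAt {g : ℂ → ℂ} {P : FormalMultilinearSeries ℂ ℂ ℂ}
    (h : HasFPowerSeriesAt g P 0) : HasLaurent g 0 (PowerSeries.mk fun k => P.coeff k) := by
  rw [hasFPowerSeriesAt_iff] at h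
  filter_upwards [mem_nhdsWithin_of_mem_nhds h] with t ht
  simpa [mul_comm] using ht

theorem of_analyticAt {g : ℂ → ℂ} (h : AnalyticAt ℂ g 0) :
    HasLaurent g 0 (PowerSeries.mk fun k => iteratedDeriv k g 0 / (k.factorial : ℂ)) := by
  simpa [FormalMultilinearSeries.coeff_ofScalars] using of_hasFPowerSeriesAt h.hasFPowerSeriesAt

theorem of_meromorphicAt (h : MeromorphicAt φ 0) : ∃ N p, HasLaurent φ N p := by
  obtain ⟨n, hn⟩ := h
  refine ⟨n, PowerSeries.mk fun k => iteratedDeriv k (fun z => (z - 0) ^ n • φ z) 0 /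
    (k.factorial : ℂ), (of_analyticAt hn).mono fun t ht => ?_⟩
  exact hasSum_of_eq ht (fun _ => rfl) (by simp)

theorem unique (h : HasLaurent φ N p) (h' : HasLaurent φ N q) : p = q := by
  have h1 := h.hasFPowerSeriesAt
  have h2 := h'.hasFPowerSeriesAt
  have hev : Function.update (fun t => t ^ N * φ t) 0 (PowerSeries.coeff 0 p) =ᶠ[𝓝[≠] 0]
      Function.update (fun t => t ^ N * φ t) 0 (PowerSeries.coeff 0 q) := by
    filter_upwards [self_mem_nhdsWithin] with t ht
    have ht : t ≠ 0 := ht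
    simp [ht]
  have h0 : PowerSeries.coeff 0 p = PowerSeries.coeff 0 q := by
    have t1 := (h1.continuousAt.tendsto).mono_left (nhdsWithin_le_nhds (s := {(0 : ℂ)}ᶜ))
    have t2 := (h2.continuousAt.tendsto).mono_left (nhdsWithin_le_nhds (s := {(0 : ℂ)}ᶜ))
    simpa using tendsto_nhds_unique (t1.congr' hev) t2
  rw [h0] at h1
  have := h1.eq_formalMultilinearSeries h2
  ext k
  simpa [FormalMultilinearSeries.coeff_ofScalars] using
    congrArg (fun P : FormalMultilinearSeries ℂ ℂ ℂ => P.coeff k) this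

theorem laurentAt_unique (h : HasLaurent φ N p) (h' : HasLaurent φ M q) (m : ℤ) :
    laurentAt N p m = laurentAt M q m := by
  have h1 := h.raise M
  have h2 := h'.raise N
  rw [add_comm] at h2
  rw [← laurentAt_X_pow_mul N M, ← laurentAt_X_pow_mul M N, h1.unique h2, add_comm M N]

theorem analyticAt_eventually (h : HasLaurent φ N p) : ∀ᶠ t in 𝓝[≠] (0 : ℂ), AnalyticAt ℂ φ t := by
  have h1 := h.hasFPowerSeriesAt.analyticAt.eventually_analyticAt
  filter_upwards [mem_nhdsWithin_of_mem_nhds h1, self_mem_nhdsWithin] with t h2 h3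
  have h3 : t ≠ 0 := h3
  have h4 : AnalyticAt ℂ (fun s : ℂ => (s ^ N)⁻¹) t :=
    (analyticAt_id.pow N).inv (pow_ne_zero N h3)
  refine (h4.mul h2).congr ?_
  filter_upwards [isOpen_ne.mem_nhds h3] with s hs
  have hs : s ≠ 0 := hs
  simp [hs]

/-- From `(t ^ (-N) * g)' = t ^ (-(N + 1)) * (t * g' - N * g)`. -/
theorem deriv (h : HasLaurent φ N p) :
    HasLaurent (deriv φ) (N + 1)
      (PowerSeries.X * PowerSeries.derivative ℂ p - (N : PowerSeries ℂ) * p) := by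
  set g := Function.update (fun t => t ^ N * φ t) 0 (PowerSeries.coeff 0 p) with hg
  have hgp : HasLaurent g 0 p := by
    filter_upwards [h, self_mem_nhdsWithin] with t h1 h2
    have h2 : t ≠ 0 := h2
    simpa [hg, h2] using h1
  have hga : AnalyticAt ℂ g 0 := h.hasFPowerSeriesAt.analyticAt
  have hp := hgp.unique (of_analyticAt hga)
  have hg' : HasLaurent (_root_.deriv g) 0 (PowerSeries.derivative ℂ p) := by
    convert of_analyticAt hga.deriv using 1
    ext k
    rw [PowerSeries.coeff_derivative, hp, PowerSeries.coeff_mk, PowerSeries.coeff_mk,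
      iteratedDeriv_succ', Nat.factorial_succ]
    have : (k.factorial : ℂ) ≠ 0 := by exact_mod_cast k.factorial_ne_zero
    have : (k + 1 : ℂ) ≠ 0 := by exact_mod_cast k.succ_ne_zero
    push_cast
    field_simp
  have h1 : HasLaurent (fun t => t * _root_.deriv g t - N * g t) 0
      (PowerSeries.X * PowerSeries.derivative ℂ p - (N : PowerSeries ℂ) * p) := by
    have hX : HasLaurent (fun t => t) 0 PowerSeries.X := by
      filter_upwards with t
      have := hasSum_single (f := fun k : ℕ => PowerSeries.coeff k (PowerSeries.X : PowerSeries ℂ)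
        * t ^ k) 1 (fun k hk => by simp [PowerSeries.coeff_X, hk])
      simpa using this
    simpa using (hX.mul hg').sub (hgp.const_mul N)
  filter_upwards [h1, self_mem_nhdsWithin, h.analyticAt_eventually] with t h2 h3 h4
  have h3 : t ≠ 0 := h3
  convert h2 using 1
  have hev : g =ᶠ[𝓝 t] fun s => s ^ N * φ s := by
    filter_upwards [isOpen_ne.mem_nhds h3] with s hs
    have hs : s ≠ 0 := hs
    simp [hg, hs]
  rw [hev.deriv_eq, hev.self_of_nhds]
  have := ((hasDerivAt_id t).pow N).mul h4.differentiableAt.hasDerivAt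
  simp only [Pi.pow_apply, id_eq] at this
  have h5 : _root_.deriv (fun s => s ^ N * φ s) t = _ := this.deriv
  rw [h5]
  rcases N with _ | N
  · simp
  · simp only [Nat.add_sub_cancel]
    push_cast
    ring

/-- Sums over `ℤ` and normalized series express the same expansion. -/
theorem hasSum (h : HasLaurent φ N p) :
    ∀ᶠ t in 𝓝[≠] (0 : ℂ), HasSum (fun m : ℤ => laurentAt N p m * t ^ m) (φ t) := by
  filter_upwards [h, self_mem_nhdsWithin] with t h1 h2
  have h2 : t ≠ 0 := h2
  have hinj : Function.Injective fun k : ℕ => (k : ℤ) - N := fun a b h => by simpa using h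
  rw [← hinj.hasSum_iff]
  · have := h1.mul_left (t ^ N)⁻¹
    refine hasSum_of_eq this ?_ ?_
    · intro k
      simp only [Function.comp_apply, laurentAt_sub]
      rw [zpow_sub₀ h2]
      simp only [zpow_natCast]
      field_simp
    · field_simp
  · intro m hm
    rw [laurentAt_of_lt, zero_mul]
    by_contra hlt
    exact hm ⟨(m + N).toNat, by simp; omega⟩

theorem of_hasSum {c : ℤ → ℂ} (hc : ∀ m < -(N : ℤ), c m = 0)
    (h : ∀ᶠ t in 𝓝[≠] (0 : ℂ), HasSum (fun m : ℤ => c m * t ^ m) (φ t)) :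
    HasLaurent φ N (PowerSeries.mk fun k => c (k - N)) := by
  filter_upwards [h, self_mem_nhdsWithin] with t h1 h2
  have h2 : t ≠ 0 := h2
  have hinj : Function.Injective fun k : ℕ => (k : ℤ) - N := fun a b h => by simpa using h
  rw [← hinj.hasSum_iff] at h1
  · have := h1.mul_left (t ^ N)
    refine hasSum_of_eq this (fun k => ?_) rfl
    simp only [Function.comp_apply, PowerSeries.coeff_mk]
    rw [zpow_sub₀ h2]
    simp only [zpow_natCast]
    field_simp
  · intro m hm
    rw [hc, zero_mul]
    by_contra hlt
    exact hm ⟨(m + N).toNat, by simp; omega⟩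

theorem eq_laurentAt_of_hasSum {c : ℤ → ℂ} (h : HasLaurent φ N p)
    (hc : ∃ K : ℤ, ∀ m < K, c m = 0)
    (hs : ∀ᶠ t in 𝓝[≠] (0 : ℂ), HasSum (fun m : ℤ => c m * t ^ m) (φ t)) (m : ℤ) :
    c m = laurentAt N p m := by
  obtain ⟨K, hK⟩ := hc
  have hK' : ∀ m < -((-K).toNat : ℤ), c m = 0 := fun m hm => hK m (by omega)
  rw [h.laurentAt_unique (of_hasSum hK' hs), laurentAt]
  split_ifs with h0
  · rw [PowerSeries.coeff_mk]
    congr 1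
    omega
  · exact hK' m (by omega)

end HasLaurent

theorem laurentAt_deriv {R : Type*} [CommRing R] (N : ℕ) (p : PowerSeries R) (m : ℤ) :
    laurentAt (N + 1) (PowerSeries.X * PowerSeries.derivative R p - (N : PowerSeries R) * p) m =
      ((m + 1 : ℤ) : R) * laurentAt N p (m + 1) := by
  simp only [laurentAt]
  push_cast
  rw [show m + 1 + (N : ℤ) = m + (N + 1) by ring]
  split_ifs with h
  · obtain ⟨k, hk⟩ := Int.eq_ofNat_of_zero_le h
    have hm : m + 1 = k - N := by omega
    rw [show (m : R) + 1 = ((m + 1 : ℤ) : R) by push_cast; ring, hm, hk]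
    have : (N : PowerSeries R) = PowerSeries.C (N : R) := by simp
    rw [map_sub, this, PowerSeries.coeff_C_mul]
    rcases k with _ | k
    · simp
    · simp only [Int.toNat_natCast, PowerSeries.coeff_succ_X_mul,
        PowerSeries.coeff_derivative]
      push_cast
      ring
  · simp

end ChiralHomology

/-! ### Generators of the coordinate ring -/

namespace ChiralHomology

variable (τ : ℍ)

/-- The value of a regular function at a point, as an algebra homomorphism. -/
def evalAt {n : ℕ} (x : conf τ n) : Gam τ n →ₐ[ℂ] ℂ :=
  (Pi.evalAlgHom ℂ (fun _ => ℂ) x).comp (Gam τ n).val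

@[simp]
theorem evalAt_apply {n : ℕ} (x : conf τ n) (f : Gam τ n) : evalAt τ x f = f.1 x := rfl

theorem Gam_ext {n : ℕ} {f g : Gam τ n} (h : ∀ x, f.1 x = g.1 x) : f = g :=
  Subtype.ext (funext h)

theorem isRegular_polyEval {n : ℕ} (g : MvPolynomial (Fin n ⊕ Fin n) ℂ) :
    IsRegular τ fun x : conf τ n => polyEval τ g x := fun _ =>
  ⟨g, 1, by simp [polyEval], fun q _ => by simp [polyEval]⟩

/-- The coordinate function `u_i = ℘(x_i)`. -/
def genU {n : ℕ} (i : Fin n) : Gam τ n :=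
  ⟨fun x => (periods τ).weierstrassP (x.1 i), by
    have := isRegular_polyEval τ (MvPolynomial.X (Sum.inl i) : MvPolynomial (Fin n ⊕ Fin n) ℂ)
    change IsRegular τ _
    simpa [polyEval, coords] using this⟩

/-- The coordinate function `v_i = ℘'(x_i)`. -/
def genV {n : ℕ} (i : Fin n) : Gam τ n :=
  ⟨fun x => (periods τ).derivWeierstrassP (x.1 i), by
    have := isRegular_polyEval τ (MvPolynomial.X (Sum.inr i) : MvPolynomial (Fin n ⊕ Fin n) ℂ)
    change IsRegular τ _
    simpa [polyEval, coords] using this⟩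

/-- The secant slope is the quotient `(v_i + v_j) / (u_i - u_j)` where `u_i ≠ u_j`. If `u_i = u_j`,
it is `(4 (u_i² + u_i u_j + u_j²) - g₂) / (v_i - v_j)`, by the equation of the cubic. -/
theorem isRegular_secant {n : ℕ} (i j : Fin n) :
    IsRegular τ fun x : conf τ n => (periods τ).secant (x.1 i) (x.1 j) := by
  by_cases hij : i = j
  · subst hij
    simpa [PeriodPair.secant, PeriodPair.zeta_zero, polyEval] using
      isRegular_polyEval τ (0 : MvPolynomial (Fin n ⊕ Fin n) ℂ)
  intro p
  by_cases hu : (periods τ).weierstrassP (p.1 i) = (periods τ).weierstrassP (p.1 j)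
  · have hv : (periods τ).derivWeierstrassP (p.1 i) ≠ (periods τ).derivWeierstrassP (p.1 j) :=
      fun hv => p.2.2 i j hij
        ((periods τ).sub_mem_of_coords_eq (p.2.1 i) (p.2.1 j) hu hv)
    refine ⟨4 * (MvPolynomial.X (Sum.inl i) ^ 2 + MvPolynomial.X (Sum.inl i) *
      MvPolynomial.X (Sum.inl j) + MvPolynomial.X (Sum.inl j) ^ 2) -
        MvPolynomial.C (periods τ).g₂,
      MvPolynomial.X (Sum.inr i) - MvPolynomial.X (Sum.inr j), ?_, fun q hq => ?_⟩
    · simpa [polyEval, coords, sub_eq_zero] using hv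
    · rw [eq_div_iff hq]
      have := (periods τ).sub_mul_secant (q.2.1 i) (q.2.1 j) (q.2.2 i j hij)
      simp only [polyEval, coords, map_sub, map_add, map_mul, map_pow, MvPolynomial.eval_X,
        MvPolynomial.eval_C, map_ofNat, Sum.elim_inl, Sum.elim_inr]
      rw [mul_comm]
      exact this
  · refine ⟨MvPolynomial.X (Sum.inr i) + MvPolynomial.X (Sum.inr j),
      MvPolynomial.X (Sum.inl i) - MvPolynomial.X (Sum.inl j), ?_, fun q hq => ?_⟩
    · simpa [polyEval, coords, sub_eq_zero] using hu
    · rw [eq_div_iff hq]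
      have := (periods τ).secant_mul_sub (q.2.1 i) (q.2.1 j) (q.2.2 i j hij)
      simp only [polyEval, coords, map_sub, map_add, MvPolynomial.eval_X,
        Sum.elim_inl, Sum.elim_inr]
      rw [mul_comm]
      exact this

/-- The secant slope of the points `x_i` and `x_j`; it is zero for `i = j`. -/
def genS {n : ℕ} (i j : Fin n) : Gam τ n :=
  ⟨fun x => (periods τ).secant (x.1 i) (x.1 j), isRegular_secant τ i j⟩

/-- The generators `u_i`, `v_i` and the secant slopes, as a family. -/
def gens {n : ℕ} : (Fin n ⊕ Fin n) ⊕ Fin n × Fin n → Gam τ n :=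
  Sum.elim (Sum.elim (genU τ) (genV τ)) fun p => genS τ p.1 p.2

theorem aeval_gens_apply {n : ℕ} (g : MvPolynomial (Fin n ⊕ Fin n) ℂ) (x : conf τ n) :
    (MvPolynomial.aeval (gens τ) (MvPolynomial.rename Sum.inl g)).1 x = polyEval τ g x := by
  rw [MvPolynomial.aeval_rename, ← evalAt_apply, ← AlgHom.comp_apply, MvPolynomial.comp_aeval,
    polyEval, MvPolynomial.aeval_eq_eval]
  congr 2
  funext k
  rcases k with k | k <;> rfl

/-- Polynomials in the generators exhaust the regular functions. By the Nullstellensatz it is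
enough that the ideal of denominators of a regular function has no zero; a zero would be a point of
the configuration space, because its coordinates lie on the cubic and because the relations of the
secant slopes keep distinct coordinates apart. -/
theorem aeval_gens_surjective {n : ℕ} (f : Gam τ n) :
    ∃ P : MvPolynomial ((Fin n ⊕ Fin n) ⊕ Fin n × Fin n) ℂ, MvPolynomial.aeval (gens τ) P = f := by
  set ev := MvPolynomial.aeval (R := ℂ) (gens τ (n := n)) with hev
  let J : Ideal (MvPolynomial ((Fin n ⊕ Fin n) ⊕ Fin n × Fin n) ℂ) :=
    { carrier := {h | ∃ P, ev P = ev h * f}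
      add_mem' := by
        rintro a b ⟨P, hP⟩ ⟨Q, hQ⟩
        exact ⟨P + Q, by rw [map_add, map_add, hP, hQ, add_mul]⟩
      zero_mem' := ⟨0, by simp⟩
      smul_mem' := by
        rintro c a ⟨P, hP⟩
        exact ⟨c * P, by rw [smul_eq_mul, map_mul, map_mul, hP, mul_assoc]⟩ }
  have hker : ∀ h, ev h = 0 → h ∈ J := fun h hh => ⟨0, by rw [hh]; simp⟩
  suffices hJ : J = ⊤ by
    obtain ⟨P, hP⟩ : (1 : MvPolynomial _ ℂ) ∈ J := hJ ▸ Submodule.mem_top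
    exact ⟨P, by rw [hP]; simp⟩
  by_contra hJ
  obtain ⟨I, hI, hJI⟩ := Ideal.exists_le_maximal J hJ
  obtain ⟨z, rfl⟩ := (MvPolynomial.isMaximal_iff_eq_vanishingIdeal_singleton (K := ℂ)).mp hI
  have hz : ∀ h ∈ J, MvPolynomial.eval z h = 0 := fun h hh => by
    have := (MvPolynomial.mem_vanishingIdeal_singleton_iff (K := ℂ) z h).mp (hJI hh)
    simpa [MvPolynomial.aeval_eq_eval] using this
  have hrel : ∀ h, (∀ x, (ev h).1 x = 0) → MvPolynomial.eval z h = 0 := fun h hh =>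
    hz h (hker h (Gam_ext τ hh))
  let U : Fin n → MvPolynomial ((Fin n ⊕ Fin n) ⊕ Fin n × Fin n) ℂ :=
    fun i => MvPolynomial.X (Sum.inl (Sum.inl i))
  let W : Fin n → MvPolynomial ((Fin n ⊕ Fin n) ⊕ Fin n × Fin n) ℂ :=
    fun i => MvPolynomial.X (Sum.inl (Sum.inr i))
  let S : Fin n → Fin n → MvPolynomial ((Fin n ⊕ Fin n) ⊕ Fin n × Fin n) ℂ :=
    fun i j => MvPolynomial.X (Sum.inr (i, j))
  have hU : ∀ i, ev (U i) = genU τ i := fun i => by simp [hev, U, gens]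
  have hW : ∀ i, ev (W i) = genV τ i := fun i => by simp [hev, W, gens]
  have hS : ∀ i j, ev (S i j) = genS τ i j := fun i j => by simp [hev, S, gens]
  have hC : ∀ c, ev (MvPolynomial.C c) = algebraMap ℂ _ c := fun c => by simp [hev]
  -- the first coordinates of the zero lie on the cubic
  have hcub : ∀ i, ∃ x ∉ (periods τ).lattice,
      (periods τ).weierstrassP x = z (Sum.inl (Sum.inl i)) ∧
      (periods τ).derivWeierstrassP x = z (Sum.inl (Sum.inr i)) := by
    intro i
    apply (periods τ).exists_uniformization
    have := hrel (W i ^ 2 - (4 * U i ^ 3 - MvPolynomial.C (periods τ).g₂ * U i -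
      MvPolynomial.C (periods τ).g₃)) fun x => by
        have := (periods τ).derivWeierstrassP_sq (x.1 i) (x.2.1 i)
        simp only [map_sub, map_mul, map_pow, map_ofNat, hU, hW, hC]
        exact sub_eq_zero.mpr this
    simpa [U, W, sub_eq_zero] using this
  choose x hx hxu hxv using hcub
  have hconf : x ∈ conf τ n := by
    refine ⟨hx, fun i j hij hmem => ?_⟩
    have e1 := hrel ((U i - U j) * S i j - (W i + W j)) fun x => by
      have := (periods τ).secant_mul_sub (x.2.1 i) (x.2.1 j) (x.2.2 i j hij)
      simp only [map_sub, map_mul, map_add, hU, hW, hS]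
      exact sub_eq_zero.mpr this
    have e2 := hrel ((W i - W j) * S i j - (4 * (U i ^ 2 + U i * U j + U j ^ 2) -
        MvPolynomial.C (periods τ).g₂)) fun x => by
      have := (periods τ).sub_mul_secant (x.2.1 i) (x.2.1 j) (x.2.2 i j hij)
      simp only [map_sub, map_mul, map_add, map_pow, map_ofNat, hU, hW, hS, hC]
      exact sub_eq_zero.mpr this
    have f1 := (periods τ).weierstrassP_eq_of_sub_mem hmem
    have f2 := (periods τ).derivWeierstrassP_eq_of_sub_mem hmem
    simp only [U, W, S, map_sub, map_mul, map_add, map_pow, map_ofNat, MvPolynomial.eval_X,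
      MvPolynomial.eval_C, ← hxu, ← hxv, f1, f2] at e1 e2
    exact (periods τ).smooth_weierstrass (hx j) (by linear_combination -e1 / 2)
      (by linear_combination -e2)
  -- a denominator of `f` at this point, squared to extend the identity over its zeros
  obtain ⟨g, h, hh, e⟩ := f.2 ⟨x, hconf⟩
  have hmem : MvPolynomial.rename Sum.inl (h ^ 2) ∈ J := by
    refine ⟨MvPolynomial.rename Sum.inl (g * h), Gam_ext τ fun q => ?_⟩
    have : (ev (MvPolynomial.rename Sum.inl (h ^ 2)) * f).1 q =
      (ev (MvPolynomial.rename Sum.inl (h ^ 2))).1 q * f.1 q := rfl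
    rw [this, aeval_gens_apply, aeval_gens_apply]
    by_cases hq : polyEval τ h q = 0
    · simp only [polyEval, map_mul, map_pow] at hq ⊢
      simp [hq]
    · rw [e q hq]
      simp only [polyEval, map_mul, map_pow] at hq ⊢
      field_simp
  have h0 := hz _ hmem
  rw [MvPolynomial.eval_rename, map_pow] at h0
  apply hh
  have hcoord : z ∘ Sum.inl = coords τ x := by
    funext k
    rcases k with k | k
    · exact (hxu k).symm
    · exact (hxv k).symm
  rw [hcoord] at h0
  exact pow_eq_zero_iff two_ne_zero |>.mp h0

/-- Induction over the algebra generated by the `u_i`, the `v_i` and the secant slopes. -/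
theorem Gam_induction {n : ℕ} {motive : Gam τ n → Prop}
    (const : ∀ c, motive (algebraMap ℂ _ c))
    (add : ∀ f g, motive f → motive g → motive (f + g))
    (mul : ∀ f g, motive f → motive g → motive (f * g))
    (U : ∀ i, motive (genU τ i)) (V : ∀ i, motive (genV τ i))
    (S : ∀ i j, i ≠ j → motive (genS τ i j)) (f : Gam τ n) : motive f := by
  obtain ⟨P, rfl⟩ := aeval_gens_surjective τ f
  induction P using MvPolynomial.induction_on with
  | C a => simpa using const a
  | add p q hp hq => rw [map_add]; exact add _ _ hp hq
  | mul_X p k hp =>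
    rw [map_mul]
    refine mul _ _ hp ?_
    rw [MvPolynomial.aeval_X]
    rcases k with (k | k) | ⟨i, j⟩
    · exact U k
    · exact V k
    · by_cases hij : i = j
      · subst hij
        convert const 0
        refine Gam_ext τ fun x => ?_
        simp [gens, genS, PeriodPair.secant, PeriodPair.zeta_zero]
      · exact S i j hij

end ChiralHomology

/-! ### The derivations of the coordinate ring -/

namespace ChiralHomology

variable (τ : ℍ)

theorem ext_of_mem {n : ℕ} (f : conf τ n → ℂ) {x : Fin n → ℂ} (hx : x ∈ conf τ n) :
    ext τ f x = f ⟨x, hx⟩ :=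
  Subtype.val_injective.extend_apply f 0 ⟨x, hx⟩

theorem hasDerivAt_ext {n : ℕ} (f : Gam τ n) (i : Fin n) (x : conf τ n) :
    HasDerivAt (fun s => ext τ f.1 (Function.update x.1 i s)) ((partialGam τ i f).1 x) (x.1 i) :=
  (exists_hasDerivAt τ i f.2 x).hasDerivAt

theorem partialGam_eq {n : ℕ} {f : Gam τ n} {i : Fin n} {x : conf τ n} {c : ℂ}
    (h : HasDerivAt (fun s => ext τ f.1 (Function.update x.1 i s)) c (x.1 i)) :
    (partialGam τ i f).1 x = c :=
  (hasDerivAt_ext τ f i x).unique h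

theorem partialGam_mul {n : ℕ} (i : Fin n) (f g : Gam τ n) :
    partialGam τ i (f * g) = f * partialGam τ i g + g * partialGam τ i f := by
  refine Gam_ext τ fun x => ?_
  refine partialGam_eq τ (((hasDerivAt_ext τ f i x).mul
    (hasDerivAt_ext τ g i x)).congr_of_eventuallyEq ?_ |>.congr_deriv ?_)
  · filter_upwards [eventually_update_mem_conf τ i x.2] with s hs
    simp only [Pi.mul_apply, ext_of_mem τ _ hs]
    rfl
  · simp only [Function.update_eq_self, ext_of_mem τ _ x.2]
    change _ = f.1 x * (partialGam τ i g).1 x + g.1 x * (partialGam τ i f).1 x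
    ring

theorem partialGam_algebraMap {n : ℕ} (i : Fin n) (c : ℂ) :
    partialGam τ i (algebraMap ℂ (Gam τ n) c) = 0 := by
  have h := partialGam_mul τ i (1 : Gam τ n) 1
  rw [mul_one, one_mul, left_eq_add] at h
  rw [Algebra.algebraMap_eq_smul_one, map_smul, h, smul_zero]

theorem polyDeriv_comm {n : ℕ} (i j : Fin n) (g : MvPolynomial (Fin n ⊕ Fin n) ℂ) :
    polyDeriv τ i (polyDeriv τ j g) = polyDeriv τ j (polyDeriv τ i g) := by
  have : ⁅polyDeriv τ i, polyDeriv τ j⁆ = 0 := by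
    refine MvPolynomial.derivation_ext fun k => ?_
    rw [Derivation.commutator_apply]
    by_cases hij : i = j
    · subst hij; simp
    rcases k with k | k
    · simp only [polyDeriv, MvPolynomial.mkDerivation_X, Sum.elim_inl]
      split_ifs with h1 h2 h2 <;> simp_all
    · simp only [polyDeriv, MvPolynomial.mkDerivation_X, Sum.elim_inr]
      split_ifs with h1 h2 h2 <;> simp_all [Derivation.leibniz, Derivation.leibniz_pow]
      all_goals exact_mod_cast Derivation.map_natCast _ 6
  have := congrArg (fun D => D g) this
  simpa [Derivation.commutator_apply, sub_eq_zero] using this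

theorem partialGam_comm {n : ℕ} (i j : Fin n) (f : Gam τ n) :
    partialGam τ i (partialGam τ j f) = partialGam τ j (partialGam τ i f) := by
  refine Gam_ext τ fun x => ?_
  obtain ⟨g, h, hh, e⟩ := f.2 x
  have e' : ∀ (k : Fin n) (q : conf τ n), polyEval τ (h ^ 2) q ≠ 0 → (partialGam τ k f).1 q =
      polyEval τ (polyDeriv τ k g * h - g * polyDeriv τ k h) q / polyEval τ (h ^ 2) q :=
    fun k q hq => (hasDerivAt_of_quot τ k e q (by simpa [polyEval] using hq)).deriv
  have hh2 : polyEval τ (h ^ 2) x ≠ 0 := by simpa [polyEval] using hh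
  have h1 := partialGam_eq τ (f := partialGam τ j f) (hasDerivAt_of_quot τ i (e' j) x hh2)
  have h2 := partialGam_eq τ (f := partialGam τ i f) (hasDerivAt_of_quot τ j (e' i) x hh2)
  have hp : polyDeriv τ i (polyDeriv τ j g * h - g * polyDeriv τ j h) * h ^ 2 -
      (polyDeriv τ j g * h - g * polyDeriv τ j h) * polyDeriv τ i (h ^ 2) =
    polyDeriv τ j (polyDeriv τ i g * h - g * polyDeriv τ i h) * h ^ 2 -
      (polyDeriv τ i g * h - g * polyDeriv τ i h) * polyDeriv τ j (h ^ 2) := by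
    have c1 := polyDeriv_comm τ i j g
    have c2 := polyDeriv_comm τ i j h
    generalize polyDeriv τ i = D at *
    generalize polyDeriv τ j = D' at *
    simp only [map_sub, Derivation.leibniz, pow_two, smul_eq_mul, c1, c2]
    ring
  exact h1.trans ((congrArg (fun P => polyEval τ P x.1 / polyEval τ ((h ^ 2) ^ 2) x.1) hp).trans
    h2.symm)

theorem partialGam_iterate_comm {n : ℕ} (i j : Fin n) (f : Gam τ n) (m : ℕ) :
    partialGam τ i ((partialGam τ j)^[m] f) = (partialGam τ j)^[m] (partialGam τ i f) := by
  induction m generalizing f with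
  | zero => rfl
  | succ m ih => rw [Function.iterate_succ_apply, ih, Function.iterate_succ_apply,
      partialGam_comm]

/-! ### Pullback along injections of index sets -/

theorem comp_mem_conf {n m : ℕ} {σ : Fin n → Fin m} (hσ : Function.Injective σ) {x : Fin m → ℂ}
    (hx : x ∈ conf τ m) : x ∘ σ ∈ conf τ n :=
  ⟨fun i => hx.1 (σ i), fun i j hij => hx.2 (σ i) (σ j) (hσ.ne hij)⟩

/-- The pullback of regular functions along the projection forgetting some variables. -/
def pull {n m : ℕ} (σ : Fin n → Fin m) (hσ : Function.Injective σ) (f : Gam τ n) : Gam τ m :=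
  ⟨fun x => f.1 ⟨x.1 ∘ σ, comp_mem_conf τ hσ x.2⟩, by
    intro p
    obtain ⟨g, h, hh, e⟩ := f.2 ⟨p.1 ∘ σ, comp_mem_conf τ hσ p.2⟩
    have key : ∀ (g : MvPolynomial (Fin n ⊕ Fin n) ℂ) (x : Fin m → ℂ),
        polyEval τ (MvPolynomial.rename (Sum.map σ σ) g) x = polyEval τ g (x ∘ σ) := by
      intro g x
      rw [polyEval, MvPolynomial.eval_rename, polyEval]
      congr 2
      funext k
      rcases k with k | k <;> rfl
    refine ⟨MvPolynomial.rename (Sum.map σ σ) g, MvPolynomial.rename (Sum.map σ σ) h, ?_, ?_⟩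
    · rwa [key]
    · intro q hq
      rw [key] at hq
      rw [key, key]
      exact e ⟨q.1 ∘ σ, comp_mem_conf τ hσ q.2⟩ hq⟩

theorem ext_pull {n m : ℕ} {σ : Fin n → Fin m} (hσ : Function.Injective σ) (f : Gam τ n)
    {x : Fin m → ℂ} (hx : x ∈ conf τ m) : ext τ (pull τ σ hσ f).1 x = ext τ f.1 (x ∘ σ) := by
  rw [ext_of_mem τ _ hx, ext_of_mem τ _ (comp_mem_conf τ hσ hx)]
  rfl

theorem partialGam_pull {n m : ℕ} {σ : Fin n → Fin m} (hσ : Function.Injective σ) (f : Gam τ n)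
    (l : Fin n) : partialGam τ (σ l) (pull τ σ hσ f) = pull τ σ hσ (partialGam τ l f) := by
  refine Gam_ext τ fun x => ?_
  refine partialGam_eq τ ((hasDerivAt_ext τ f l
    ⟨x.1 ∘ σ, comp_mem_conf τ hσ x.2⟩).congr_of_eventuallyEq ?_)
  filter_upwards [eventually_update_mem_conf τ (σ l) x.2] with s hs
  rw [ext_pull τ hσ f hs, Function.update_comp_eq_of_injective _ hσ]

theorem partialGam_pull_of_notMem {n m : ℕ} {σ : Fin n → Fin m} (hσ : Function.Injective σ)
    (f : Gam τ n) {j : Fin m} (hj : ∀ l, σ l ≠ j) : partialGam τ j (pull τ σ hσ f) = 0 := by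
  refine Gam_ext τ fun x => ?_
  refine partialGam_eq τ ((hasDerivAt_const (x.1 j) (ext τ f.1 (x.1 ∘ σ))).congr_of_eventuallyEq ?_)
  filter_upwards [eventually_update_mem_conf τ j x.2] with s hs
  rw [ext_pull τ hσ f hs]
  congr 1
  funext l
  simp [hj l]

theorem pull_genU {n m : ℕ} {σ : Fin n → Fin m} (hσ : Function.Injective σ) (i : Fin n) :
    pull τ σ hσ (genU τ i) = genU τ (σ i) := rfl

theorem pull_genV {n m : ℕ} {σ : Fin n → Fin m} (hσ : Function.Injective σ) (i : Fin n) :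
    pull τ σ hσ (genV τ i) = genV τ (σ i) := rfl

theorem pull_genS {n m : ℕ} {σ : Fin n → Fin m} (hσ : Function.Injective σ) (i j : Fin n) :
    pull τ σ hσ (genS τ i j) = genS τ (σ i) (σ j) := rfl

theorem partialGam_genU_of_ne {n : ℕ} {i j : Fin n} (h : j ≠ i) :
    partialGam τ i (genU τ j) = 0 :=
  partialGam_pull_of_notMem τ (σ := fun _ : Fin 1 => j) (fun _ _ _ => Subsingleton.elim _ _)
    (genU τ 0) fun _ => h

theorem partialGam_genV_of_ne {n : ℕ} {i j : Fin n} (h : j ≠ i) :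
    partialGam τ i (genV τ j) = 0 :=
  partialGam_pull_of_notMem τ (σ := fun _ : Fin 1 => j) (fun _ _ _ => Subsingleton.elim _ _)
    (genV τ 0) fun _ => h

theorem partialGam_genS_of_ne {n : ℕ} {i j k : Fin n} (hjk : j ≠ k) (hj : j ≠ i) (hk : k ≠ i) :
    partialGam τ i (genS τ j k) = 0 :=
  partialGam_pull_of_notMem τ (σ := ![j, k]) (by
    intro a b; fin_cases a <;> fin_cases b <;> simp [hjk, hjk.symm])
    (genS τ 0 1) fun l => by fin_cases l <;> simp [hj, hk]

theorem genS_comm {n : ℕ} (i j : Fin n) : genS τ j i = -genS τ i j :=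
  Gam_ext τ fun x => (periods τ).secant_comm (x.1 i) (x.1 j)

/-- The `ζ`-form of the secant slope makes its derivatives Weierstrass functions. -/
theorem partialGam_genS {n : ℕ} {i j : Fin n} (hij : i ≠ j) (x : conf τ n) :
    (partialGam τ j (genS τ i j)).1 x =
      2 * ((periods τ).weierstrassP (x.1 i - x.1 j) - (periods τ).weierstrassP (x.1 j)) := by
  have h1 := ((periods τ).hasDerivAt_zeta (x.2.2 i j hij)).comp (x.1 j)
    ((hasDerivAt_id (x.1 j)).const_sub (x.1 i))
  have h2 := ((h1.sub_const ((periods τ).zeta (x.1 i))).add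
    ((periods τ).hasDerivAt_zeta (x.2.1 j))).const_mul 2
  refine partialGam_eq τ ((h2.congr_deriv (by ring)).congr_of_eventuallyEq ?_)
  filter_upwards [eventually_update_mem_conf τ j x.2] with s hs
  rw [ext_of_mem τ _ hs]
  simp [genS, PeriodPair.secant, hij]

/-! ### Taylor series in one of the variables -/

/-- The Taylor series of `f` in the variable `x_l`, with coefficients `∂_l ^ m f / m!`. -/
def taylorGam {n : ℕ} (l : Fin n) (f : Gam τ n) : PowerSeries (Gam τ n) :=
  PowerSeries.mk fun m => ((m.factorial : ℂ)⁻¹) • (partialGam τ l)^[m] f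

theorem eventually_update_add_mem_conf {n : ℕ} (l : Fin n) (y : conf τ n) :
    ∀ᶠ t in 𝓝 (0 : ℂ), Function.update y.1 l (y.1 l + t) ∈ conf τ n :=
  (tendsto_const_add_nhds_zero _).eventually (eventually_update_mem_conf τ l y.2)

theorem iteratedDeriv_ext {n : ℕ} (l : Fin n) (f : Gam τ n) (y : conf τ n) (m : ℕ) :
    iteratedDeriv m (fun t => ext τ f.1 (Function.update y.1 l (y.1 l + t))) =ᶠ[𝓝 0]
      fun t => ext τ ((partialGam τ l)^[m] f).1 (Function.update y.1 l (y.1 l + t)) := by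
  induction m with
  | zero => simp
  | succ m ih =>
    rw [iteratedDeriv_succ]
    filter_upwards [ih.eventuallyEq_nhds, eventually_update_add_mem_conf τ l y] with t ht hmt
    rw [ht.deriv_eq, Function.iterate_succ_apply', ext_of_mem τ _ hmt]
    have h := hasDerivAt_ext τ ((partialGam τ l)^[m] f) l ⟨_, hmt⟩
    simp only [Function.update_idem, Function.update_self] at h
    exact (HasDerivAt.comp_const_add (y.1 l) t h).deriv

theorem analyticAt_ext {n : ℕ} (l : Fin n) (f : Gam τ n) (y : conf τ n) :
    AnalyticAt ℂ (fun t => ext τ f.1 (Function.update y.1 l (y.1 l + t))) 0 := by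
  rw [Complex.analyticAt_iff_eventually_differentiableAt]
  filter_upwards [eventually_update_add_mem_conf τ l y] with t hmt
  have h := hasDerivAt_ext τ f l ⟨_, hmt⟩
  simp only [Function.update_idem, Function.update_self] at h
  exact (HasDerivAt.comp_const_add (y.1 l) t h).differentiableAt

theorem hasLaurent_taylorGam {n : ℕ} (l : Fin n) (f : Gam τ n) (y : conf τ n) :
    HasLaurent (fun t => ext τ f.1 (Function.update y.1 l (y.1 l + t))) 0
      ((taylorGam τ l f).map (evalAt τ y : Gam τ n →+* ℂ)) := by
  convert HasLaurent.of_analyticAt (analyticAt_ext τ l f y) using 1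
  ext m
  have := (iteratedDeriv_ext τ l f y m).self_of_nhds
  rw [PowerSeries.coeff_mk, this, PowerSeries.coeff_map, taylorGam, PowerSeries.coeff_mk]
  simp only [add_zero, Function.update_eq_self]
  rw [ext_of_mem τ _ y.2, div_eq_inv_mul]
  rfl

end ChiralHomology

/-! ### Expansions with regular coefficients -/

namespace ChiralHomology

variable (τ : ℍ)

/-- The points `x_1, …, x_n` together with the origin, which comes last: the possible centers of
Laurent expansions, indexed like the tensor slots. -/
def point {n : ℕ} (y : Fin n → ℂ) : Fin (n + 1) → ℂ := Fin.snoc (α := fun _ => ℂ) y 0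

@[simp]
theorem point_castSucc {n : ℕ} (y : Fin n → ℂ) (k : Fin n) : point y k.castSucc = y k := by
  simp [point]

@[simp]
theorem point_last {n : ℕ} (y : Fin n → ℂ) : point y (Fin.last n) = 0 := by
  simp [point]

theorem point_sub_notMem {n : ℕ} {y : Fin n → ℂ} (hy : y ∈ conf τ n) {k l : Fin (n + 1)}
    (h : k ≠ l) : point y k - point y l ∉ (periods τ).lattice := by
  induction k using Fin.lastCases with
  | last =>
    induction l using Fin.lastCases with
    | last => exact absurd rfl h
    | cast l => simpa [lattice] using hy.1 l
  | cast k =>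
    induction l using Fin.lastCases with
    | last => simpa [lattice] using hy.1 k
    | cast l => simpa [lattice] using hy.2 k l (fun e => h (by rw [e]))

theorem point_sub_eq_zero_or {n : ℕ} {y : Fin n → ℂ} (hy : y ∈ conf τ n) (k l : Fin (n + 1)) :
    point y k - point y l = 0 ∨ point y k - point y l ∉ (periods τ).lattice := by
  by_cases h : k = l
  · exact Or.inl (by rw [h, sub_self])
  · exact Or.inr (point_sub_notMem τ hy h)

theorem mem_conf_of_point {n : ℕ} {y : Fin n → ℂ}
    (h : ∀ k l : Fin (n + 1), k ≠ l → point y k - point y l ∉ (periods τ).lattice) :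
    y ∈ conf τ n := by
  refine ⟨fun i => ?_, fun i j hij => ?_⟩
  · simpa [lattice] using h i.castSucc (Fin.last n) (Fin.castSucc_lt_last i).ne
  · simpa [lattice] using h i.castSucc j.castSucc (by simpa using hij)

theorem eventually_add_notMem {c : ℂ} (hc : c = 0 ∨ c ∉ (periods τ).lattice) :
    ∀ᶠ t in 𝓝[≠] (0 : ℂ), c + t ∉ (periods τ).lattice := by
  rcases hc with rfl | hc
  · simpa using (periods τ).eventually_nhdsNE_zero_notMem
  · refine mem_nhdsWithin_of_mem_nhds ?_
    exact (tendsto_const_add_nhds_zero c).eventually ((periods τ).eventually_notMem hc)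

theorem point_insertNth {n : ℕ} (i : Fin (n + 1)) (a : ℂ) (y : Fin n → ℂ) :
    point (i.insertNth (α := fun _ => ℂ) a y) =
      i.castSucc.insertNth (α := fun _ => ℂ) a (point y) := by
  symm
  rw [Fin.insertNth_eq_iff]
  refine ⟨by simp, ?_⟩
  funext p
  rw [Fin.removeNth]
  induction p using Fin.lastCases with
  | last =>
    rw [show i.castSucc.succAbove (Fin.last n) = Fin.last (n + 1) by
      rw [Fin.succAbove_of_le_castSucc _ _ (by simpa using Fin.le_last i)]; simp]
    simp
  | cast p => rw [Fin.castSucc_succAbove_castSucc]; simp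

theorem insertNth_mem_conf {n : ℕ} {y : Fin n → ℂ} (hy : y ∈ conf τ n) (i : Fin (n + 1)) {a : ℂ}
    (h : ∀ p, a - point y p ∉ (periods τ).lattice) :
    i.insertNth (α := fun _ => ℂ) a y ∈ conf τ (n + 1) := by
  refine mem_conf_of_point τ ?_
  rw [point_insertNth, Fin.forall_iff_succAbove i.castSucc]
  refine ⟨fun l hl => ?_, fun k l hl => ?_⟩
  · induction l using Fin.succAboveCases i.castSucc with
    | x => exact absurd rfl hl
    | p l => simpa using h l
  · induction l using Fin.succAboveCases i.castSucc with
    | x =>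
      have := (periods τ).neg_notMem (h k)
      simpa using this
    | p l => simpa using point_sub_notMem τ hy fun e => hl (by rw [e])

theorem eventually_insertNth_mem {n : ℕ} (i : Fin (n + 1)) (k : Fin (n + 1)) {y : Fin n → ℂ}
    (hy : y ∈ conf τ n) :
    ∀ᶠ t in 𝓝[≠] (0 : ℂ),
      i.insertNth (α := fun _ => ℂ) (point y k + t) y ∈ conf τ (n + 1) := by
  have h : ∀ᶠ t in 𝓝[≠] (0 : ℂ), ∀ l : Fin (n + 1),
      (point y k - point y l) + t ∉ (periods τ).lattice :=
    eventually_all.mpr fun l => eventually_add_notMem τ (point_sub_eq_zero_or τ hy k l)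
  filter_upwards [h] with t ht
  refine insertNth_mem_conf τ hy i fun l => ?_
  rw [add_sub_right_comm]
  exact ht l

/-- The function `f` of the `i`-th variable, near the center `k` and centered at the origin. -/
def slice {n : ℕ} (f : Gam τ (n + 1)) (i k : Fin (n + 1)) (y : Fin n → ℂ) (t : ℂ) : ℂ :=
  ext τ f.1 (i.insertNth (α := fun _ => ℂ) (point y k + t) y)

/-- `f` has the Laurent expansion `t ^ (-N) * P` in the `i`-th variable around the center `k`,
with coefficients in the coordinate ring of the remaining variables. -/
def Expands {n : ℕ} (f : Gam τ (n + 1)) (i k : Fin (n + 1)) (N : ℕ)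
    (P : PowerSeries (Gam τ n)) : Prop :=
  ∀ y : conf τ n, HasLaurent (slice τ f i k y.1) N (P.map (evalAt τ y : Gam τ n →+* ℂ))

variable {τ}

namespace Expands

variable {n : ℕ} {f g : Gam τ (n + 1)} {i k : Fin (n + 1)} {N M : ℕ} {P Q : PowerSeries (Gam τ n)}

theorem add (h : Expands τ f i k N P) (h' : Expands τ g i k N Q) :
    Expands τ (f + g) i k N (P + Q) := by
  intro y
  rw [map_add]
  refine ((h y).add (h' y)).congr ?_
  filter_upwards [eventually_insertNth_mem τ i k y.2] with t ht
  simp only [slice, ext_of_mem τ _ ht]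
  rfl

theorem mul (h : Expands τ f i k N P) (h' : Expands τ g i k M Q) :
    Expands τ (f * g) i k (N + M) (P * Q) := by
  intro y
  rw [map_mul]
  refine ((h y).mul (h' y)).congr ?_
  filter_upwards [eventually_insertNth_mem τ i k y.2] with t ht
  simp only [slice, ext_of_mem τ _ ht]
  rfl

theorem raise (h : Expands τ f i k N P) (M : ℕ) :
    Expands τ f i k (N + M) (PowerSeries.X ^ M * P) := by
  intro y
  rw [map_mul, map_pow, PowerSeries.map_X]
  exact (h y).raise M

theorem const (c : ℂ) : Expands τ (algebraMap ℂ _ c) i k 0 (PowerSeries.C (algebraMap ℂ _ c)) := by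
  intro y
  rw [PowerSeries.map_C]
  refine (HasLaurent.const _).congr ?_
  filter_upwards [eventually_insertNth_mem τ i k y.2] with t ht
  simp only [slice, ext_of_mem τ _ ht]
  rfl

theorem smul (h : Expands τ f i k N P) (c : ℂ) : Expands τ (c • f) i k N (c • P) := by
  have := (const (i := i) (k := k) c).mul h
  rw [zero_add, ← Algebra.smul_def] at this
  convert this using 1
  ext m : 1
  rw [PowerSeries.coeff_C_mul, ← Algebra.smul_def, PowerSeries.coeff_smul]

/-- The expansion of the derivative in the expanded variable is the derivative of the expansion. -/
theorem deriv_self (h : Expands τ f i k N P) :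
    Expands τ (partialGam τ i f) i k (N + 1)
      (PowerSeries.X * PowerSeries.derivative _ P - (N : PowerSeries (Gam τ n)) * P) := by
  intro y
  have e : (PowerSeries.X * PowerSeries.derivative _ P - (N : PowerSeries (Gam τ n)) * P).map
      (evalAt τ y : Gam τ n →+* ℂ) = PowerSeries.X * PowerSeries.derivative ℂ
        (P.map (evalAt τ y : Gam τ n →+* ℂ)) -
        (N : PowerSeries ℂ) * P.map (evalAt τ y : Gam τ n →+* ℂ) := by
    rw [map_sub, map_mul, map_mul, PowerSeries.map_X, map_natCast]
    congr 2
  rw [e]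
  refine (h y).deriv.congr ?_
  filter_upwards [eventually_insertNth_mem τ i k y.2] with t ht
  have h1 := hasDerivAt_ext τ f i ⟨_, ht⟩
  simp only [Fin.insertNth_apply_same, Fin.update_insertNth] at h1
  have := (HasDerivAt.comp_const_add (point y.1 k) t h1).deriv
  simp only [slice]
  rw [ext_of_mem τ _ ht]
  exact this.symm

theorem hasSum (h : Expands τ f i k N P) (y : conf τ n) :
    ∀ᶠ t in 𝓝[≠] (0 : ℂ),
      ∃ hx : i.insertNth (α := fun _ => ℂ) (point y.1 k + t) y.1 ∈ conf τ (n + 1),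
        HasSum (fun m : ℤ => (laurentAt N P m).1 y * t ^ m) (f.1 ⟨_, hx⟩) := by
  filter_upwards [(h y).hasSum, eventually_insertNth_mem τ i k y.2] with t h1 h2
  refine ⟨h2, ?_⟩
  rw [slice, ext_of_mem τ _ h2] at h1
  refine hasSum_of_eq h1 (fun m => ?_) rfl
  rw [laurentAt_map]
  rfl

end Expands

variable (τ)

theorem IsLaurentExpansion.hasSum_slice {n : ℕ} {f : Gam τ (n + 1)} {i k : Fin (n + 1)}
    {g : ℤ → Gam τ n} (h : IsLaurentExpansion τ f i (fun y => point y k) g) (y : conf τ n) :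
    ∀ᶠ t in 𝓝[≠] (0 : ℂ), HasSum (fun m : ℤ => (g m).1 y * t ^ m) (slice τ f i k y.1 t) := by
  filter_upwards [h.2 y] with t ht
  obtain ⟨hx, hs⟩ := ht
  rwa [slice, ext_of_mem τ _ hx]

theorem Expands.isLaurentExpansion {n : ℕ} {f : Gam τ (n + 1)} {i k : Fin (n + 1)} {N : ℕ}
    {P : PowerSeries (Gam τ n)} (h : Expands τ f i k N P) :
    IsLaurentExpansion τ f i (fun y => point y k) (laurentAt N P) :=
  ⟨⟨-N, fun _ hm => laurentAt_of_lt P hm⟩, h.hasSum⟩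

theorem Expands.eq_laurentAt {n : ℕ} {f : Gam τ (n + 1)} {i k : Fin (n + 1)} {N : ℕ}
    {P : PowerSeries (Gam τ n)} (h : Expands τ f i k N P) {g : ℤ → Gam τ n}
    (hg : IsLaurentExpansion τ f i (fun y => point y k) g) : g = laurentAt N P := by
  funext m
  refine Gam_ext τ fun y => ?_
  have := (h y).eq_laurentAt_of_hasSum
    (hg.1.imp fun K hK m hm => by rw [hK m hm]; rfl) (hg.hasSum_slice τ y) m
  rw [this, laurentAt_map]
  rfl

/-- Coefficientwise derivative of a power series over the coordinate ring. -/
def coeffDeriv {n : ℕ} (l : Fin n) (P : PowerSeries (Gam τ n)) : PowerSeries (Gam τ n) :=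
  PowerSeries.mk fun m => partialGam τ l (PowerSeries.coeff m P)

theorem coeffDeriv_add {n : ℕ} (l : Fin n) (P Q : PowerSeries (Gam τ n)) :
    coeffDeriv τ l (P + Q) = coeffDeriv τ l P + coeffDeriv τ l Q := by
  ext m : 1
  simp [coeffDeriv]

theorem coeffDeriv_mul {n : ℕ} (l : Fin n) (P Q : PowerSeries (Gam τ n)) :
    coeffDeriv τ l (P * Q) = P * coeffDeriv τ l Q + Q * coeffDeriv τ l P := by
  ext m : 1
  rw [mul_comm Q]
  simp only [coeffDeriv, map_add, PowerSeries.coeff_mk, PowerSeries.coeff_mul, map_sum,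
    partialGam_mul, Finset.sum_add_distrib]
  simp_rw [mul_comm]

theorem coeffDeriv_C {n : ℕ} (l : Fin n) (f : Gam τ n) :
    coeffDeriv τ l (PowerSeries.C f) = PowerSeries.C (partialGam τ l f) := by
  ext m : 1
  simp only [coeffDeriv, PowerSeries.coeff_mk, PowerSeries.coeff_C]
  split_ifs <;> simp

theorem coeffDeriv_X_pow {n : ℕ} (l : Fin n) (M : ℕ) :
    coeffDeriv τ l (PowerSeries.X ^ M) = 0 := by
  ext m : 1
  simp only [coeffDeriv, PowerSeries.coeff_mk, PowerSeries.coeff_X_pow]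
  have : partialGam τ l (1 : Gam τ n) = 0 := by
    simpa using partialGam_algebraMap τ l 1
  split_ifs <;> simp [this]

theorem coeffDeriv_map_algebraMap {n : ℕ} (l : Fin n) (p : PowerSeries ℂ) :
    coeffDeriv τ l (p.map (algebraMap ℂ (Gam τ n))) = 0 := by
  ext m : 1
  simp [coeffDeriv, partialGam_algebraMap]

theorem coeffDeriv_taylorGam {n : ℕ} (l l' : Fin n) (f : Gam τ n) :
    coeffDeriv τ l (taylorGam τ l' f) = taylorGam τ l' (partialGam τ l f) := by
  ext m : 1
  simp [coeffDeriv, taylorGam, partialGam_iterate_comm]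

theorem derivative_taylorGam {n : ℕ} (l : Fin n) (f : Gam τ n) :
    PowerSeries.derivative _ (taylorGam τ l f) = taylorGam τ l (partialGam τ l f) := by
  ext m : 1
  simp only [PowerSeries.coeff_derivative, taylorGam, PowerSeries.coeff_mk, Nat.factorial_succ,
    Function.iterate_succ_apply]
  rw [show ((m : Gam τ n) + 1) = algebraMap ℂ _ (m + 1 : ℂ) by simp, mul_comm,
    ← Algebra.smul_def, smul_smul]
  congr 1
  have : (m.factorial : ℂ) ≠ 0 := by exact_mod_cast m.factorial_ne_zero
  have : (m + 1 : ℂ) ≠ 0 := by exact_mod_cast m.succ_ne_zero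
  push_cast
  field_simp

/-- The effect on an expansion `t ^ (-N) * P`, `t = x_i - c`, of the derivative in the `l`-th of
the remaining variables: it acts on the coefficients and, if the center `c` is that variable, on
`t`. The result is normalized by `t ^ (-(N + 1))`. -/
def expansionDeriv {n : ℕ} (k : Fin (n + 1)) (l : Fin n) (N : ℕ) (P : PowerSeries (Gam τ n)) :
    PowerSeries (Gam τ n) :=
  PowerSeries.X * coeffDeriv τ l P - if k = l.castSucc then
    PowerSeries.X * PowerSeries.derivative _ P - (N : PowerSeries (Gam τ n)) * P else 0

/-- `f` has a Laurent expansion with regular coefficients, compatible with all derivations. -/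
def Expandable {n : ℕ} (i k : Fin (n + 1)) (f : Gam τ (n + 1)) : Prop :=
  ∃ (N : ℕ) (P : PowerSeries (Gam τ n)), Expands τ f i k N P ∧
    ∀ l : Fin n, Expands τ (partialGam τ (i.succAbove l) f) i k (N + 1) (expansionDeriv τ k l N P)

theorem expansionDeriv_raise {n : ℕ} (k : Fin (n + 1)) (l : Fin n) (N M : ℕ)
    (P : PowerSeries (Gam τ n)) :
    expansionDeriv τ k l (N + M) (PowerSeries.X ^ M * P) =
      PowerSeries.X ^ M * expansionDeriv τ k l N P := by
  rw [expansionDeriv, expansionDeriv, coeffDeriv_mul, coeffDeriv_X_pow, Derivation.leibniz,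
    Derivation.leibniz_pow]
  split_ifs
  · rcases M with _ | M
    · simp
    · simp only [Nat.add_sub_cancel, smul_eq_mul, PowerSeries.derivative_X, nsmul_eq_mul]
      push_cast
      ring
  · ring

namespace Expandable

variable {τ} {n : ℕ} {i k : Fin (n + 1)} {f g : Gam τ (n + 1)}

theorem const (c : ℂ) : Expandable τ i k (algebraMap ℂ _ c) := by
  refine ⟨0, _, Expands.const c, fun l => ?_⟩
  rw [partialGam_algebraMap]
  have := (Expands.const (i := i) (k := k) (τ := τ) (n := n) 0).raise 1
  simpa [expansionDeriv, coeffDeriv_C, partialGam_algebraMap] using this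

theorem add (hf : Expandable τ i k f) (hg : Expandable τ i k g) : Expandable τ i k (f + g) := by
  obtain ⟨N, P, h1, h2⟩ := hf
  obtain ⟨M, Q, h3, h4⟩ := hg
  refine ⟨N + M, _, (h1.raise M).add (by rw [add_comm]; exact h3.raise N), fun l => ?_⟩
  rw [map_add]
  have e := ((h2 l).raise M).add (Q := PowerSeries.X ^ N * expansionDeriv τ k l M Q)
    (by rw [show N + 1 + M = M + 1 + N by ring]; exact (h4 l).raise N)
  rw [show N + 1 + M = N + M + 1 by ring] at e
  convert e using 1
  rw [← expansionDeriv_raise, ← expansionDeriv_raise, add_comm M N]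
  simp only [expansionDeriv, coeffDeriv_add, map_add]
  split_ifs <;> ring

theorem mul (hf : Expandable τ i k f) (hg : Expandable τ i k g) : Expandable τ i k (f * g) := by
  obtain ⟨N, P, h1, h2⟩ := hf
  obtain ⟨M, Q, h3, h4⟩ := hg
  refine ⟨N + M, _, h1.mul h3, fun l => ?_⟩
  rw [partialGam_mul]
  have e := (h1.mul (h4 l)).add (Q := Q * expansionDeriv τ k l N P)
    (by rw [show N + (M + 1) = M + (N + 1) by ring]; exact h3.mul (h2 l))
  have e' : expansionDeriv τ k l (N + M) (P * Q) =
      P * expansionDeriv τ k l M Q + Q * expansionDeriv τ k l N P := by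
    simp only [expansionDeriv, coeffDeriv_mul, Derivation.leibniz, smul_eq_mul]
    split_ifs
    · push_cast; ring
    · ring
  rw [e']
  exact e

/-- A function not involving the variable `x_i`. -/
theorem pull_succAbove (h : Gam τ n) :
    Expandable τ i k (pull τ i.succAbove Fin.succAbove_right_injective h) := by
  have key : ∀ h : Gam τ n, Expands τ (pull τ i.succAbove Fin.succAbove_right_injective h) i k 0
      (PowerSeries.C h) := by
    intro h y
    rw [PowerSeries.map_C]
    refine (HasLaurent.const _).congr ?_
    filter_upwards [eventually_insertNth_mem τ i k y.2] with t ht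
    rw [slice, ext_pull τ _ _ ht]
    have : (i.insertNth (α := fun _ => ℂ) (point y.1 k + t) y.1) ∘ i.succAbove = y.1 := by
      funext l; simp
    rw [this, ext_of_mem τ _ y.2]
    rfl
  refine ⟨0, _, key h, fun l => ?_⟩
  rw [partialGam_pull]
  simpa [expansionDeriv, coeffDeriv_C] using (key (partialGam τ l h)).raise 1

/-- The index map replacing the `l₀`-th of the remaining variables by `x_i`. -/
def replace (i : Fin (n + 1)) (l₀ : Fin n) (l : Fin n) : Fin (n + 1) :=
  if l = l₀ then i else i.succAbove l

theorem replace_injective (i : Fin (n + 1)) (l₀ : Fin n) :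
    Function.Injective (replace i l₀) := by
  intro a b h
  unfold replace at h
  split_ifs at h with h1 h2 h2
  · rw [h1, h2]
  · exact absurd h.symm (Fin.succAbove_ne i b)
  · exact absurd h (Fin.succAbove_ne i a)
  · exact Fin.succAbove_right_injective h

/-- A function of the variables other than `x_k`, expanded around `x_i = x_k`, has a Taylor
expansion. -/
theorem pull_replace (l₀ : Fin n) (h : Gam τ n) :
    Expandable τ i l₀.castSucc (pull τ (replace i l₀) (replace_injective i l₀) h) := by
  have key : ∀ h : Gam τ n, Expands τ (pull τ (replace i l₀) (replace_injective i l₀) h) i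
      l₀.castSucc 0 (taylorGam τ l₀ h) := by
    intro h y
    refine (hasLaurent_taylorGam τ l₀ h y).congr ?_
    filter_upwards [eventually_insertNth_mem τ i l₀.castSucc y.2] with t ht
    rw [slice, ext_pull τ _ _ ht]
    congr 1
    funext l
    simp only [Function.comp_apply, replace, point_castSucc]
    split_ifs with hl
    · subst hl; simp
    · simp [hl]
  refine ⟨0, _, key h, fun l => ?_⟩
  by_cases hl : l = l₀
  · subst hl
    rw [partialGam_pull_of_notMem]
    · have := (Expands.const (i := i) (k := l.castSucc) (τ := τ) (n := n) 0).raise 1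
      simpa [expansionDeriv, coeffDeriv_taylorGam, derivative_taylorGam] using this
    · intro l'
      unfold replace
      split_ifs with h'
      · exact (Fin.succAbove_ne i l).symm
      · exact fun e => h' (Fin.succAbove_right_injective e)
  · have e := partialGam_pull τ (replace_injective i l₀) h l
    rw [show replace i l₀ l = i.succAbove l by simp [replace, hl]] at e
    rw [e]
    have hl' : l₀.castSucc ≠ l.castSucc := fun e => hl (by simpa using e.symm)
    have := (key (partialGam τ l h)).raise 1
    simpa [expansionDeriv, coeffDeriv_taylorGam, hl'] using this

/-- A function of `x_i` alone, expanded around the origin, has constant coefficients. -/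
theorem of_slice_eq {φ : ℂ → ℂ} (hφ : MeromorphicAt φ 0)
    (h : ∀ (y : conf τ n), ∀ᶠ t in 𝓝[≠] (0 : ℂ), slice τ f i (Fin.last n) y.1 t = φ t)
    (h' : ∀ l, partialGam τ (i.succAbove l) f = 0) : Expandable τ i (Fin.last n) f := by
  obtain ⟨N, p, hp⟩ := HasLaurent.of_meromorphicAt hφ
  refine ⟨N, p.map (algebraMap ℂ (Gam τ n)), fun y => ?_, fun l => ?_⟩
  · have : (p.map (algebraMap ℂ (Gam τ n))).map (evalAt τ y : Gam τ n →+* ℂ) = p := by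
      ext m; simp
    rw [this]
    exact hp.congr (h y)
  · rw [h' l]
    have hl' : Fin.last n ≠ l.castSucc := (Fin.castSucc_lt_last l).ne'
    have := (Expands.const (i := i) (k := Fin.last n) (τ := τ) (n := n) 0).raise (N + 1)
    simpa [expansionDeriv, coeffDeriv_map_algebraMap, hl'] using this

end Expandable

end ChiralHomology

namespace ChiralHomology

variable (τ : ℍ)

/-! ### Expansion of the secant slopes at their pole -/

/-- The Taylor series of `ζ(y_l + t) - ζ(y_l)` in `t`, whose coefficients are regular because the
derivative of `ζ` is `-℘`. -/
def zetaTaylor {n : ℕ} (l : Fin n) : PowerSeries (Gam τ n) :=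
  PowerSeries.mk fun m => match m with
    | 0 => 0
    | m + 1 => -(((m + 1).factorial : ℂ)⁻¹ • (partialGam τ l)^[m] (genU τ l))

theorem hasLaurent_zetaTaylor {n : ℕ} (l : Fin n) (y : conf τ n) :
    HasLaurent (fun t => (periods τ).zeta (y.1 l + t) - (periods τ).zeta (y.1 l)) 0
      ((zetaTaylor τ l).map (evalAt τ y : Gam τ n →+* ℂ)) := by
  have han : AnalyticAt ℂ
      (fun t => (periods τ).zeta (y.1 l + t) - (periods τ).zeta (y.1 l)) 0 := by
    have : AnalyticAt ℂ (fun t => (periods τ).zeta (y.1 l + t)) 0 :=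
      AnalyticAt.fun_comp_of_eq ((periods τ).analyticAt_zeta (y.2.1 l)) (by fun_prop) (by simp)
    fun_prop
  have hd : deriv (fun t => (periods τ).zeta (y.1 l + t) - (periods τ).zeta (y.1 l)) =ᶠ[𝓝 0]
      -fun t => ext τ (genU τ l).1 (Function.update y.1 l (y.1 l + t)) := by
    filter_upwards [eventually_update_add_mem_conf τ l y] with t ht
    have h1 : y.1 l + t ∉ (periods τ).lattice := by simpa [lattice] using ht.1 l
    have h2 := (HasDerivAt.comp_const_add (y.1 l) t ((periods τ).hasDerivAt_zeta h1)).sub_const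
      ((periods τ).zeta (y.1 l))
    rw [h2.deriv, Pi.neg_apply, ext_of_mem τ _ ht]
    simp [genU]
  convert HasLaurent.of_analyticAt han using 1
  ext m
  rw [PowerSeries.coeff_map, PowerSeries.coeff_mk]
  rcases m with _ | m
  · simp [zetaTaylor]
  · rw [iteratedDeriv_succ', hd.iteratedDeriv_eq, iteratedDeriv_neg,
      (iteratedDeriv_ext τ l (genU τ l) y m).self_of_nhds]
    simp only [add_zero, Function.update_eq_self]
    rw [ext_of_mem τ _ y.2, zetaTaylor, PowerSeries.coeff_mk, neg_div, div_eq_inv_mul]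
    rfl

theorem derivative_zetaTaylor {n : ℕ} (l : Fin n) :
    PowerSeries.derivative _ (zetaTaylor τ l) = -taylorGam τ l (genU τ l) := by
  ext m : 1
  simp only [PowerSeries.coeff_derivative, taylorGam, zetaTaylor, PowerSeries.coeff_mk,
    Nat.factorial_succ, map_neg]
  rw [show ((m : Gam τ n) + 1) = algebraMap ℂ _ (m + 1 : ℂ) by simp, mul_comm,
    ← Algebra.smul_def, smul_neg, smul_smul]
  congr 2
  have : (m.factorial : ℂ) ≠ 0 := by exact_mod_cast m.factorial_ne_zero
  have : (m + 1 : ℂ) ≠ 0 := by exact_mod_cast m.succ_ne_zero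
  push_cast
  field_simp

theorem coeffDeriv_zetaTaylor {n : ℕ} (l : Fin n) :
    coeffDeriv τ l (zetaTaylor τ l) =
      PowerSeries.C (genU τ l) - taylorGam τ l (genU τ l) := by
  ext m : 1
  rcases m with _ | m
  · simp [coeffDeriv, zetaTaylor, taylorGam]
  · simp [coeffDeriv, zetaTaylor, taylorGam, ← Function.iterate_succ_apply',
      -Function.iterate_succ]

theorem coeffDeriv_zetaTaylor_of_ne {n : ℕ} {l l' : Fin n} (h : l ≠ l') :
    coeffDeriv τ l (zetaTaylor τ l') = 0 := by
  ext m : 1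
  rcases m with _ | m
  · simp [coeffDeriv, zetaTaylor]
  · simp [coeffDeriv, zetaTaylor, partialGam_iterate_comm, partialGam_genU_of_ne τ h.symm]

theorem coeffDeriv_rescale {n : ℕ} (l : Fin n) (P : PowerSeries (Gam τ n)) :
    coeffDeriv τ l (PowerSeries.rescale (-1) P) = PowerSeries.rescale (-1) (coeffDeriv τ l P) := by
  ext m : 1
  simp only [coeffDeriv, PowerSeries.coeff_mk, PowerSeries.coeff_rescale]
  rcases neg_one_pow_eq_or (Gam τ n) m with h | h <;> simp [h]

theorem map_rescale_neg_one {R S : Type*} [CommRing R] [CommRing S] (f : R →+* S)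
    (P : PowerSeries R) :
    (PowerSeries.rescale (-1) P).map f = PowerSeries.rescale (-1) (P.map f) := by
  ext m : 1
  simp

theorem expansionDeriv_add {n : ℕ} (k : Fin (n + 1)) (l : Fin n) (N : ℕ)
    (P Q : PowerSeries (Gam τ n)) :
    expansionDeriv τ k l N (P + Q) = expansionDeriv τ k l N P + expansionDeriv τ k l N Q := by
  simp only [expansionDeriv, coeffDeriv_add, map_add]
  split_ifs <;> ring

namespace Expandable

variable {n : ℕ} (i : Fin (n + 1))

theorem eventually_zeta_eq :
    ∀ᶠ t in 𝓝[≠] (0 : ℂ), (periods τ).weierstrassP t = -deriv (periods τ).zeta t := by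
  filter_upwards [(periods τ).eventually_nhdsNE_zero_notMem] with t ht
  rw [((periods τ).hasDerivAt_zeta ht).deriv, neg_neg]

theorem expands_zero (k : Fin (n + 1)) (N : ℕ) : Expands τ 0 i k N (0 : PowerSeries (Gam τ n)) := by
  simpa using (Expands.const (i := i) (k := k) (τ := τ) (n := n) 0).raise N

theorem map_map_evalAt (y : conf τ n) (q : PowerSeries ℂ) :
    (q.map (algebraMap ℂ (Gam τ n))).map (evalAt τ y : Gam τ n →+* ℂ) = q := by
  ext m
  simp

theorem derivative_map_algebraMap (q : PowerSeries ℂ) :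
    PowerSeries.derivative (Gam τ n) (q.map (algebraMap ℂ (Gam τ n))) =
      (PowerSeries.derivative ℂ q).map (algebraMap ℂ (Gam τ n)) := by
  ext m : 1
  simp [PowerSeries.coeff_derivative]

theorem coeffDeriv_neg (l : Fin n) (P : PowerSeries (Gam τ n)) :
    coeffDeriv τ l (-P) = -coeffDeriv τ l P := by
  ext m : 1
  simp [coeffDeriv]

/-- Half the secant slope of `x_i` and `x_k`, expanded along `x_i = x_k`. -/
theorem half_genS_self (l₀ : Fin n) :
    Expandable τ i l₀.castSucc ((2⁻¹ : ℂ) • genS τ i (i.succAbove l₀)) := by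
  obtain ⟨N, p, hp⟩ := HasLaurent.of_meromorphicAt (periods τ).meromorphicAt_zeta_zero
  set A : PowerSeries (Gam τ n) := p.map (algebraMap ℂ (Gam τ n)) with hA
  set B : PowerSeries (Gam τ n) := -zetaTaylor τ l₀ with hB
  have hB' : ∀ y : conf τ n, HasLaurent (fun t => -((periods τ).zeta (y.1 l₀ + t) -
      (periods τ).zeta (y.1 l₀))) 0 (B.map (evalAt τ y : Gam τ n →+* ℂ)) := by
    intro y
    rw [hB, map_neg]
    exact (hasLaurent_zetaTaylor τ l₀ y).neg
  refine ⟨N, A + PowerSeries.X ^ N * B, fun y => ?_, fun l => ?_⟩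
  · rw [map_add, map_mul, hA, map_map_evalAt, map_pow, PowerSeries.map_X]
    have h2 := (hB' y).raise N
    rw [zero_add] at h2
    refine (hp.add h2).congr ?_
    filter_upwards [eventually_insertNth_mem τ i l₀.castSucc y.2] with t ht
    rw [slice, ext_of_mem τ _ ht]
    simp [genS, PeriodPair.secant]
    ring
  by_cases hl : l = l₀
  · subst hl
    intro y
    -- the `t`-derivatives of the two zeta functions combine to `℘(t) - ℘(y_l)`
    have e : expansionDeriv τ l.castSucc l N (A + PowerSeries.X ^ N * B) =
        (-(PowerSeries.X * PowerSeries.derivative _ p - (N : PowerSeries ℂ) * p)).map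
          (algebraMap ℂ (Gam τ n)) - PowerSeries.X ^ (N + 1) * PowerSeries.C (genU τ l) := by
      have e1 := expansionDeriv_raise τ l.castSucc l 0 N B
      rw [zero_add] at e1
      rw [expansionDeriv_add, e1]
      simp only [expansionDeriv, if_true]
      rw [hB, coeffDeriv_neg, map_neg, coeffDeriv_zetaTaylor, derivative_zetaTaylor, hA,
        derivative_map_algebraMap, coeffDeriv_map_algebraMap]
      simp only [map_sub, map_neg, map_mul, PowerSeries.map_X, map_natCast]
      push_cast
      ring
    rw [e, map_sub, map_map_evalAt]
    have h2 := (HasLaurent.const ((periods τ).weierstrassP (y.1 l))).raise (N + 1)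
    rw [zero_add] at h2
    have e5 : (PowerSeries.X ^ (N + 1) * PowerSeries.C (genU τ l)).map
        (evalAt τ y : Gam τ n →+* ℂ) = PowerSeries.X ^ (N + 1) *
          PowerSeries.C ((periods τ).weierstrassP (y.1 l)) := by
      simp [genU]
    rw [e5]
    refine (hp.deriv.neg.sub h2).congr ?_
    filter_upwards [eventually_insertNth_mem τ i l.castSucc y.2, eventually_zeta_eq τ]
      with t ht ht'
    rw [slice, ext_of_mem τ _ ht, map_smul]
    have := partialGam_genS τ (Fin.succAbove_ne i l).symm ⟨_, ht⟩
    change (2⁻¹ : ℂ) * (partialGam τ (i.succAbove l) (genS τ i (i.succAbove l))).1 _ = _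
    rw [this]
    simp [ht']
  · rw [map_smul, partialGam_genS_of_ne τ (Fin.succAbove_ne i l₀).symm (Fin.succAbove_ne i l).symm
      (fun e => hl (Fin.succAbove_right_injective e).symm), smul_zero]
    have hl' : l₀.castSucc ≠ l.castSucc := fun e => hl (by simpa using e.symm)
    have : expansionDeriv τ l₀.castSucc l N (A + PowerSeries.X ^ N * B) = 0 := by
      rw [expansionDeriv, if_neg hl', coeffDeriv_add, coeffDeriv_mul, hB, coeffDeriv_neg,
        coeffDeriv_zetaTaylor_of_ne τ hl, coeffDeriv_X_pow, hA, coeffDeriv_map_algebraMap]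
      simp
    rw [this]
    exact expands_zero τ i _ _

/-- Half the secant slope of `x_i` and another variable, expanded along `x_i = 0`. -/
theorem half_genS_last (l₀ : Fin n) :
    Expandable τ i (Fin.last n) ((2⁻¹ : ℂ) • genS τ i (i.succAbove l₀)) := by
  obtain ⟨N, p, hp⟩ := HasLaurent.of_meromorphicAt (periods τ).meromorphicAt_zeta_zero
  set A : PowerSeries (Gam τ n) := (-p).map (algebraMap ℂ (Gam τ n)) with hA
  set B : PowerSeries (Gam τ n) := -PowerSeries.rescale (-1) (zetaTaylor τ l₀) with hB
  have hB' : ∀ y : conf τ n, HasLaurent (fun t => -((periods τ).zeta (y.1 l₀ + -t) -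
      (periods τ).zeta (y.1 l₀))) 0 (B.map (evalAt τ y : Gam τ n →+* ℂ)) := by
    intro y
    have := (hasLaurent_zetaTaylor τ l₀ y).comp_neg.neg
    rw [pow_zero, one_mul] at this
    rwa [hB, map_neg, map_rescale_neg_one]
  have e3 : ∀ l, coeffDeriv τ l (A + PowerSeries.X ^ N * B) =
      -(PowerSeries.X ^ N * PowerSeries.rescale (-1) (coeffDeriv τ l (zetaTaylor τ l₀))) := by
    intro l
    rw [coeffDeriv_add, coeffDeriv_mul, hB, coeffDeriv_neg, coeffDeriv_rescale, coeffDeriv_X_pow,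
      hA, coeffDeriv_map_algebraMap]
    ring
  refine ⟨N, A + PowerSeries.X ^ N * B, fun y => ?_, fun l => ?_⟩
  · rw [map_add, map_mul, hA, map_map_evalAt, map_pow, PowerSeries.map_X]
    have h2 := (hB' y).raise N
    rw [zero_add] at h2
    refine (hp.neg.add h2).congr ?_
    filter_upwards [eventually_insertNth_mem τ i (Fin.last n) y.2] with t ht
    rw [slice, ext_of_mem τ _ ht]
    have hz : (periods τ).zeta (t - y.1 l₀) = -(periods τ).zeta (y.1 l₀ + -t) := by
      rw [← (periods τ).zeta_neg]
      congr 1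
      ring
    simp [genS, PeriodPair.secant, hz]
    ring
  have hl' : Fin.last n ≠ l.castSucc := (Fin.castSucc_lt_last l).ne'
  by_cases hl : l = l₀
  · subst hl
    intro y
    rw [expansionDeriv, if_neg hl', e3, coeffDeriv_zetaTaylor]
    have h1 := ((hasLaurent_taylorGam τ l (genU τ l) y).comp_neg.sub
      (HasLaurent.const ((periods τ).weierstrassP (y.1 l)))).raise (N + 1)
    have e5 : PowerSeries.rescale (-1) (PowerSeries.C (genU τ l)) = PowerSeries.C (genU τ l) := by
      ext m : 1
      rw [PowerSeries.coeff_rescale, PowerSeries.coeff_C]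
      split_ifs with hm
      · simp [hm]
      · simp
    have e4 : (PowerSeries.X * -(PowerSeries.X ^ N * PowerSeries.rescale (-1)
        (PowerSeries.C (genU τ l) - taylorGam τ l (genU τ l))) - 0).map
          (evalAt τ y : Gam τ n →+* ℂ) = PowerSeries.X ^ (N + 1) *
        ((-1) ^ 0 * PowerSeries.rescale (-1) ((taylorGam τ l (genU τ l)).map
          (evalAt τ y : Gam τ n →+* ℂ)) - PowerSeries.C ((periods τ).weierstrassP (y.1 l))) := by
      have e6 : evalAt τ y (genU τ l) = (periods τ).weierstrassP (y.1 l) := rfl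
      simp only [sub_zero, map_mul, map_neg, map_sub, map_pow, PowerSeries.map_X, e5,
        map_rescale_neg_one, PowerSeries.map_C, RingHom.coe_coe, e6]
      ring
    rw [e4]
    rw [zero_add] at h1
    refine h1.congr ?_
    have hn : Tendsto (fun t : ℂ => -t) (𝓝[≠] 0) (𝓝 0) :=
      (continuous_neg.tendsto' 0 0 neg_zero).mono_left nhdsWithin_le_nhds
    filter_upwards [eventually_insertNth_mem τ i (Fin.last n) y.2,
      hn.eventually (eventually_update_add_mem_conf τ l y)] with t ht ht'
    rw [slice, ext_of_mem τ _ ht, ext_of_mem τ _ ht', map_smul]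
    have := partialGam_genS τ (Fin.succAbove_ne i l).symm ⟨_, ht⟩
    change (2⁻¹ : ℂ) * (partialGam τ (i.succAbove l) (genS τ i (i.succAbove l))).1 _ = _
    rw [this]
    have hz : (periods τ).weierstrassP (t - y.1 l) =
        (periods τ).weierstrassP (y.1 l + -t) := by
      rw [← (periods τ).weierstrassP_neg]
      congr 1
      ring
    simp [genU, hz]
  · rw [map_smul, partialGam_genS_of_ne τ (Fin.succAbove_ne i l₀).symm (Fin.succAbove_ne i l).symm
      (fun e => hl (Fin.succAbove_right_injective e).symm), smul_zero]
    have : expansionDeriv τ (Fin.last n) l N (A + PowerSeries.X ^ N * B) = 0 := by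
      rw [expansionDeriv, if_neg hl', e3, coeffDeriv_zetaTaylor_of_ne τ hl]
      simp
    rw [this]
    exact expands_zero τ i _ _

theorem of_half (k : Fin (n + 1)) {f : Gam τ (n + 1)} (h : Expandable τ i k ((2⁻¹ : ℂ) • f)) :
    Expandable τ i k f := by
  have := (Expandable.const 2).mul h
  rwa [← Algebra.smul_def, smul_smul, mul_inv_cancel₀ two_ne_zero, one_smul] at this

end Expandable

/-- The secant slope of `x_i` and another variable has a pole only at that variable and at the
origin; at every other center it is a pullback, with a Taylor expansion. -/
theorem expandable_genS {n : ℕ} (i k : Fin (n + 1)) (l : Fin n) :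
    Expandable τ i k (genS τ i (i.succAbove l)) := by
  induction k using Fin.lastCases with
  | last => exact Expandable.of_half τ i _ (Expandable.half_genS_last τ i l)
  | cast k =>
    by_cases h : l = k
    · subst h; exact Expandable.of_half τ i _ (Expandable.half_genS_self τ i l)
    · have := Expandable.pull_replace (i := i) k (genS τ k l)
      rw [pull_genS] at this
      simpa [Expandable.replace, h] using this

/-- Every regular function has Laurent expansions with regular coefficients. -/
theorem expandable {n : ℕ} (i k : Fin (n + 1)) (f : Gam τ (n + 1)) : Expandable τ i k f := by
  have hneg : ∀ {f : Gam τ (n + 1)}, Expandable τ i k f → Expandable τ i k (-f) := fun hf => by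
    have := (Expandable.const (-1)).mul hf
    rwa [← Algebra.smul_def, neg_smul, one_smul] at this
  induction f using Gam_induction with
  | const c => exact Expandable.const c
  | add f g hf hg => exact hf.add hg
  | mul f g hf hg => exact hf.mul hg
  | U j =>
    induction j using Fin.succAboveCases i with
    | p l => exact Expandable.pull_succAbove (genU τ l)
    | x =>
      induction k using Fin.lastCases with
      | last =>
        refine Expandable.of_slice_eq ((periods τ).meromorphic_weierstrassP 0) (fun y => ?_)
          fun l => partialGam_genU_of_ne τ (Fin.succAbove_ne i l).symm
        filter_upwards [eventually_insertNth_mem τ i (Fin.last n) y.2] with t ht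
        rw [slice, ext_of_mem τ _ ht]
        simp [genU]
      | cast k =>
        have := Expandable.pull_replace (i := i) k (genU τ k)
        rw [pull_genU] at this
        simpa [Expandable.replace] using this
  | V j =>
    induction j using Fin.succAboveCases i with
    | p l => exact Expandable.pull_succAbove (genV τ l)
    | x =>
      induction k using Fin.lastCases with
      | last =>
        refine Expandable.of_slice_eq ((periods τ).meromorphic_derivWeierstrassP 0) (fun y => ?_)
          fun l => partialGam_genV_of_ne τ (Fin.succAbove_ne i l).symm
        filter_upwards [eventually_insertNth_mem τ i (Fin.last n) y.2] with t ht
        rw [slice, ext_of_mem τ _ ht]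
        simp [genV]
      | cast k =>
        have := Expandable.pull_replace (i := i) k (genV τ k)
        rw [pull_genV] at this
        simpa [Expandable.replace] using this
  | S j j' h =>
    induction j using Fin.succAboveCases i with
    | p l =>
      induction j' using Fin.succAboveCases i with
      | p l' => exact Expandable.pull_succAbove (genS τ l l')
      | x =>
        rw [genS_comm]
        exact hneg (expandable_genS τ i k l)
    | x =>
      induction j' using Fin.succAboveCases i with
      | p l' => exact expandable_genS τ i k l'
      | x => exact absurd rfl h

end ChiralHomology

/-! ### Laurent coefficients as linear maps -/

namespace ChiralHomology

variable (τ : ℍ)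

theorem existsUnique_isLaurentExpansion {n : ℕ} (f : Gam τ (n + 1)) (i k : Fin (n + 1)) :
    ∃! g, IsLaurentExpansion τ f i (fun y => point y k) g := by
  obtain ⟨N, P, h, -⟩ := expandable τ i k f
  exact ⟨_, h.isLaurentExpansion, fun _ hg => h.eq_laurentAt τ hg⟩

theorem Expands.laurentCoeff_eq {n : ℕ} {f : Gam τ (n + 1)} {i k : Fin (n + 1)} {N : ℕ}
    {P : PowerSeries (Gam τ n)} (h : Expands τ f i k N P) :
    laurentCoeff τ f i (fun y => point y k) = laurentAt N P := by
  have hex : ∃ g, IsLaurentExpansion τ f i (fun y => point y k) g := ⟨_, h.isLaurentExpansion⟩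
  rw [laurentCoeff, dif_pos hex]
  exact h.eq_laurentAt τ hex.choose_spec

theorem laurentAt_add {R : Type*} [Semiring R] (N : ℕ) (P Q : PowerSeries R) (m : ℤ) :
    laurentAt N (P + Q) m = laurentAt N P m + laurentAt N Q m := by
  simp only [laurentAt]
  split_ifs <;> simp

theorem laurentAt_smul {R : Type*} [CommRing R] [Algebra ℂ R] (N : ℕ) (c : ℂ) (P : PowerSeries R)
    (m : ℤ) : laurentAt N (c • P) m = c • laurentAt N P m := by
  simp only [laurentAt]
  split_ifs <;> simp

/-- The coefficient of `t ^ m`, `t = x_i - c`, in the Laurent expansion around the center `k`. -/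
def laurentLin {n : ℕ} (i k : Fin (n + 1)) (m : ℤ) : Gam τ (n + 1) →ₗ[ℂ] Gam τ n where
  toFun f := laurentCoeff τ f i (fun y => point y k) m
  map_add' f g := by
    obtain ⟨N, P, h, -⟩ := expandable τ i k f
    obtain ⟨M, Q, h', -⟩ := expandable τ i k g
    have h1 := h.raise M
    have h2 := h'.raise N
    rw [add_comm] at h2
    rw [(h1.add h2).laurentCoeff_eq, h1.laurentCoeff_eq, h2.laurentCoeff_eq, laurentAt_add]
  map_smul' c f := by
    obtain ⟨N, P, h, -⟩ := expandable τ i k f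
    rw [(h.smul c).laurentCoeff_eq, h.laurentCoeff_eq, laurentAt_smul]
    rfl

theorem Expands.laurentLin_eq {n : ℕ} {f : Gam τ (n + 1)} {i k : Fin (n + 1)} {N : ℕ}
    {P : PowerSeries (Gam τ n)} (h : Expands τ f i k N P) (m : ℤ) :
    laurentLin τ i k m f = laurentAt N P m :=
  congrFun (h.laurentCoeff_eq τ) m

theorem laurentCoeff_castSucc {n : ℕ} (f : Gam τ (n + 1)) (i : Fin (n + 1)) (k : Fin n) (m : ℤ) :
    laurentCoeff τ f i (fun y => y k) m = laurentLin τ i k.castSucc m f := by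
  simp [laurentLin]

theorem laurentCoeff_last {n : ℕ} (f : Gam τ (n + 1)) (i : Fin (n + 1)) (m : ℤ) :
    laurentCoeff τ f i (fun _ => 0) m = laurentLin τ i (Fin.last n) m f := by
  simp [laurentLin]

theorem laurentLin_eq_zero {n : ℕ} (i k : Fin (n + 1)) (f : Gam τ (n + 1)) :
    ∃ N : ℕ, ∀ m < -(N : ℤ), laurentLin τ i k m f = 0 := by
  obtain ⟨N, P, h, -⟩ := expandable τ i k f
  exact ⟨N, fun m hm => by rw [h.laurentLin_eq, laurentAt_of_lt P hm]⟩

theorem laurentLin_partialGam_self {n : ℕ} (i k : Fin (n + 1)) (f : Gam τ (n + 1)) (m : ℤ) :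
    laurentLin τ i k m (partialGam τ i f) = (m + 1) • laurentLin τ i k (m + 1) f := by
  obtain ⟨N, P, h, -⟩ := expandable τ i k f
  rw [h.deriv_self.laurentLin_eq, h.laurentLin_eq, laurentAt_deriv, zsmul_eq_mul]

/-- If the center is the variable `x_l` itself, then `t = x_i - x_l` depends on it, which
contributes the derivative in `t`. -/
theorem laurentLin_partialGam_succAbove {n : ℕ} (i k : Fin (n + 1)) (l : Fin n)
    (f : Gam τ (n + 1)) (m : ℤ) :
    laurentLin τ i k m (partialGam τ (i.succAbove l) f) =
      partialGam τ l (laurentLin τ i k m f) -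
        if k = l.castSucc then (m + 1) • laurentLin τ i k (m + 1) f else 0 := by
  obtain ⟨N, P, h, h'⟩ := expandable τ i k f
  have e : laurentAt (N + 1) (PowerSeries.X * coeffDeriv τ l P) m =
      partialGam τ l (laurentAt N P m) := by
    rw [← pow_one (PowerSeries.X : PowerSeries (Gam τ n)), laurentAt_X_pow_mul]
    simp only [laurentAt, coeffDeriv]
    split_ifs <;> simp
  have e' : ∀ (Q R : PowerSeries (Gam τ n)), laurentAt (N + 1) (Q - R) m =
      laurentAt (N + 1) Q m - laurentAt (N + 1) R m := fun Q R => by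
    rw [eq_sub_iff_add_eq, ← laurentAt_add, sub_add_cancel]
  rw [(h' l).laurentLin_eq, h.laurentLin_eq, h.laurentLin_eq, expansionDeriv, e', e]
  congr 1
  split_ifs
  · rw [laurentAt_deriv, zsmul_eq_mul]
  · simp [laurentAt]

theorem laurentLin_hasSum {n : ℕ} (i k : Fin (n + 1)) (f : Gam τ (n + 1)) (y : conf τ n) :
    ∃ (N : ℕ) (p : PowerSeries ℂ), HasLaurent (slice τ f i k y.1) N p ∧
      ∀ m, evalAt τ y (laurentLin τ i k m f) = laurentAt N p m := by
  obtain ⟨N, P, h, -⟩ := expandable τ i k f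
  refine ⟨N, _, h y, fun m => ?_⟩
  rw [h.laurentLin_eq, laurentAt_map]
  rfl

end ChiralHomology

/-! ### Translation covariance -/

namespace VertexAlgebra

variable {V : Type*} [AddCommGroup V] [Module ℂ V] [VertexAlgebra V]

theorem neg_one_pow_mul_choose_neg_two (j : ℕ) :
    (-1 : ℤ) ^ j * Ring.choose (-2 : ℤ) j = j + 1 := by
  rw [Ring.choose_neg', Ring.multichoose_two, Int.negOnePow_def, zpow_natCast, Units.smul_def,
    Units.val_pow_eq_pow_val, smul_eq_mul, ← mul_assoc, ← mul_pow]
  simp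

/-- `(T a)_(r) = -r a_(r-1)`: the Borcherds identity with the vacuum in second place. -/
theorem nprod_translation (r : ℤ) (a b : V) :
    nprod r (translation V a) b = -r • nprod (r - 1) a b := by
  have h := borcherds a vac b 0 (-2) r
  rw [finsum_eq_single _ 0 (fun j hj => by
    rw [Ring.choose_zero_pos ℤ (Nat.pos_of_ne_zero hj), zero_smul])] at h
  simp only [Ring.choose_zero_right, one_smul, Nat.cast_zero, add_zero, sub_zero, zero_add,
    neg_one_pow_mul_choose_neg_two, vac_nprod] at h
  have e : ((-2 : ℤ).negOnePow : ℤ) = 1 := by decide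
  simp only [e, one_smul] at h
  change nprod r (nprod (-2) a vac) b = _
  rw [h]
  rcases lt_trichotomy r 0 with hr | hr | hr
  · obtain ⟨s, rfl⟩ : ∃ s : ℕ, r = -(s + 1) := ⟨(-r - 1).toNat, by omega⟩
    rw [finsum_eq_single _ s (fun j hj => by
      rw [if_neg (by omega), if_neg (by omega)]; simp)]
    rw [if_pos (by ring), if_neg (by omega), sub_zero, neg_neg]
    rw [show (-2 - (s : ℤ)) = -(s + 1) - 1 by ring]
  · subst hr
    rw [finsum_eq_zero_of_forall_eq_zero fun j => by
      rw [if_neg (by omega), if_neg (by omega)]; simp]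
    simp
  · obtain ⟨s, rfl⟩ : ∃ s : ℕ, r = s + 1 := ⟨(r - 1).toNat, by omega⟩
    rw [finsum_eq_single _ s (fun j hj => by
      rw [if_neg (by omega), if_neg (by omega)]; simp)]
    rw [if_neg (by omega), if_pos (by ring), map_zero, zero_sub, smul_neg, neg_smul,
      add_sub_cancel_right]

/-- `[T, a_(r)] = -r a_(r-1)`: the Borcherds identity with the vacuum in third place. -/
theorem nprod_apply_translation (r : ℤ) (a b : V) :
    nprod r a (translation V b) = translation V (nprod r a b) + r • nprod (r - 1) a b := by
  have h := borcherds a b vac 0 r (-2)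
  rw [finsum_eq_single _ 0 (fun j hj => by
    rw [Ring.choose_zero_pos ℤ (Nat.pos_of_ne_zero hj), zero_smul])] at h
  have e : ∀ j : ℕ, nprod (j : ℤ) a vac = 0 := fun j => nprod_vac a _ (by omega)
  simp only [Ring.choose_zero_right, one_smul, Nat.cast_zero, add_zero, sub_zero, zero_add,
    e, map_zero, smul_zero] at h
  rw [finsum_eq_sum_of_support_subset (s := {0, 1})] at h
  · rw [Finset.sum_pair zero_ne_one] at h
    simp only [pow_zero, Ring.choose_zero_right, one_mul, one_smul, Nat.cast_zero, sub_zero,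
      add_zero, pow_one, Ring.choose_one_right, Nat.cast_one, neg_mul, one_mul, neg_smul] at h
    rw [show (-2 : ℤ) + 1 = -1 by norm_num, nprod_neg_one_vac] at h
    change nprod r a (nprod (-2) b vac) = nprod (-2) (nprod r a b) vac + _
    rw [h]
    abel
  · intro j hj
    by_contra hj'
    refine hj ?_
    simp only [Finset.coe_insert, Finset.coe_singleton, Set.mem_insert_iff,
      Set.mem_singleton_iff, not_or] at hj'
    simp only
    rw [nprod_vac b _ (by omega), map_zero, smul_zero]

end VertexAlgebra

namespace ChiralHomology

theorem map_update_tprod {V : Type*} [AddCommGroup V] [Module ℂ V] {n : ℕ} (k : Fin n)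
    (φ : V →ₗ[ℂ] V) (b : Fin n → V) :
    PiTensorProduct.map (Function.update (fun _ => LinearMap.id) k φ)
      (PiTensorProduct.tprod ℂ b) =
      PiTensorProduct.tprod ℂ (Function.update b k (φ (b k))) := by
  rw [PiTensorProduct.map_tprod]
  congr 1
  funext j
  by_cases hj : j = k
  · subst hj; simp
  · simp [hj]

variable (τ : ℍ) (V : Type*) [AddCommGroup V] [Module ℂ V] [VertexAlgebra V]

open VertexAlgebra

/-! ### The residue maps -/

/-- The `m`-th product with `v`, acting on the tensor factor in slot `k`. -/
def nprodAt {n : ℕ} (k : Fin n) (m : ℤ) :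
    V →ₗ[ℂ] MultilinearMap ℂ (fun _ : Fin n => V) (PiTensorProduct ℂ fun _ : Fin n => V) where
  toFun v := (PiTensorProduct.map (Function.update (fun _ => LinearMap.id) k
    (nprod m v))).compMultilinearMap (PiTensorProduct.tprod ℂ)
  map_add' v w := by
    rw [map_add, ← PiTensorProduct.mapMultilinear_apply, MultilinearMap.map_update_add]
    rfl
  map_smul' c v := by
    rw [map_smul, ← PiTensorProduct.mapMultilinear_apply, MultilinearMap.map_update_smul]
    rfl

/-- The `m`-th product of the tensor factor belonging to `x_i` with the one in slot `k` of the
remaining factors. -/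
def mergeMap {n : ℕ} (i k : Fin (n + 1)) (m : ℤ) :
    (PiTensorProduct ℂ fun _ : Fin (n + 2) => V) →ₗ[ℂ]
      (PiTensorProduct ℂ fun _ : Fin (n + 1) => V) :=
  PiTensorProduct.lift (LinearMap.uncurryMid (M := fun _ => V) i.castSucc (nprodAt V k m))

variable {V}

@[simp]
theorem mergeMap_tprod {n : ℕ} (i k : Fin (n + 1)) (m : ℤ) (a : Fin (n + 2) → V) :
    mergeMap V i k m (PiTensorProduct.tprod ℂ a) = PiTensorProduct.tprod ℂ (merge a i k m) :=
   (PiTensorProduct.lift.tprod _).trans (map_update_tprod k _ _)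

theorem merge_apply_eq_zero {n : ℕ} (i k : Fin (n + 1)) (a : Fin (n + 2) → V) :
    ∃ M : ℤ, ∀ m, M ≤ m → merge a i k m k = 0 := by
  obtain ⟨N, hN⟩ := field (a i.castSucc) (i.castSucc.removeNth a k)
  exact ⟨N, fun m hm => by simp [merge, hN m hm]⟩

theorem mergeMap_eq_zero {n : ℕ} (i k : Fin (n + 1))
    (w : PiTensorProduct ℂ fun _ : Fin (n + 2) => V) :
    ∃ M : ℤ, ∀ m, M ≤ m → mergeMap V i k m w = 0 := by
  induction w using PiTensorProduct.induction_on with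
  | smul_tprod c a =>
    obtain ⟨M, hM⟩ := merge_apply_eq_zero i k a
    refine ⟨M, fun m hm => ?_⟩
    rw [map_smul, mergeMap_tprod, MultilinearMap.map_coord_zero _ k (hM m hm), smul_zero]
  | add x y hx hy =>
    obtain ⟨M, hM⟩ := hx
    obtain ⟨M', hM'⟩ := hy
    refine ⟨max M M', fun m hm => ?_⟩
    rw [map_add, hM m (le_trans (le_max_left _ _) hm), hM' m (le_trans (le_max_right _ _) hm),
      add_zero]

theorem finite_support_of_bounds {M : Type*} [Zero M] {F : ℤ → M} {A B : ℤ}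
    (hA : ∀ m < A, F m = 0) (hB : ∀ m, B ≤ m → F m = 0) : F.HasFiniteSupport := by
  refine (Set.finite_Ico A B).subset fun m hm => ⟨?_, ?_⟩
  · by_contra h
    exact hm (hA m (not_le.mp h))
  · by_contra h
    exact hm (hB m (not_lt.mp h))

theorem residue_finite {n : ℕ} (i k : Fin (n + 1)) (f : Gam τ (n + 1))
    (w : PiTensorProduct ℂ fun _ : Fin (n + 2) => V) :
    (fun m : ℤ => laurentLin τ i k m f ⊗ₜ[ℂ] mergeMap V i k m w).HasFiniteSupport := by
  obtain ⟨N, hN⟩ := laurentLin_eq_zero τ i k f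
  obtain ⟨M, hM⟩ := mergeMap_eq_zero i k w
  exact finite_support_of_bounds (A := -N) (B := M)
    (fun m hm => by rw [hN m hm, TensorProduct.zero_tmul])
    (fun m hm => by rw [hM m hm, TensorProduct.tmul_zero])

variable (V)

/-- The residue, at the center `k`, of the product of the tensor factor belonging to `x_i` with the
one belonging to `k`. -/
def residue {n : ℕ} (i k : Fin (n + 1)) : CTilde τ V (n + 1) →ₗ[ℂ] CTilde τ V n :=
  TensorProduct.lift (LinearMap.mk₂ ℂ
    (fun f w => ∑ᶠ m : ℤ, laurentLin τ i k m f ⊗ₜ[ℂ] mergeMap V i k m w)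
    (fun f g w => by
      rw [← finsum_add_distrib (residue_finite τ i k f w) (residue_finite τ i k g w)]
      simp only [map_add, TensorProduct.add_tmul])
    (fun c f w => by
      rw [smul_finsum' c (residue_finite τ i k f w)]
      simp only [map_smul, TensorProduct.smul_tmul'])
    (fun f w w' => by
      rw [← finsum_add_distrib (residue_finite τ i k f w) (residue_finite τ i k f w')]
      simp only [map_add, TensorProduct.tmul_add])
    (fun c f w => by
      rw [smul_finsum' c (residue_finite τ i k f w)]
      simp only [map_smul, TensorProduct.tmul_smul]))

variable {V}

theorem residue_tmul {n : ℕ} (i k : Fin (n + 1)) (f : Gam τ (n + 1))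
    (w : PiTensorProduct ℂ fun _ : Fin (n + 2) => V) :
    residue τ V i k (f ⊗ₜ[ℂ] w) = ∑ᶠ m : ℤ, laurentLin τ i k m f ⊗ₜ[ℂ] mergeMap V i k m w := rfl

theorem dTerm_eq {n : ℕ} (f : Gam τ (n + 1)) (a : Fin (n + 2) → V) (i : Fin (n + 1))
    (k : Fin n) : dTerm τ f a i k =
      residue τ V i k.castSucc (f ⊗ₜ[ℂ] PiTensorProduct.tprod ℂ a) := by
  simp [residue_tmul, dTerm, laurentCoeff_castSucc]

theorem pTerm_eq {n : ℕ} (f : Gam τ (n + 1)) (a : Fin (n + 2) → V) (i : Fin (n + 1)) :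
    pTerm τ f a i = residue τ V i (Fin.last n) (f ⊗ₜ[ℂ] PiTensorProduct.tprod ℂ a) := by
  simp [residue_tmul, pTerm, laurentCoeff_last]

/-! ### Compatibility with the operators `∂_i + T_i` -/

theorem mergeMap_translationAt_self {n : ℕ} (i k : Fin (n + 1)) (m : ℤ) (a : Fin (n + 2) → V) :
    mergeMap V i k m (translationAt V (n + 1) i (PiTensorProduct.tprod ℂ a)) =
      -m • mergeMap V i k (m - 1) (PiTensorProduct.tprod ℂ a) := by
  rw [translationAt, map_update_tprod, mergeMap_tprod, mergeMap_tprod, merge, merge,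
    Fin.removeNth_update, Function.update_self, nprod_translation, ← Int.cast_smul_eq_zsmul ℂ,
    MultilinearMap.map_update_smul, Int.cast_smul_eq_zsmul]

theorem mergeMap_translationAt_succAbove {n : ℕ} (i k : Fin (n + 1)) (l : Fin n) (m : ℤ)
    (a : Fin (n + 2) → V) :
    mergeMap V i k m (translationAt V (n + 1) (i.succAbove l) (PiTensorProduct.tprod ℂ a)) =
      translationAt V n l (mergeMap V i k m (PiTensorProduct.tprod ℂ a)) +
        if k = l.castSucc then m • mergeMap V i k (m - 1) (PiTensorProduct.tprod ℂ a) else 0 := by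
  have h1 : ∀ v : V, i.castSucc.removeNth (Function.update a (i.succAbove l).castSucc v) =
      Function.update (i.castSucc.removeNth a) l.castSucc v := fun v => by
    funext j
    rw [← Fin.castSucc_succAbove_castSucc]
    by_cases hj : j = l.castSucc
    · subst hj; simp [Fin.removeNth]
    · rw [Function.update_of_ne hj, Fin.removeNth, Fin.removeNth,
        Function.update_of_ne (Fin.succAbove_right_injective.ne hj)]
  have h2 : a (i.succAbove l).castSucc = i.castSucc.removeNth a l.castSucc := by
    rw [← Fin.castSucc_succAbove_castSucc]; rfl
  have h3 : i.castSucc ≠ (i.succAbove l).castSucc := by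
    simp
  simp only [translationAt, map_update_tprod, mergeMap_tprod, merge]
  rw [h1, h2, Function.update_of_ne h3]
  set b := i.castSucc.removeNth a with hb
  split_ifs with hk
  · subst hk
    simp only [Function.update_self, Function.update_idem]
    rw [nprod_apply_translation, MultilinearMap.map_update_add, ← Int.cast_smul_eq_zsmul ℂ m,
      MultilinearMap.map_update_smul, Int.cast_smul_eq_zsmul]
  · rw [add_zero, Function.update_of_ne hk, Function.update_of_ne (Ne.symm hk),
      Function.update_comm (Ne.symm hk)]

/-- The residue of a derivative vanishes, here as summation by parts. -/
theorem finsum_laurentLin_succ {n : ℕ} (i k : Fin (n + 1)) (f : Gam τ (n + 1))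
    (w : PiTensorProduct ℂ fun _ : Fin (n + 2) => V) :
    ∑ᶠ m : ℤ, (m + 1) • (laurentLin τ i k (m + 1) f ⊗ₜ[ℂ] mergeMap V i k m w) =
      ∑ᶠ m : ℤ, m • (laurentLin τ i k m f ⊗ₜ[ℂ] mergeMap V i k (m - 1) w) := by
  rw [← finsum_comp_equiv (Equiv.addRight (1 : ℤ)) (f := fun m : ℤ =>
    m • (laurentLin τ i k m f ⊗ₜ[ℂ] mergeMap V i k (m - 1) w))]
  simp

theorem succ_finite {n : ℕ} (i k : Fin (n + 1)) (f : Gam τ (n + 1))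
    (w : PiTensorProduct ℂ fun _ : Fin (n + 2) => V) :
    (fun m : ℤ => (m + 1) • (laurentLin τ i k (m + 1) f ⊗ₜ[ℂ]
      mergeMap V i k m w)).HasFiniteSupport := by
  obtain ⟨N, hN⟩ := laurentLin_eq_zero τ i k f
  obtain ⟨M, hM⟩ := mergeMap_eq_zero i k w
  exact finite_support_of_bounds (A := -N - 1) (B := M)
    (fun m hm => by rw [hN (m + 1) (by omega), TensorProduct.zero_tmul, smul_zero])
    (fun m hm => by rw [hM m hm, TensorProduct.tmul_zero, smul_zero])

theorem pred_finite {n : ℕ} (i k : Fin (n + 1)) (f : Gam τ (n + 1))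
    (w : PiTensorProduct ℂ fun _ : Fin (n + 2) => V) :
    (fun m : ℤ => m • (laurentLin τ i k m f ⊗ₜ[ℂ]
      mergeMap V i k (m - 1) w)).HasFiniteSupport := by
  obtain ⟨N, hN⟩ := laurentLin_eq_zero τ i k f
  obtain ⟨M, hM⟩ := mergeMap_eq_zero i k w
  exact finite_support_of_bounds (A := -N) (B := M + 1)
    (fun m hm => by rw [hN m hm, TensorProduct.zero_tmul, smul_zero])
    (fun m hm => by rw [hM (m - 1) (by omega), TensorProduct.tmul_zero, smul_zero])

/-- The residue of a total derivative in the variable which is integrated vanishes. -/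
theorem residue_comp_totalDeriv_self {n : ℕ} (i k : Fin (n + 1)) :
    residue τ V i k ∘ₗ totalDeriv τ V (n + 1) i = 0 := by
  refine TensorProduct.ext' fun f w => ?_
  induction w using PiTensorProduct.induction_on with
  | add x y hx hy => rw [TensorProduct.tmul_add, map_add, hx, hy, map_add]
  | smul_tprod c a =>
    rw [TensorProduct.tmul_smul, map_smul, LinearMap.zero_apply]
    convert smul_zero c
    simp only [LinearMap.comp_apply, totalDeriv, LinearMap.add_apply, LinearMap.rTensor_tmul,
      LinearMap.lTensor_tmul, map_add, residue_tmul, laurentLin_partialGam_self,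
      mergeMap_translationAt_self]
    simp only [TensorProduct.tmul_smul, ← TensorProduct.smul_tmul', neg_smul,
      TensorProduct.tmul_neg, finsum_neg_distrib]
    rw [finsum_laurentLin_succ, add_neg_cancel]

/-- Residues commute with the total derivatives in the remaining variables. At the variable serving
as center, the two extra terms cancel by summation by parts. -/
theorem residue_comp_totalDeriv_succAbove {n : ℕ} (i k : Fin (n + 1)) (l : Fin n) :
    residue τ V i k ∘ₗ totalDeriv τ V (n + 1) (i.succAbove l) =
      totalDeriv τ V n l ∘ₗ residue τ V i k := by
  refine TensorProduct.ext' fun f w => ?_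
  induction w using PiTensorProduct.induction_on with
  | add x y hx hy => rw [TensorProduct.tmul_add, map_add, hx, hy, map_add]
  | smul_tprod c a =>
    rw [TensorProduct.tmul_smul, map_smul, map_smul]
    congr 1
    set w := PiTensorProduct.tprod ℂ a with hw
    have h1 := residue_finite τ i k f w
    simp only [LinearMap.comp_apply]
    rw [residue_tmul τ i k f w, map_finsum _ h1]
    simp only [totalDeriv, LinearMap.add_apply, LinearMap.rTensor_tmul, LinearMap.lTensor_tmul,
      map_add, residue_tmul]
    have h2 : (fun m : ℤ => partialGam τ l (laurentLin τ i k m f) ⊗ₜ[ℂ]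
        mergeMap V i k m w).HasFiniteSupport := Set.Finite.subset h1
      fun m hm h0 => hm (by simpa using congrArg ((partialGam τ l).rTensor _) h0)
    have h3 : (fun m : ℤ => laurentLin τ i k m f ⊗ₜ[ℂ]
        translationAt V n l (mergeMap V i k m w)).HasFiniteSupport := Set.Finite.subset h1
      fun m hm h0 => hm (by simpa using congrArg ((translationAt V n l).lTensor _) h0)
    rw [finsum_add_distrib h2 h3]
    simp only [laurentLin_partialGam_succAbove, hw, mergeMap_translationAt_succAbove]
    rw [← hw]
    split_ifs with hk
    · simp only [TensorProduct.tmul_add, TensorProduct.sub_tmul,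
        ← TensorProduct.smul_tmul']
      have h4 : ∀ m : ℤ, laurentLin τ i k m f ⊗ₜ[ℂ] (m • mergeMap V i k (m - 1) w) =
          m • (laurentLin τ i k m f ⊗ₜ[ℂ] mergeMap V i k (m - 1) w) := fun m =>
        map_zsmul (TensorProduct.mk ℂ _ _ (laurentLin τ i k m f)) m _
      simp only [h4]
      rw [finsum_sub_distrib h2 (succ_finite τ i k f w),
        finsum_add_distrib h3 (pred_finite τ i k f w), finsum_laurentLin_succ]
      abel
    · simp only [add_zero, sub_zero]

end ChiralHomology

/-! ### The differential and its descent -/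

namespace ChiralHomology

variable (τ : ℍ) (V : Type*) [AddCommGroup V] [Module ℂ V] [VertexAlgebra V]

/-- The sum of the residues of the variable `x_i` at all later variables and at the origin. -/
def face (n : ℕ) (i : Fin (n + 1)) : CTilde τ V (n + 1) →ₗ[ℂ] CTilde τ V n :=
  ∑ k : Fin (n + 1) with i ≤ k, residue τ V i k

/-- The alternating sum of the faces. -/
def differential (n : ℕ) : CTilde τ V (n + 1) →ₗ[ℂ] CTilde τ V n :=
  ∑ i : Fin (n + 1), (-1 : ℂ) ^ (n - (i : ℕ)) • face τ V n i

variable {V}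

theorem isChiralDifferential_differential : IsChiralDifferential τ (differential τ V) := by
  intro n f a
  rw [differential, LinearMap.sum_apply, ← Finset.sum_add_distrib]
  refine Finset.sum_congr rfl fun i _ => ?_
  rw [LinearMap.smul_apply, face, LinearMap.sum_apply, Finset.sum_filter, Fin.sum_univ_castSucc,
    if_pos (Fin.le_last i), smul_add, pTerm_eq, ← Finset.smul_sum, Finset.sum_filter]
  congr 2
  refine Finset.sum_congr rfl fun k _ => ?_
  rw [dTerm_eq]
  refine if_congr ?_ rfl rfl
  rw [Fin.lt_succAbove_iff_le_castSucc]

theorem IsChiralDifferential.unique {δ δ' : ∀ n : ℕ, CTilde τ V (n + 1) →ₗ[ℂ] CTilde τ V n}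
    (h : IsChiralDifferential τ δ) (h' : IsChiralDifferential τ δ') : δ' = δ := by
  funext n
  refine TensorProduct.ext' fun f w => ?_
  induction w using PiTensorProduct.induction_on with
  | add x y hx hy => rw [TensorProduct.tmul_add, map_add, map_add, hx, hy]
  | smul_tprod c a => rw [TensorProduct.tmul_smul, map_smul, map_smul, h, h']

theorem residue_mem_relations {n : ℕ} (i k : Fin (n + 1)) :
    relations τ V (n + 1) ≤ (relations τ V n).comap (residue τ V i k) := by
  refine iSup_le fun j => ?_
  rintro _ ⟨z, rfl⟩
  rw [Submodule.mem_comap, ← LinearMap.comp_apply]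
  induction j using Fin.succAboveCases i with
  | x => rw [residue_comp_totalDeriv_self]; exact zero_mem _
  | p l =>
    rw [residue_comp_totalDeriv_succAbove]
    exact (le_iSup (fun l => LinearMap.range (totalDeriv τ V n l)) l) ⟨_, rfl⟩

theorem differential_mem_relations (n : ℕ) :
    relations τ V (n + 1) ≤ (relations τ V n).comap (differential τ V n) := by
  intro z hz
  simp only [Submodule.mem_comap, differential, face, LinearMap.sum_apply, LinearMap.smul_apply]
  exact Submodule.sum_mem _ fun i _ => Submodule.smul_mem _ _ <|
    Submodule.sum_mem _ fun k _ => residue_mem_relations τ i k hz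

/-! ### Simplicial identities -/

/-- The indices `J > i` are the `j.succ` with `i ≤ j`, the others the `j.castSucc` with `j ≤ i`. -/
theorem sum_fin_split {M : Type*} [AddCommMonoid M] {n : ℕ} (i : Fin (n + 1))
    (G : Fin (n + 2) → M) :
    ∑ J, G J = (∑ j : Fin (n + 1) with i ≤ j, G j.succ) +
      ∑ j : Fin (n + 1) with j ≤ i, G j.castSucc := by
  have h : ∀ J, G J = (if i.castSucc < J then G J else 0) + if J ≤ i.castSucc then G J else 0 := by
    intro J
    rcases lt_or_ge i.castSucc J with hJ | hJ
    · rw [if_pos hJ, if_neg hJ.not_ge, add_zero]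
    · rw [if_neg hJ.not_gt, if_pos hJ, zero_add]
  rw [Finset.sum_congr rfl fun J _ => h J, Finset.sum_add_distrib, Finset.sum_filter,
    Finset.sum_filter, Fin.sum_univ_succ, Fin.sum_univ_castSucc (n := n + 1)]
  congr 1
  · rw [if_neg (Fin.not_lt_zero _), zero_add]
    refine Finset.sum_congr rfl fun j _ => if_congr ?_ rfl rfl
    rw [Fin.castSucc_lt_succ_iff]
  · rw [if_neg (Fin.castSucc_lt_last i).not_ge, add_zero]
    refine Finset.sum_congr rfl fun j _ => if_congr ?_ rfl rfl
    rw [Fin.castSucc_le_castSucc_iff]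

theorem comp_finset_sum {M₀ M₁ M₂ ι : Type*} [AddCommGroup M₀] [Module ℂ M₀]
    [AddCommGroup M₁] [Module ℂ M₁] [AddCommGroup M₂] [Module ℂ M₂] (s : Finset ι)
    (c : M₁ →ₗ[ℂ] M₀) (c' : ι → M₂ →ₗ[ℂ] M₁) : c ∘ₗ (∑ j ∈ s, c' j) = ∑ j ∈ s, c ∘ₗ c' j := by
  ext
  simp

theorem finset_sum_comp {M₀ M₁ M₂ ι : Type*} [AddCommGroup M₀] [Module ℂ M₀]
    [AddCommGroup M₁] [Module ℂ M₁] [AddCommGroup M₂] [Module ℂ M₂] (s : Finset ι)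
    (c : ι → M₁ →ₗ[ℂ] M₀) (c' : M₂ →ₗ[ℂ] M₁) : (∑ j ∈ s, c j) ∘ₗ c' = ∑ j ∈ s, c j ∘ₗ c' := by
  ext
  simp

/-- Alternating sums of maps satisfying the simplicial identities square to zero. -/
theorem alternating_sum_comp_eq_zero {M₀ M₁ M₂ : Type*} [AddCommGroup M₀] [Module ℂ M₀]
    [AddCommGroup M₁] [Module ℂ M₁] [AddCommGroup M₂] [Module ℂ M₂] {n : ℕ}
    (c : Fin (n + 1) → M₁ →ₗ[ℂ] M₀) (c' : Fin (n + 2) → M₂ →ₗ[ℂ] M₁)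
    (h : ∀ i j, i ≤ j → c i ∘ₗ c' j.succ = c j ∘ₗ c' i.castSucc) :
    (∑ i : Fin (n + 1), (-1 : ℂ) ^ (n - (i : ℕ)) • c i) ∘ₗ
      (∑ j : Fin (n + 2), (-1 : ℂ) ^ (n + 1 - (j : ℕ)) • c' j) = 0 := by
  have e : ∀ i : Fin (n + 1), ((-1 : ℂ) ^ (n - (i : ℕ)) • c i) ∘ₗ
      (∑ j : Fin (n + 2), (-1 : ℂ) ^ (n + 1 - (j : ℕ)) • c' j) =
      (∑ j : Fin (n + 1) with i ≤ j, ((-1 : ℂ) ^ (n - (i : ℕ)) * (-1) ^ (n - (j : ℕ))) •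
        c i ∘ₗ c' j.succ) - ∑ j : Fin (n + 1) with j ≤ i,
          ((-1 : ℂ) ^ (n - (i : ℕ)) * (-1) ^ (n - (j : ℕ))) • c i ∘ₗ c' j.castSucc := by
    intro i
    rw [comp_finset_sum, sum_fin_split i, sub_eq_add_neg, ← Finset.sum_neg_distrib]
    congr 1
    · refine Finset.sum_congr rfl fun j _ => ?_
      rw [LinearMap.smul_comp, LinearMap.comp_smul, smul_smul, Fin.val_succ,
        Nat.add_sub_add_right]
    · refine Finset.sum_congr rfl fun j _ => ?_
      rw [LinearMap.smul_comp, LinearMap.comp_smul, smul_smul, Fin.val_castSucc,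
        Nat.sub_add_comm (Nat.lt_succ_iff.mp j.2), pow_succ, mul_neg_one, mul_neg, neg_smul]
  rw [finset_sum_comp, Finset.sum_congr rfl fun i _ => e i, Finset.sum_sub_distrib,
    sub_eq_zero]
  simp only [Finset.sum_filter]
  rw [Finset.sum_comm]
  refine Finset.sum_congr rfl fun j _ => Finset.sum_congr rfl fun i _ => ?_
  split_ifs with hij
  · rw [h i j hij, mul_comm]
  · rfl

/-- The commutator form of the Borcherds identity for residues gives the simplicial identities
of the faces. -/
theorem face_comp_face {n : ℕ} {i j : Fin (n + 1)} (hij : i ≤ j)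
    (h : ∀ k l : Fin (n + 1),
      residue τ V i k ∘ₗ residue τ V j.succ (i.castSucc.succAbove l) =
        residue τ V j l ∘ₗ residue τ V i.castSucc (j.castSucc.succAbove k) +
          if k = l then residue τ V j l ∘ₗ residue τ V i.castSucc j.castSucc else 0) :
    face τ V n i ∘ₗ face τ V (n + 1) j.succ =
      face τ V n j ∘ₗ face τ V (n + 1) i.castSucc := by
  have e1 : face τ V (n + 1) j.succ = ∑ l : Fin (n + 1) with j ≤ l,
      residue τ V j.succ (i.castSucc.succAbove l) := by
    rw [face, Finset.sum_filter, Fin.sum_univ_succ, if_neg (by simp), zero_add,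
      Finset.sum_filter]
    refine Finset.sum_congr rfl fun l _ => ?_
    by_cases hl : j ≤ l
    · rw [if_pos hl, if_pos (Fin.succ_le_succ_iff.mpr hl),
        Fin.succAbove_of_le_castSucc _ _ (by simpa using hij.trans hl)]
    · rw [if_neg hl, if_neg (mt Fin.succ_le_succ_iff.mp hl)]
  have e2 : face τ V (n + 1) i.castSucc = residue τ V i.castSucc j.castSucc +
      ∑ k : Fin (n + 1) with i ≤ k, residue τ V i.castSucc (j.castSucc.succAbove k) := by
    rw [face, Finset.sum_filter, Fin.sum_univ_succAbove _ j.castSucc,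
      if_pos (by simpa using hij), Finset.sum_filter]
    congr 1
    refine Finset.sum_congr rfl fun k _ => if_congr ?_ rfl rfl
    rcases lt_or_ge k j with hk | hk
    · rw [Fin.succAbove_of_castSucc_lt _ _ (by simpa using hk)]
      simp
    · rw [Fin.succAbove_of_le_castSucc _ _ (by simpa using hk)]
      simp only [Fin.le_def, Fin.val_castSucc, Fin.val_succ] at hk hij ⊢
      omega
  rw [e1, e2, face, face]
  simp only [LinearMap.comp_add, finset_sum_comp, comp_finset_sum, h,
    Finset.sum_add_distrib]
  rw [Finset.sum_comm]
  refine (add_comm _ _).trans (congrArg₂ (· + ·) ?_ rfl)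
  refine Finset.sum_congr rfl fun l hl => ?_
  rw [Finset.sum_ite_eq', if_pos]
  rw [Finset.mem_filter] at hl ⊢
  exact ⟨Finset.mem_univ _, hij.trans hl.2⟩

end ChiralHomology

/-! ### Iterated Laurent expansions -/

namespace ChiralHomology

/-- `φ` has the Laurent coefficients `c m` at the origin, with a pole of finite order. -/
def HasCoeffs (φ : ℂ → ℂ) (c : ℤ → ℂ) : Prop :=
  ∃ (N : ℕ) (p : PowerSeries ℂ), HasLaurent φ N p ∧ ∀ m, c m = laurentAt N p m

namespace HasCoeffs

variable {φ ψ : ℂ → ℂ} {c c' : ℤ → ℂ}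

theorem exists_bound (h : HasCoeffs φ c) : ∃ N : ℕ, ∀ m < -(N : ℤ), c m = 0 := by
  obtain ⟨N, p, -, hc⟩ := h
  exact ⟨N, fun m hm => by rw [hc, laurentAt_of_lt p hm]⟩

theorem unique (h : HasCoeffs φ c) (h' : HasCoeffs φ c') : c = c' := by
  obtain ⟨N, p, hp, hc⟩ := h
  obtain ⟨M, q, hq, hc'⟩ := h'
  funext m
  rw [hc, hc', hp.laurentAt_unique hq]

theorem congr (h : HasCoeffs φ c) (e : ∀ᶠ t in 𝓝[≠] (0 : ℂ), ψ t = φ t) : HasCoeffs ψ c := by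
  obtain ⟨N, p, hp, hc⟩ := h
  exact ⟨N, p, hp.congr e, hc⟩

theorem const (a : ℂ) : HasCoeffs (fun _ => a) (fun m => if m = 0 then a else 0) := by
  refine ⟨0, _, HasLaurent.const a, fun m => ?_⟩
  simp only [laurentAt, PowerSeries.coeff_C]
  split_ifs <;> first | rfl | omega

theorem add (h : HasCoeffs φ c) (h' : HasCoeffs ψ c') :
    HasCoeffs (fun t => φ t + ψ t) (fun m => c m + c' m) := by
  obtain ⟨N, p, hp, hc⟩ := h
  obtain ⟨M, q, hq, hc'⟩ := h'
  have h2 := hq.raise N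
  rw [add_comm] at h2
  refine ⟨_, _, (hp.raise M).add h2, fun m => ?_⟩
  dsimp only
  rw [laurentAt_add, laurentAt_X_pow_mul, add_comm N M, laurentAt_X_pow_mul, hc, hc']

theorem sum {ι : Type*} {s : Finset ι} {φ : ι → ℂ → ℂ} {c : ι → ℤ → ℂ}
    (h : ∀ i ∈ s, HasCoeffs (φ i) (c i)) :
    HasCoeffs (fun t => ∑ i ∈ s, φ i t) (fun m => ∑ i ∈ s, c i m) := by
  classical
  induction s using Finset.induction_on with
  | empty => simpa using const 0
  | insert i s hi ih =>
    simp only [Finset.sum_insert hi]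
    exact (h i (Finset.mem_insert_self i s)).add
      (ih fun j hj => h j (Finset.mem_insert_of_mem hj))

theorem mul (h : HasCoeffs φ c) (h' : HasCoeffs ψ c') :
    HasCoeffs (fun t => φ t * ψ t) (fun r => ∑ᶠ m, c m * c' (r - m)) := by
  obtain ⟨N, p, hp, hc⟩ := h
  obtain ⟨M, q, hq, hc'⟩ := h'
  refine ⟨_, _, hp.mul hq, fun r => ?_⟩
  dsimp only
  rw [laurentAt_mul N M p q r le_rfl le_rfl,
    finsum_eq_sum_of_support_subset (s := Finset.Icc (-(N : ℤ)) (r + M))]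
  · simp only [hc, hc']
  · intro m hm
    simp only [Function.mem_support, hc, hc'] at hm
    simp only [Finset.coe_Icc, Set.mem_Icc]
    refine ⟨?_, ?_⟩
    · by_contra hlt
      exact hm (by rw [laurentAt_of_lt p (not_le.mp hlt), zero_mul])
    · by_contra hlt
      exact hm (by rw [laurentAt_of_lt q (by omega), mul_zero])

theorem const_mul (h : HasCoeffs φ c) (a : ℂ) :
    HasCoeffs (fun t => a * φ t) (fun m => a * c m) := by
  obtain ⟨N, p, hp, hc⟩ := h
  refine ⟨N, _, hp.const_mul a, fun m => ?_⟩
  dsimp only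
  rw [hc]
  simp only [laurentAt]
  split_ifs <;> simp

theorem deriv (h : HasCoeffs φ c) :
    HasCoeffs (deriv φ) (fun m => ((m + 1 : ℤ) : ℂ) * c (m + 1)) := by
  obtain ⟨N, p, hp, hc⟩ := h
  exact ⟨_, _, hp.deriv, fun m => by dsimp only; rw [laurentAt_deriv, hc]⟩

theorem succ_mul_choose (m : ℤ) (b : ℕ) :
    (m + 1) * (b.factorial * Ring.choose (m + 1 + b) b) =
      ((b + 1).factorial * Ring.choose (m + (b + 1 : ℕ)) (b + 1) : ℤ) := by
  have h1 := Ring.descPochhammer_eq_factorial_smul_choose (m + 1 + b) b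
  have h2 := Ring.descPochhammer_eq_factorial_smul_choose (m + (b + 1 : ℕ)) (b + 1)
  rw [nsmul_eq_mul, ← Polynomial.eval_eq_smeval] at h1 h2
  rw [← h1, ← h2, descPochhammer_succ_right, Polynomial.eval_mul]
  push_cast
  rw [show m + (b + 1 : ℤ) = m + 1 + b by ring]
  simp [mul_comm]

/-- The coefficients of the divided derivatives. -/
theorem iteratedDeriv (h : HasCoeffs φ c) (b : ℕ) :
    HasCoeffs (fun t => iteratedDeriv b φ t / b.factorial)
      (fun m => (Ring.choose (m + b) b : ℤ) * c (m + b)) := by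
  have key : HasCoeffs (_root_.iteratedDeriv b φ)
      (fun m => ((b.factorial * Ring.choose (m + b) b : ℤ) : ℂ) * c (m + b)) := by
    induction b with
    | zero => simpa using h
    | succ b ih =>
      rw [iteratedDeriv_succ]
      convert ih.deriv using 2 with m
      rw [← succ_mul_choose, Int.cast_mul, mul_assoc, show m + ((b + 1 : ℕ) : ℤ) = m + 1 + b by
        push_cast; ring]
  have hb : (b.factorial : ℂ) ≠ 0 := by exact_mod_cast b.factorial_ne_zero
  convert key.const_mul (b.factorial : ℂ)⁻¹ using 2 with t m
  · rw [div_eq_inv_mul]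
  · push_cast
    field_simp

theorem comp_mul_left (h : HasCoeffs φ c) {α : ℂ} (hα : α ≠ 0) :
    HasCoeffs (fun t => φ (α * t)) (fun m => α ^ m * c m) := by
  obtain ⟨N, p, hp, hc⟩ := h
  refine ⟨N, PowerSeries.C (α ^ N)⁻¹ * PowerSeries.rescale α p, ?_, fun m => ?_⟩
  · filter_upwards [(tendsto_mul_nhdsNE_zero hα).eventually hp] with t h1
    refine hasSum_of_eq (h1.mul_left (α ^ N)⁻¹) (fun k => ?_) ?_
    · rw [PowerSeries.coeff_C_mul, PowerSeries.coeff_rescale, mul_pow]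
      ring
    · rw [mul_pow]
      field_simp
  · dsimp only
    rw [hc]
    simp only [laurentAt]
    split_ifs with h0
    · rw [PowerSeries.coeff_C_mul, PowerSeries.coeff_rescale, ← zpow_natCast α (m + N).toNat,
        Int.toNat_of_nonneg h0, zpow_add₀ hα, zpow_natCast, ← mul_assoc]
      congr 1
      field_simp
    · rw [mul_zero]

/-- Multiplication by a function analytic at the origin. -/
theorem analytic_mul {g : ℂ → ℂ} (hg : AnalyticAt ℂ g 0) (h : HasCoeffs φ c) {N : ℕ}
    (hN : ∀ m < -(N : ℤ), c m = 0) :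
    HasCoeffs (fun t => g t * φ t) (fun q => ∑ b ∈ Finset.range (q + N + 1).toNat,
      _root_.iteratedDeriv b g 0 / b.factorial * c (q - b)) := by
  convert mul ⟨0, _, HasLaurent.of_analyticAt hg, fun m => rfl⟩ h using 2 with q
  symm
  have hinj : Function.Injective (fun b : ℕ => (b : ℤ)) := Nat.cast_injective
  rw [finsum_eq_sum_of_support_subset (s := (Finset.range (q + N + 1).toNat).map ⟨_, hinj⟩),
    Finset.sum_map]
  · refine Finset.sum_congr rfl fun b _ => ?_
    have := laurentAt_sub 0
      (PowerSeries.mk fun k => _root_.iteratedDeriv k g 0 / (k.factorial : ℂ)) b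
    simp only [Nat.cast_zero, sub_zero] at this
    simp [this]
  · intro m hm
    simp only [Function.mem_support] at hm
    have h1 : 0 ≤ m := by
      by_contra hlt
      exact hm (by rw [laurentAt_of_lt _ (by simpa using hlt), zero_mul])
    have h2 : -(N : ℤ) ≤ q - m := by
      by_contra hlt
      exact hm (by rw [hN _ (not_le.mp hlt), mul_zero])
    simp only [Finset.coe_map, Finset.coe_range, Function.Embedding.coeFn_mk, Set.mem_image,
      Set.mem_Iio]
    exact ⟨m.toNat, by omega, by omega⟩

theorem analyticAt_eventually (h : HasCoeffs φ c) : ∀ᶠ t in 𝓝[≠] (0 : ℂ), AnalyticAt ℂ φ t := by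
  obtain ⟨N, p, hp, -⟩ := h
  exact hp.analyticAt_eventually

end HasCoeffs

theorem iteratedDeriv_comp_mul_left {g : ℂ → ℂ} (hg : AnalyticAt ℂ g 0) {β : ℂ} (hβ : β ≠ 0)
    (b : ℕ) : iteratedDeriv b (fun t => g (β * t)) 0 = β ^ b * iteratedDeriv b g 0 := by
  have hg' : AnalyticAt ℂ (fun t => g (β * t)) 0 :=
    AnalyticAt.fun_comp_of_eq hg (by fun_prop) (by simp)
  have h1 : HasCoeffs g _ := ⟨0, _, HasLaurent.of_analyticAt hg, fun m => rfl⟩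
  have h2 : HasCoeffs _ _ := ⟨0, _, HasLaurent.of_analyticAt hg', fun m => rfl⟩
  have h3 := congrFun (h2.unique (h1.comp_mul_left hβ)) b
  have hb : (b.factorial : ℂ) ≠ 0 := by exact_mod_cast b.factorial_ne_zero
  simp only [laurentAt, Nat.cast_zero, add_zero, Int.natCast_nonneg, if_true, Int.toNat_natCast,
    PowerSeries.coeff_mk, zpow_natCast] at h3
  field_simp at h3
  exact h3

theorem exists_ne_zero_of_finsum {ι M : Type*} [AddCommMonoid M] {f : ι → M}
    (h : ∑ᶠ i, f i ≠ 0) : ∃ i, f i ≠ 0 := by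
  by_contra! h'
  exact h (finsum_eq_zero_of_forall_eq_zero h')

/-- The contribution of `σ ^ m`, `φ ^ k` and the `b`-th term of the binomial expansion of
`(α σ + β φ) ^ n` in the domain `|φ| < |σ|`. -/
def kernel (α β : ℂ) (n : ℤ) (b : ℕ) : ℂ := (Ring.choose n b : ℤ) * α ^ (n - b) * β ^ b

/-- The coefficients of the iterated expansion of a sum of products
`h_s(σ) h_f(φ) h_m(α σ + β φ)`, in the domain `|φ| < |σ|`: first in `φ`, then in `σ`. -/
theorem iterated_coeffs {ι : Type*} [Fintype ι] {α β : ℂ} (hα : α ≠ 0) (hβ : β ≠ 0)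
    {hs hf hm : ι → ℂ → ℂ} {cs cf cm : ι → ℤ → ℂ} (Hs : ∀ r, HasCoeffs (hs r) (cs r))
    (Hf : ∀ r, HasCoeffs (hf r) (cf r)) (Hm : ∀ r, HasCoeffs (hm r) (cm r))
    {N : ι → ℕ} (hN : ∀ r, ∀ m < -(N r : ℤ), cf r m = 0)
    {G : ℂ → ℂ → ℂ} (hG : ∀ᶠ σ in 𝓝[≠] (0 : ℂ), ∀ᶠ φ in 𝓝[≠] (0 : ℂ),
      G σ φ = ∑ r, hs r σ * hf r φ * hm r (α * σ + β * φ))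
    {C : ℤ → ℂ → ℂ} (hC : ∀ᶠ σ in 𝓝[≠] (0 : ℂ), HasCoeffs (G σ) (fun q => C q σ))
    {A : ℤ → ℤ → ℂ} (hA : ∀ q, HasCoeffs (C q) (fun p => A p q)) (p q : ℤ) :
    A p q = ∑ r, ∑ b ∈ Finset.range (q + N r + 1).toNat, ∑ᶠ m : ℤ,
      cs r m * cf r (q - b) * cm r (p - m + b) * kernel α β (p - m + b) b := by
  have h1 : ∀ᶠ σ in 𝓝[≠] (0 : ℂ), C q σ = ∑ r, ∑ b ∈ Finset.range (q + N r + 1).toNat,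
      (β ^ b * cf r (q - b)) * (hs r σ * (iteratedDeriv b (hm r) (α * σ) / b.factorial)) := by
    have han : ∀ᶠ σ in 𝓝[≠] (0 : ℂ), ∀ r, AnalyticAt ℂ (hm r) (α * σ) := by
      rw [eventually_all]
      exact fun r => (tendsto_mul_nhdsNE_zero hα).eventually (Hm r).analyticAt_eventually
    filter_upwards [hG, hC, han] with σ hG hC han
    have key : HasCoeffs (G σ) (fun q => ∑ r, hs r σ * ∑ b ∈ Finset.range (q + N r + 1).toNat,
        iteratedDeriv b (fun φ => hm r (α * σ + β * φ)) 0 / b.factorial * cf r (q - b)) := by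
      have han' : ∀ r, AnalyticAt ℂ (fun φ => hm r (α * σ + β * φ)) 0 := fun r =>
        AnalyticAt.fun_comp_of_eq (han r) (by fun_prop) (by simp)
      refine (HasCoeffs.sum (s := Finset.univ) fun r _ => (HasCoeffs.analytic_mul (han' r) (Hf r)
        (hN r)).const_mul (hs r σ)).congr ?_
      filter_upwards [hG] with φ hφ
      rw [hφ]
      exact Finset.sum_congr rfl fun r _ => by ring
    rw [congrFun (hC.unique key) q]
    refine Finset.sum_congr rfl fun r _ => ?_
    rw [Finset.mul_sum]
    refine Finset.sum_congr rfl fun b _ => ?_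
    have e : iteratedDeriv b (fun φ => hm r (α * σ + β * φ)) 0 =
        β ^ b * iteratedDeriv b (hm r) (α * σ) := by
      have han0 : AnalyticAt ℂ (fun φ => hm r (α * σ + φ)) 0 :=
        AnalyticAt.fun_comp_of_eq (han r) (by fun_prop) (by simp)
      rw [iteratedDeriv_comp_mul_left han0 hβ, iteratedDeriv_comp_const_add]
      simp only [add_zero]
    rw [e]
    ring
  have h2 : HasCoeffs (C q) (fun p => ∑ r, ∑ b ∈ Finset.range (q + N r + 1).toNat,
      (β ^ b * cf r (q - b)) * ∑ᶠ m : ℤ, cs r m * (α ^ (p - m) *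
        ((Ring.choose (p - m + b) b : ℤ) * cm r (p - m + b)))) := by
    refine HasCoeffs.congr ?_ h1
    exact HasCoeffs.sum fun r _ => HasCoeffs.sum fun b _ =>
      ((Hs r).mul (((Hm r).iteratedDeriv b).comp_mul_left hα)).const_mul _
  rw [congrFun ((hA q).unique h2) p]
  refine Finset.sum_congr rfl fun r _ => Finset.sum_congr rfl fun b _ => ?_
  rw [← smul_eq_mul, smul_finsum]
  refine finsum_congr fun m => ?_
  rw [kernel, show p - m + b - (b : ℤ) = p - m by ring, smul_eq_mul]
  ring

/-! ### Pairing iterated coefficients with vectors -/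

/-- A family of vectors, indexed by pairs of mode numbers, which vanishes for large `q`, and for
large `p` for each `q`. -/
def Admissible {M : Type*} [Zero M] (X : ℤ → ℤ → M) : Prop :=
  (∃ Q, ∀ q, Q ≤ q → ∀ p, X p q = 0) ∧ ∀ q, ∃ P, ∀ p, P ≤ p → X p q = 0

section Summation

variable {M : Type*} [AddCommGroup M] [Module ℂ M] {α β : ℂ} {cs cf cm : ℤ → ℂ} {X : ℤ → ℤ → M}

/-- The summand of the iterated residue. -/
def summand (α β : ℂ) (cs cf cm : ℤ → ℂ) (X : ℤ → ℤ → M) (x : (ℤ × ℤ × ℤ) × ℕ) : M :=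
  (cs x.1.1 * cf x.1.2.1 * cm x.1.2.2 * kernel α β x.1.2.2 x.2) •
    X (x.1.1 + x.1.2.2 - x.2) (x.1.2.1 + x.2)

/-- The pole orders bound the exponents from below; admissibility then bounds the second mode
number, by `Q`, and after it the first one, by `R`. -/
theorem summand_finite (hs : ∃ N : ℕ, ∀ m < -(N : ℤ), cs m = 0)
    (hf : ∃ N : ℕ, ∀ m < -(N : ℤ), cf m = 0) (hm : ∃ N : ℕ, ∀ m < -(N : ℤ), cm m = 0)
    (hX : Admissible X) : (summand α β cs cf cm X).HasFiniteSupport := by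
  obtain ⟨Ns, hs⟩ := hs
  obtain ⟨Nf, hf⟩ := hf
  obtain ⟨Nm, hm⟩ := hm
  obtain ⟨⟨Q, hQ⟩, hX⟩ := hX
  choose P hP using hX
  obtain ⟨R, hR⟩ := ((Finset.Icc (-Nf : ℤ) Q).image P).exists_le
  have hfin : (((Set.Icc (-Ns : ℤ) (R + Q + Nf + Nm)) ×ˢ (Set.Icc (-Nf : ℤ) Q) ×ˢ
      (Set.Icc (-Nm : ℤ) (R + Q + Nf + Ns))) ×ˢ (Set.Iic (Q + Nf).toNat)).Finite :=
    ((Set.finite_Icc _ _).prod ((Set.finite_Icc _ _).prod (Set.finite_Icc _ _))).prod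
      (Set.finite_Iic _)
  refine hfin.subset ?_
  rintro ⟨⟨m, k, n⟩, b⟩ hx
  simp only [Function.mem_support, summand] at hx
  have h1 : -(Ns : ℤ) ≤ m := by
    by_contra h
    exact hx (by rw [hs m (not_le.mp h)]; simp)
  have h2 : -(Nf : ℤ) ≤ k := by
    by_contra h
    exact hx (by rw [hf k (not_le.mp h)]; simp)
  have h3 : -(Nm : ℤ) ≤ n := by
    by_contra h
    exact hx (by rw [hm n (not_le.mp h)]; simp)
  have h4 : k + b < Q := by
    by_contra h
    exact hx (by rw [hQ _ (not_lt.mp h), smul_zero])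
  have h5 : m + n - b < P (k + b) := by
    by_contra h
    exact hx (by rw [hP _ _ (not_lt.mp h), smul_zero])
  have h6 : P (k + b) ≤ R := hR _ (Finset.mem_image_of_mem _ (by
    rw [Finset.mem_Icc]; omega))
  simp only [Set.mem_prod, Set.mem_Icc, Set.mem_Iic]
  omega

/-- Reindexing by the pair of mode numbers. -/
def modeEquiv : (ℤ × ℤ) × (ℕ × ℤ) ≃ (ℤ × ℤ × ℤ) × ℕ where
  toFun x := ((x.2.2, x.1.1 - x.2.1, x.1.2 - x.2.2 + x.2.1), x.2.1)
  invFun x := ((x.1.2.1 + x.2, x.1.1 + x.1.2.2 - x.2), (x.2, x.1.1))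
  left_inv x := by ext <;> simp; ring
  right_inv x := by ext <;> simp; ring

/-- Passage from coefficients indexed by the pair of mode numbers to the exponents of the three
series and the binomial index. -/
theorem finsum_modes_eq (hs : ∃ N : ℕ, ∀ m < -(N : ℤ), cs m = 0) {N : ℕ}
    (hf : ∀ m < -(N : ℤ), cf m = 0) (hm : ∃ N : ℕ, ∀ m < -(N : ℤ), cm m = 0)
    (hX : Admissible X) :
    (fun x : ℤ × ℤ => (∑ b ∈ Finset.range (x.1 + N + 1).toNat, ∑ᶠ m : ℤ,
      cs m * cf (x.1 - b) * cm (x.2 - m + b) * kernel α β (x.2 - m + b) b) •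
        X x.2 x.1).HasFiniteSupport ∧
    ∑ᶠ x : ℤ × ℤ, (∑ b ∈ Finset.range (x.1 + N + 1).toNat, ∑ᶠ m : ℤ,
      cs m * cf (x.1 - b) * cm (x.2 - m + b) * kernel α β (x.2 - m + b) b) • X x.2 x.1 =
      ∑ᶠ x : (ℤ × ℤ × ℤ) × ℕ, summand α β cs cf cm X x := by
  have hfin := summand_finite (α := α) (β := β) hs ⟨N, hf⟩ hm hX
  have hfin' : (fun x => summand α β cs cf cm X (modeEquiv x)).HasFiniteSupport :=
    Set.Finite.preimage modeEquiv.injective.injOn hfin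
  have e : ∀ x : ℤ × ℤ, (∑ b ∈ Finset.range (x.1 + N + 1).toNat, ∑ᶠ m : ℤ,
      cs m * cf (x.1 - b) * cm (x.2 - m + b) * kernel α β (x.2 - m + b) b) • X x.2 x.1 =
      ∑ᶠ y : ℕ × ℤ, summand α β cs cf cm X (modeEquiv (x, y)) := by
    intro x
    have hfx : (fun y : ℕ × ℤ => summand α β cs cf cm X (modeEquiv (x, y))).HasFiniteSupport :=
      Set.Finite.preimage (f := fun y => (x, y)) (fun a _ b _ h => by simpa using h) hfin'
    rw [finsum_curry _ hfx, ← finsum_eq_sum_of_support_subset, finsum_smul]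
    · refine finsum_congr fun b => ?_
      rw [finsum_smul]
      refine finsum_congr fun m => ?_
      simp only [summand, modeEquiv, Equiv.coe_fn_mk]
      congr 2 <;> ring
    · intro b hb
      rw [Finset.coe_range, Set.mem_Iio]
      by_contra hlt
      refine hb (finsum_eq_zero_of_forall_eq_zero fun m => ?_)
      rw [hf _ (by omega)]
      simp
  refine ⟨?_, ?_⟩
  · refine (hfin'.image Prod.fst).subset fun x hx => ?_
    rw [Function.mem_support, e] at hx
    obtain ⟨y, hy⟩ := exists_ne_zero_of_finsum hx
    exact ⟨(x, y), hy, rfl⟩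
  · rw [← finsum_comp_equiv modeEquiv, finsum_curry _ hfin']
    exact finsum_congr e

/-- The sum over the binomial index may be taken first, for fixed exponents of the three series. -/
theorem summand_finite_outer (hs : ∃ N : ℕ, ∀ m < -(N : ℤ), cs m = 0)
    (hf : ∃ N : ℕ, ∀ m < -(N : ℤ), cf m = 0) (hm : ∃ N : ℕ, ∀ m < -(N : ℤ), cm m = 0)
    (hX : Admissible X) :
    (fun x : ℤ × ℤ × ℤ => (cs x.1 * cf x.2.1 * cm x.2.2) • ∑ᶠ b : ℕ,
      kernel α β x.2.2 b • X (x.1 + x.2.2 - b) (x.2.1 + b)).HasFiniteSupport ∧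
    ∑ᶠ x : (ℤ × ℤ × ℤ) × ℕ, summand α β cs cf cm X x =
      ∑ᶠ x : ℤ × ℤ × ℤ, (cs x.1 * cf x.2.1 * cm x.2.2) • ∑ᶠ b : ℕ,
        kernel α β x.2.2 b • X (x.1 + x.2.2 - b) (x.2.1 + b) := by
  have hfin := summand_finite (α := α) (β := β) hs hf hm hX
  have e : ∀ x : ℤ × ℤ × ℤ, (cs x.1 * cf x.2.1 * cm x.2.2) • ∑ᶠ b : ℕ,
      kernel α β x.2.2 b • X (x.1 + x.2.2 - b) (x.2.1 + b) =
      ∑ᶠ b : ℕ, summand α β cs cf cm X (x, b) := fun x => by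
    rw [smul_finsum]
    exact finsum_congr fun b => by rw [smul_smul, summand]
  refine ⟨?_, ?_⟩
  · refine (hfin.image Prod.fst).subset fun x hx => ?_
    rw [Function.mem_support, e] at hx
    obtain ⟨y, hy⟩ := exists_ne_zero_of_finsum hx
    exact ⟨(x, y), hy, rfl⟩
  · rw [finsum_curry _ hfin]
    exact finsum_congr fun x => (e x).symm

end Summation

/-- Pairing the iterated Laurent coefficients with an admissible family. -/
theorem iterated_residue {ι : Type*} [Fintype ι] {α β : ℂ} (hα : α ≠ 0) (hβ : β ≠ 0)
    {hs hf hm : ι → ℂ → ℂ} {cs cf cm : ι → ℤ → ℂ} (Hs : ∀ r, HasCoeffs (hs r) (cs r))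
    (Hf : ∀ r, HasCoeffs (hf r) (cf r)) (Hm : ∀ r, HasCoeffs (hm r) (cm r))
    {G : ℂ → ℂ → ℂ} (hG : ∀ᶠ σ in 𝓝[≠] (0 : ℂ), ∀ᶠ φ in 𝓝[≠] (0 : ℂ),
      G σ φ = ∑ r, hs r σ * hf r φ * hm r (α * σ + β * φ))
    {C : ℤ → ℂ → ℂ} (hC : ∀ᶠ σ in 𝓝[≠] (0 : ℂ), HasCoeffs (G σ) (fun q => C q σ))
    {A : ℤ → ℤ → ℂ} (hA : ∀ q, HasCoeffs (C q) (fun p => A p q))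
    {M : Type*} [AddCommGroup M] [Module ℂ M] {X : ℤ → ℤ → M} (hX : Admissible X) :
    ∑ᶠ (q : ℤ) (p : ℤ), A p q • X p q =
      ∑ r, ∑ᶠ x : ℤ × ℤ × ℤ, (cs r x.1 * cf r x.2.1 * cm r x.2.2) • ∑ᶠ b : ℕ,
        kernel α β x.2.2 b • X (x.1 + x.2.2 - b) (x.2.1 + b) := by
  choose N hN using fun r => (Hf r).exists_bound
  have key := fun r => finsum_modes_eq (α := α) (β := β) (Hs r).exists_bound (hN r)
    (Hm r).exists_bound hX
  have e : ∀ x : ℤ × ℤ, A x.2 x.1 • X x.2 x.1 = ∑ r, (∑ b ∈ Finset.range (x.1 + N r + 1).toNat,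
      ∑ᶠ m : ℤ, cs r m * cf r (x.1 - b) * cm r (x.2 - m + b) * kernel α β (x.2 - m + b) b) •
        X x.2 x.1 := fun x => by
    rw [iterated_coeffs hα hβ Hs Hf Hm hN hG hC hA, Finset.sum_smul]
  have hfin : (fun x : ℤ × ℤ => A x.2 x.1 • X x.2 x.1).HasFiniteSupport := by
    refine (Set.finite_iUnion fun r => (key r).1).subset fun x hx => ?_
    rw [Function.mem_support, e] at hx
    obtain ⟨r, -, hr⟩ := Finset.exists_ne_zero_of_sum_ne_zero hx
    exact Set.mem_iUnion.mpr ⟨r, hr⟩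
  rw [← finsum_curry (fun x : ℤ × ℤ => A x.2 x.1 • X x.2 x.1) hfin, finsum_congr e,
    finsum_sum_comm _ _ fun r _ => (key r).1]
  refine Finset.sum_congr rfl fun r _ => ?_
  rw [(key r).2, (summand_finite_outer (Hs r).exists_bound (Hf r).exists_bound
    (Hm r).exists_bound hX).2]

end ChiralHomology

/-! ### Regular functions near a codimension two stratum -/

namespace ChiralHomology

/-- Near the origin and away from `s = 0`, `t = 0`, `s = t`, the function `F s t` is a finite sum
of products of Laurent series in `s`, in `t`, and in `s - t`; the latter are power series if `an`
holds. -/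
def Separable (an : Prop) (F : ℂ → ℂ → ℂ) : Prop :=
  ∃ (ι : Type) (_ : Fintype ι) (h₁ h₂ h₃ : ι → ℂ → ℂ) (c₁ c₂ c₃ : ι → ℤ → ℂ),
    (∀ r, HasCoeffs (h₁ r) (c₁ r)) ∧ (∀ r, HasCoeffs (h₂ r) (c₂ r)) ∧
    (∀ r, HasCoeffs (h₃ r) (c₃ r)) ∧ (an → ∀ r, ∀ m < 0, c₃ r m = 0) ∧
    ∀ᶠ z : ℂ × ℂ in 𝓝 0, z.1 ≠ 0 → z.2 ≠ 0 → z.1 ≠ z.2 →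
      F z.1 z.2 = ∑ r, h₁ r z.1 * h₂ r z.2 * h₃ r (z.1 - z.2)

theorem HasCoeffs.exists_of_meromorphicAt {φ : ℂ → ℂ} (h : MeromorphicAt φ 0) :
    ∃ c, HasCoeffs φ c := by
  obtain ⟨N, p, hp⟩ := HasLaurent.of_meromorphicAt h
  exact ⟨_, N, p, hp, fun _ => rfl⟩

theorem HasCoeffs.exists_of_analyticAt {φ : ℂ → ℂ} (h : AnalyticAt ℂ φ 0) :
    ∃ c, HasCoeffs φ c ∧ ∀ m < 0, c m = 0 :=
  ⟨_, ⟨0, _, HasLaurent.of_analyticAt h, fun _ => rfl⟩,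
    fun m hm => laurentAt_of_lt _ (by simpa using hm)⟩

namespace Separable

variable {an : Prop} {F F' : ℂ → ℂ → ℂ}

theorem congr (h : Separable an F) (e : ∀ᶠ z : ℂ × ℂ in 𝓝 0, z.1 ≠ 0 → z.2 ≠ 0 → z.1 ≠ z.2 →
    F' z.1 z.2 = F z.1 z.2) : Separable an F' := by
  obtain ⟨ι, hι, h₁, h₂, h₃, c₁, c₂, c₃, H₁, H₂, H₃, H, he⟩ := h
  refine ⟨ι, hι, h₁, h₂, h₃, c₁, c₂, c₃, H₁, H₂, H₃, H, ?_⟩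
  filter_upwards [e, he] with z e1 e2 a b c
  rw [e1 a b c, e2 a b c]

theorem of_prod {φ₁ φ₂ φ₃ : ℂ → ℂ} (H₁ : MeromorphicAt φ₁ 0) (H₂ : MeromorphicAt φ₂ 0)
    (H₃ : MeromorphicAt φ₃ 0) (H : an → AnalyticAt ℂ φ₃ 0) :
    Separable an (fun s t => φ₁ s * φ₂ t * φ₃ (s - t)) := by
  obtain ⟨c₁, h₁⟩ := HasCoeffs.exists_of_meromorphicAt H₁
  obtain ⟨c₂, h₂⟩ := HasCoeffs.exists_of_meromorphicAt H₂
  obtain ⟨c₃, h₃⟩ := HasCoeffs.exists_of_meromorphicAt H₃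
  refine ⟨Unit, inferInstance, fun _ => φ₁, fun _ => φ₂, fun _ => φ₃, fun _ => c₁, fun _ => c₂,
    fun _ => c₃, fun _ => h₁, fun _ => h₂, fun _ => h₃, fun ha _ m hm => ?_, by simp⟩
  obtain ⟨c, hc, hc0⟩ := HasCoeffs.exists_of_analyticAt (H ha)
  exact (congrFun (h₃.unique hc) m).trans (hc0 m hm)

theorem const (a : ℂ) : Separable an (fun _ _ => a) := by
  simpa using of_prod (an := an) (MeromorphicAt.const a 0) (MeromorphicAt.const 1 0)
    (MeromorphicAt.const 1 0) fun _ => analyticAt_const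

theorem left {φ : ℂ → ℂ} (h : MeromorphicAt φ 0) : Separable an (fun s _ => φ s) := by
  simpa using of_prod (an := an) h (MeromorphicAt.const 1 0)
    (MeromorphicAt.const 1 0) fun _ => analyticAt_const

theorem right {φ : ℂ → ℂ} (h : MeromorphicAt φ 0) : Separable an (fun _ t => φ t) := by
  simpa using of_prod (an := an) (MeromorphicAt.const 1 0) h
    (MeromorphicAt.const 1 0) fun _ => analyticAt_const

theorem diff {φ : ℂ → ℂ} (h : MeromorphicAt φ 0) (h' : an → AnalyticAt ℂ φ 0) :
    Separable an (fun s t => φ (s - t)) := by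
  simpa using of_prod (an := an) (MeromorphicAt.const 1 0) (MeromorphicAt.const 1 0) h h'

theorem add (h : Separable an F) (h' : Separable an F') :
    Separable an (fun s t => F s t + F' s t) := by
  obtain ⟨ι, hι, h₁, h₂, h₃, c₁, c₂, c₃, H₁, H₂, H₃, H, he⟩ := h
  obtain ⟨ι', hι', h₁', h₂', h₃', c₁', c₂', c₃', H₁', H₂', H₃', H', he'⟩ := h'
  refine ⟨ι ⊕ ι', inferInstance, Sum.elim h₁ h₁', Sum.elim h₂ h₂', Sum.elim h₃ h₃',
    Sum.elim c₁ c₁', Sum.elim c₂ c₂', Sum.elim c₃ c₃', Sum.forall.mpr ⟨H₁, H₁'⟩,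
    Sum.forall.mpr ⟨H₂, H₂'⟩, Sum.forall.mpr ⟨H₃, H₃'⟩,
    fun ha => Sum.forall.mpr ⟨H ha, H' ha⟩, ?_⟩
  filter_upwards [he, he'] with z e1 e2 a b c
  rw [e1 a b c, e2 a b c, Fintype.sum_sum_type]
  rfl

theorem mul (h : Separable an F) (h' : Separable an F') :
    Separable an (fun s t => F s t * F' s t) := by
  obtain ⟨ι, hι, h₁, h₂, h₃, c₁, c₂, c₃, H₁, H₂, H₃, H, he⟩ := h
  obtain ⟨ι', hι', h₁', h₂', h₃', c₁', c₂', c₃', H₁', H₂', H₃', H', he'⟩ := h'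
  refine ⟨ι × ι', inferInstance, _, _, _, _, _, _, fun r => (H₁ r.1).mul (H₁' r.2),
    fun r => (H₂ r.1).mul (H₂' r.2), fun r => (H₃ r.1).mul (H₃' r.2), fun ha r m hm => ?_, ?_⟩
  · refine finsum_eq_zero_of_forall_eq_zero fun q => ?_
    rcases lt_or_ge q 0 with hq | hq
    · rw [H ha _ q hq, zero_mul]
    · rw [H' ha _ (m - q) (by omega), mul_zero]
  · filter_upwards [he, he'] with z e1 e2 a b c
    rw [e1 a b c, e2 a b c, Finset.sum_mul_sum, Fintype.sum_prod_type]
    exact Finset.sum_congr rfl fun r _ => Finset.sum_congr rfl fun r' _ => by ring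

theorem const_mul (h : Separable an F) (a : ℂ) : Separable an (fun s t => a * F s t) :=
  (const a).mul h

end Separable

variable (τ : ℍ)

/-- Two ways of removing a pair of indices. -/
theorem succAbove_succAbove_comm {n : ℕ} {i j : Fin (n + 1)} (h : i ≤ j) (p : Fin n) :
    j.succ.succAbove (i.succAbove p) = i.castSucc.succAbove (j.succAbove p) := by
  simp only [Fin.ext_iff, Fin.succAbove, Fin.lt_def, Fin.le_def] at h ⊢
  split_ifs <;> simp at * <;> omega

theorem insertNth_insertNth_comm {α : Type*} {n : ℕ} {i j : Fin (n + 1)} (h : i ≤ j) (a b : α)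
    (y : Fin n → α) :
    j.succ.insertNth (α := fun _ => α) b (i.insertNth (α := fun _ => α) a y) =
      i.castSucc.insertNth (α := fun _ => α) a (j.insertNth (α := fun _ => α) b y) := by
  have e1 : j.succ.succAbove i = i.castSucc :=
    Fin.succAbove_of_castSucc_lt _ _ (Fin.castSucc_lt_succ_iff.mpr h)
  have e3 : j.succ = i.castSucc.succAbove j :=
    (Fin.succAbove_of_le_castSucc _ _ (by simpa using h)).symm
  rw [Fin.insertNth_eq_iff]
  refine ⟨by rw [e3]; simp, ?_⟩
  rw [Fin.insertNth_eq_iff]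
  refine ⟨by rw [Fin.removeNth, e1]; simp, ?_⟩
  funext p
  rw [Fin.removeNth, Fin.removeNth, succAbove_succAbove_comm h]
  simp

variable {n : ℕ} {i j : Fin (n + 1)} {y : Fin n → ℂ}

/-- The points near the stratum where `x_i` is at the center `k` and `x_j` at the center `l`. -/
def nearby (i j k l : Fin (n + 1)) (y : Fin n → ℂ) (s t : ℂ) : Fin (n + 2) → ℂ :=
  j.succ.insertNth (α := fun _ => ℂ) (point y l + t)
    (i.insertNth (α := fun _ => ℂ) (point y k + s) y)

theorem eventually_fst {P : ℂ → Prop} (h : ∀ᶠ s in 𝓝[≠] (0 : ℂ), P s) :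
    ∀ᶠ z : ℂ × ℂ in 𝓝 0, z.1 ≠ 0 → P z.1 :=
  (by simpa using continuous_fst.tendsto (0 : ℂ × ℂ) :
    Tendsto (Prod.fst : ℂ × ℂ → ℂ) (𝓝 0) (𝓝 0)).eventually (eventually_nhdsWithin_iff.mp h)

theorem eventually_snd {P : ℂ → Prop} (h : ∀ᶠ s in 𝓝[≠] (0 : ℂ), P s) :
    ∀ᶠ z : ℂ × ℂ in 𝓝 0, z.2 ≠ 0 → P z.2 :=
  (by simpa using continuous_snd.tendsto (0 : ℂ × ℂ) :
    Tendsto (Prod.snd : ℂ × ℂ → ℂ) (𝓝 0) (𝓝 0)).eventually (eventually_nhdsWithin_iff.mp h)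

theorem eventually_fst_sub_snd {P : ℂ → Prop} (h : ∀ᶠ s in 𝓝[≠] (0 : ℂ), P s) :
    ∀ᶠ z : ℂ × ℂ in 𝓝 0, z.1 ≠ z.2 → P (z.1 - z.2) := by
  have : Tendsto (fun z : ℂ × ℂ => z.1 - z.2) (𝓝 0) (𝓝 0) := by
    have : Continuous fun z : ℂ × ℂ => z.1 - z.2 := by fun_prop
    simpa using this.tendsto 0
  filter_upwards [this.eventually (eventually_nhdsWithin_iff.mp h)] with z hz hne
  exact hz (sub_ne_zero.mpr hne)

/-- The variables `x_i`, `x_j` keep away from the other variables and the origin for small nonzero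
`s`, `t`, and from each other because `s ≠ t` or because they have different centers. -/
theorem eventually_nearby_mem (hy : y ∈ conf τ n) (k l : Fin (n + 1)) :
    ∀ᶠ z : ℂ × ℂ in 𝓝 0, z.1 ≠ 0 → z.2 ≠ 0 → z.1 ≠ z.2 →
      nearby i j k l y z.1 z.2 ∈ conf τ (n + 2) := by
  have h1 : ∀ᶠ s in 𝓝[≠] (0 : ℂ), ∀ p, (point y k - point y p) + s ∉ (periods τ).lattice :=
    eventually_all.mpr fun p => eventually_add_notMem τ (point_sub_eq_zero_or τ hy k p)
  have h2 : ∀ᶠ s in 𝓝[≠] (0 : ℂ), ∀ p, (point y l - point y p) + s ∉ (periods τ).lattice :=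
    eventually_all.mpr fun p => eventually_add_notMem τ (point_sub_eq_zero_or τ hy l p)
  have h3 := eventually_add_notMem τ (point_sub_eq_zero_or τ hy k l)
  filter_upwards [eventually_fst h1, eventually_snd h2, eventually_fst_sub_snd h3]
    with z h1 h2 h3 a b c
  refine insertNth_mem_conf τ (insertNth_mem_conf τ hy i fun p => ?_) _ ?_
  · rw [add_sub_right_comm]
    exact h1 a p
  · rw [point_insertNth, Fin.forall_iff_succAbove i.castSucc]
    refine ⟨?_, fun p => ?_⟩
    · have := (periods τ).neg_notMem (h3 c)
      rw [Fin.insertNth_apply_same]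
      convert this using 1
      ring_nf
    · rw [Fin.insertNth_apply_succAbove, add_sub_right_comm]
      exact h2 b p

theorem meromorphicAt_shift {φ : ℂ → ℂ} (h : Meromorphic φ) (c : ℂ) :
    MeromorphicAt (fun t => φ (c + t)) 0 := by
  have := h (c + 0)
  exact this.comp_analyticAt (f := φ) (g := fun t => c + t) (by fun_prop)

theorem analyticAt_zeta_shift {c : ℂ} (hc : c ∉ (periods τ).lattice) :
    AnalyticAt ℂ (fun t => (periods τ).zeta (c + t)) 0 :=
  AnalyticAt.fun_comp_of_eq ((periods τ).analyticAt_zeta hc) (by fun_prop) (by simp)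

theorem meromorphicAt_zeta_shift {c : ℂ} (hc : c = 0 ∨ c ∉ (periods τ).lattice) :
    MeromorphicAt (fun t => (periods τ).zeta (c + t)) 0 := by
  rcases hc with rfl | hc
  · simpa using (periods τ).meromorphicAt_zeta_zero
  · exact (analyticAt_zeta_shift τ hc).meromorphicAt

theorem separable_coord {an : Prop} {φ : ℂ → ℂ} (h : Meromorphic φ) (k l : Fin (n + 1))
    (m : Fin (n + 2)) : Separable an (fun s t => φ (nearby i j k l y s t m)) := by
  induction m using Fin.succAboveCases j.succ with
  | x => simpa [nearby] using Separable.right (meromorphicAt_shift h _)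
  | p m =>
    induction m using Fin.succAboveCases i with
    | x => simpa [nearby] using Separable.left (meromorphicAt_shift h _)
    | p m => simpa [nearby] using Separable.const _

/-- The zeta function of the differences of the `x_m` and the origin. -/
theorem separable_zeta (hy : y ∈ conf τ n) {k l : Fin (n + 1)} {a b : Fin (n + 3)} (hab : a ≠ b) :
    Separable (k ≠ l) (fun s t => (periods τ).zeta
      (point (nearby i j k l y s t) a - point (nearby i j k l y s t) b)) := by
  have symm : ∀ {a b : Fin (n + 3)}, Separable (k ≠ l) (fun s t => (periods τ).zeta
      (point (nearby i j k l y s t) a - point (nearby i j k l y s t) b)) →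
      Separable (k ≠ l) (fun s t => (periods τ).zeta
        (point (nearby i j k l y s t) b - point (nearby i j k l y s t) a)) := fun h => by
    refine (h.const_mul (-1)).congr (Eventually.of_forall fun z _ _ _ => ?_)
    rw [neg_one_mul, ← (periods τ).zeta_neg, neg_sub]
  have hJ : ∀ b, Separable (k ≠ l) (fun s t => (periods τ).zeta
      (point (nearby i j k l y s t) j.succ.castSucc -
        point (nearby i j k l y s t) (j.succ.castSucc.succAbove b))) := by
    intro b
    simp only [nearby, point_insertNth, Fin.insertNth_apply_same, Fin.insertNth_apply_succAbove]
    induction b using Fin.succAboveCases i.castSucc with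
    | x =>
      refine ((Separable.diff (meromorphicAt_zeta_shift τ (point_sub_eq_zero_or τ hy k l))
        fun h => analyticAt_zeta_shift τ (point_sub_notMem τ hy h)).const_mul (-1)).congr
        (Eventually.of_forall fun z _ _ _ => ?_)
      rw [neg_one_mul, ← (periods τ).zeta_neg, Fin.insertNth_apply_same]
      congr 1
      ring
    | p b =>
      simp only [Fin.insertNth_apply_succAbove, add_sub_right_comm]
      exact Separable.right (meromorphicAt_zeta_shift τ (point_sub_eq_zero_or τ hy l b))
  have hI : ∀ b, Separable (k ≠ l) (fun s t => (periods τ).zeta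
      (point (nearby i j k l y s t) (j.succ.castSucc.succAbove i.castSucc) -
        point (nearby i j k l y s t)
          (j.succ.castSucc.succAbove (i.castSucc.succAbove b)))) := by
    intro b
    simp only [nearby, point_insertNth, Fin.insertNth_apply_same, Fin.insertNth_apply_succAbove,
      add_sub_right_comm]
    exact Separable.left (meromorphicAt_zeta_shift τ (point_sub_eq_zero_or τ hy k b))
  induction a using Fin.succAboveCases j.succ.castSucc with
  | x =>
    induction b using Fin.succAboveCases j.succ.castSucc with
    | x => exact absurd rfl hab
    | p b => exact hJ b
  | p a =>
    induction b using Fin.succAboveCases j.succ.castSucc with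
    | x => exact symm (hJ a)
    | p b =>
      induction a using Fin.succAboveCases i.castSucc with
      | x =>
        induction b using Fin.succAboveCases i.castSucc with
        | x => exact absurd rfl hab
        | p b => exact hI b
      | p a =>
        induction b using Fin.succAboveCases i.castSucc with
        | x => exact symm (hI a)
        | p b =>
          simp only [nearby, point_insertNth, Fin.insertNth_apply_succAbove]
          exact Separable.const _

/-- Near the stratum where `x_i` and `x_j` are at given centers, a regular function is a finite
sum of products of Laurent series in the displacements `s`, `t` and in `s - t`. -/
theorem separable (hy : y ∈ conf τ n) (k l : Fin (n + 1)) (f : Gam τ (n + 2)) :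
    Separable (k ≠ l) (fun s t => ext τ f.1 (nearby i j k l y s t)) := by
  have hmem := eventually_nearby_mem τ (i := i) (j := j) hy k l
  induction f using Gam_induction with
  | const c =>
    refine (Separable.const c).congr ?_
    filter_upwards [hmem] with z h h1 h2 h3
    rw [ext_of_mem τ _ (h h1 h2 h3)]
    rfl
  | add f g hf hg =>
    refine (hf.add hg).congr ?_
    filter_upwards [hmem] with z h h1 h2 h3
    simp only [ext_of_mem τ _ (h h1 h2 h3)]
    rfl
  | mul f g hf hg =>
    refine (hf.mul hg).congr ?_
    filter_upwards [hmem] with z h h1 h2 h3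
    simp only [ext_of_mem τ _ (h h1 h2 h3)]
    rfl
  | U m =>
    refine (separable_coord (i := i) (j := j) (y := y)
      (periods τ).meromorphic_weierstrassP k l m).congr ?_
    filter_upwards [hmem] with z h h1 h2 h3
    rw [ext_of_mem τ _ (h h1 h2 h3)]
    rfl
  | V m =>
    refine (separable_coord (i := i) (j := j) (y := y)
      (periods τ).meromorphic_derivWeierstrassP k l m).congr ?_
    filter_upwards [hmem] with z h h1 h2 h3
    rw [ext_of_mem τ _ (h h1 h2 h3)]
    rfl
  | S m m' hm =>
    have e1 := separable_zeta τ (i := i) (j := j) (k := k) (l := l) hy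
      (a := m.castSucc) (b := m'.castSucc) (by simpa using hm)
    have e2 := separable_zeta τ (i := i) (j := j) (k := k) (l := l) hy
      (a := m.castSucc) (b := Fin.last _) (Fin.castSucc_lt_last m).ne
    have e3 := separable_zeta τ (i := i) (j := j) (k := k) (l := l) hy
      (a := m'.castSucc) (b := Fin.last _) (Fin.castSucc_lt_last m').ne
    refine (((e1.add (e2.const_mul (-1))).add e3).const_mul 2).congr ?_
    filter_upwards [hmem] with z h h1 h2 h3
    rw [ext_of_mem τ _ (h h1 h2 h3)]
    simp only [point_castSucc, point_last, sub_zero, genS, PeriodPair.secant]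
    ring

end ChiralHomology

/-! ### The Borcherds identity in terms of binomial expansions -/

namespace VertexAlgebra

open ChiralHomology

variable {V : Type*} [AddCommGroup V] [Module ℂ V] [VertexAlgebra V]

theorem kernel_one_one (n : ℤ) (b : ℕ) : kernel 1 1 n b = (Ring.choose n b : ℤ) := by
  simp [kernel]

theorem kernel_one_neg_one (n : ℤ) (b : ℕ) :
    kernel 1 (-1) n b = (((-1 : ℤ) ^ b * Ring.choose n b : ℤ) : ℂ) := by
  simp [kernel, mul_comm]

theorem kernel_neg_one_one (n : ℤ) (b : ℕ) :
    kernel (-1) 1 n b = (((-1 : ℤ) ^ b * Ring.choose n b * (n.negOnePow : ℤ) : ℤ) : ℂ) := by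
  have e : ((-1 : ℂ) ^ b)⁻¹ = (-1) ^ b := by
    rcases neg_one_pow_eq_or ℂ b with h | h <;> simp [h]
  have e' : ((n.negOnePow : ℤ) : ℂ) = (-1) ^ n := by
    rcases Int.even_or_odd n with h | h
    · rw [Int.negOnePow_even n h, h.neg_one_zpow]; simp
    · rw [Int.negOnePow_odd n h, h.neg_one_zpow]; simp
  rw [kernel, zpow_sub₀ (by norm_num), zpow_natCast, div_eq_mul_inv, e]
  push_cast
  rw [e']
  ring

theorem finite_support_of_ge {M : Type*} [Zero M] {F : ℕ → M} {B : ℕ}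
    (h : ∀ j, B ≤ j → F j = 0) : F.HasFiniteSupport :=
  (Set.finite_Iio B).subset fun j hj => by
    by_contra hlt
    exact hj (h j (not_lt.mp hlt))

/-- The Borcherds identity, in terms of the binomial expansions of `(s - t) ^ n`, of `(-t + s) ^ n`
and, with `w = s - t`, of `s ^ m = (t + w) ^ m`; the sums are separated and mapped by `Φ`. -/
theorem borcherds_kernel {M : Type*} [AddCommGroup M] [Module ℂ M] (Φ : V →ₗ[ℂ] M) (a b c : V)
    (m n k : ℤ) :
    ∑ᶠ j : ℕ, kernel 1 (-1) n j • Φ (nprod (m + n - j) a (nprod (k + j) b c)) =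
      ∑ᶠ j : ℕ, kernel (-1) 1 n j • Φ (nprod (k + n - j) b (nprod (m + j) a c)) +
        ∑ᶠ j : ℕ, kernel 1 1 m j • Φ (nprod (k + m - j) (nprod (n + j) a b) c) := by
  obtain ⟨B₁, h₁⟩ := field b c
  obtain ⟨B₂, h₂⟩ := field a c
  obtain ⟨B₃, h₃⟩ := field a b
  have f₁ : (fun j : ℕ => ((-1 : ℤ) ^ j * Ring.choose n j) •
      nprod (n + m - j) a (nprod (k + j) b c)).HasFiniteSupport :=
    finite_support_of_ge (B := (B₁ - k).toNat) fun j hj => by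
      rw [h₁ _ (by omega), map_zero, smul_zero]
  have f₂ : (fun j : ℕ => ((-1 : ℤ) ^ j * Ring.choose n j) • (n.negOnePow : ℤ) •
      nprod (n + k - j) b (nprod (m + j) a c)).HasFiniteSupport :=
    finite_support_of_ge (B := (B₂ - m).toNat) fun j hj => by
      rw [h₂ _ (by omega), map_zero, smul_zero, smul_zero]
  have f₃ : (fun j : ℕ => Ring.choose m j •
      nprod (m + k - j) (nprod (n + j) a b) c).HasFiniteSupport :=
    finite_support_of_ge (B := (B₃ - n).toNat) fun j hj => by
      rw [h₃ _ (by omega), map_zero, LinearMap.zero_apply, smul_zero]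
  have h := congrArg Φ (borcherds a b c m n k)
  simp only [smul_sub] at h
  rw [finsum_sub_distrib f₁ f₂, map_sub, map_finsum _ f₁, map_finsum _ f₂, map_finsum _ f₃,
    eq_sub_iff_add_eq'] at h
  simp only [kernel_one_one, kernel_one_neg_one, kernel_neg_one_one, Int.cast_smul_eq_zsmul]
  simp only [map_zsmul, smul_smul] at h
  simpa only [add_comm m n, add_comm k n, add_comm k m] using h.symm

/-- For `n ≥ 0` the two binomial expansions agree. -/
theorem finsum_kernel_comm {M : Type*} [AddCommGroup M] [Module ℂ M] (X : ℤ → ℤ → M)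
    (m k : ℤ) {n : ℤ} (hn : 0 ≤ n) :
    ∑ᶠ j : ℕ, kernel 1 (-1) n j • X (m + n - j) (k + j) =
      ∑ᶠ j : ℕ, kernel (-1) 1 n j • X (m + j) (k + n - j) := by
  lift n to ℕ using hn
  have h0 : ∀ (α β : ℂ) (Y : ℕ → M), ∑ᶠ j : ℕ, kernel α β n j • Y j =
      ∑ j ∈ Finset.range (n + 1), kernel α β n j • Y j := fun α β Y => by
    refine finsum_eq_sum_of_support_subset _ fun j hj => ?_
    rw [Finset.coe_range, Set.mem_Iio]
    by_contra hlt
    exact hj (by simp [kernel, Ring.choose_natCast, Nat.choose_eq_zero_of_lt (by omega : n < j)])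
  rw [h0, h0, ← Finset.sum_range_reflect]
  refine Finset.sum_congr rfl fun j hj => ?_
  have hj : j ≤ n := Nat.lt_succ_iff.mp (Finset.mem_range.mp hj)
  have e : n + 1 - 1 - j = n - j := by omega
  rw [e]
  congr 1
  · simp only [kernel, Ring.choose_natCast, Nat.choose_symm hj, one_zpow, one_pow, mul_one]
    congr 1
    rw [← Nat.cast_sub hj, zpow_natCast]
  · push_cast [hj]
    congr 1 <;> ring

end VertexAlgebra

/-! ### The commutator formula for residues -/

namespace ChiralHomology

open VertexAlgebra

variable (τ : ℍ) {V : Type*} [AddCommGroup V] [Module ℂ V] {n : ℕ}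

/-- Evaluation of the coordinate ring factor at a point. -/
def evalTensor (V : Type*) [AddCommGroup V] [Module ℂ V] (y : conf τ n) :
    CTilde τ V n →ₗ[ℂ] PiTensorProduct ℂ fun _ : Fin (n + 1) => V :=
  (TensorProduct.lid ℂ _).toLinearMap ∘ₗ (evalAt τ y).toLinearMap.rTensor _

theorem evalTensor_tmul (y : conf τ n) (f : Gam τ n)
    (w : PiTensorProduct ℂ fun _ : Fin (n + 1) => V) :
    evalTensor τ V y (f ⊗ₜ[ℂ] w) = evalAt τ y f • w := by
  simp [evalTensor]

/-- Elements of `C̃_n` are determined by their values at all points of the configuration space. -/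
theorem ext_evalTensor {z z' : CTilde τ V n} (h : ∀ y, evalTensor τ V y z = evalTensor τ V y z') :
    z = z' := by
  classical
  let B := Module.Basis.ofVectorSpace ℂ (PiTensorProduct ℂ fun _ : Fin (n + 1) => V)
  let e := TensorProduct.equivFinsuppOfBasisRight (M := Gam τ n) B
  have key : ∀ (y : conf τ n) (z : CTilde τ V n) (s), evalAt τ y (e z s) =
      B.repr (evalTensor τ V y z) s := by
    intro y z s
    induction z using TensorProduct.induction_on with
    | zero =>
      simp only [LinearEquiv.map_zero, LinearMap.map_zero, Finsupp.zero_apply]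
      exact (evalAt τ y).map_zero'
    | add z z' hz hz' => simp only [map_add, Finsupp.add_apply, hz, hz']
    | tmul f w =>
      rw [evalTensor_tmul]
      simp [e, TensorProduct.equivFinsuppOfBasisRight_apply_tmul, mul_comm]
  apply e.injective
  ext s : 1
  refine Gam_ext τ fun y => ?_
  have := key y z s
  rw [h y, ← key y z' s] at this
  exact this

variable [VertexAlgebra V]

theorem evalTensor_residue_residue (I₁ K₁ : Fin (n + 2)) (I₂ K₂ : Fin (n + 1))
    (f : Gam τ (n + 2)) (w : PiTensorProduct ℂ fun _ : Fin (n + 3) => V) (y : conf τ n) :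
    evalTensor τ V y (residue τ V I₂ K₂ (residue τ V I₁ K₁ (f ⊗ₜ[ℂ] w))) =
      ∑ᶠ (q : ℤ) (p : ℤ), evalAt τ y (laurentLin τ I₂ K₂ p (laurentLin τ I₁ K₁ q f)) •
        mergeMap V I₂ K₂ p (mergeMap V I₁ K₁ q w) := by
  have h1 := residue_finite τ I₁ K₁ f w
  rw [residue_tmul, map_finsum _ h1, map_finsum]
  · refine finsum_congr fun q => ?_
    rw [residue_tmul, map_finsum _ (residue_finite τ I₂ K₂ _ _)]
    exact finsum_congr fun p => evalTensor_tmul τ y _ _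
  · exact Set.Finite.subset h1 fun m hm h0 => hm (by
      simpa using congrArg (residue τ V I₂ K₂) h0)

theorem admissible_mergeMap (I₁ K₁ : Fin (n + 2)) (I₂ K₂ : Fin (n + 1))
    (w : PiTensorProduct ℂ fun _ : Fin (n + 3) => V) :
    Admissible (fun p q => mergeMap V I₂ K₂ p (mergeMap V I₁ K₁ q w)) := by
  refine ⟨?_, fun q => mergeMap_eq_zero I₂ K₂ _⟩
  obtain ⟨Q, hQ⟩ := mergeMap_eq_zero I₁ K₁ w
  exact ⟨Q, fun q hq p => by dsimp only; rw [hQ q hq, map_zero]⟩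

theorem hasCoeffs_slice (I K : Fin (n + 1)) (f : Gam τ (n + 1)) (y : conf τ n) :
    HasCoeffs (slice τ f I K y.1) (fun m => evalAt τ y (laurentLin τ I K m f)) := by
  obtain ⟨N, p, hp, hc⟩ := laurentLin_hasSum τ I K f y
  exact ⟨N, p, hp, hc⟩

/-- An iterated residue, for a function which is a sum of products near the stratum. -/
theorem evalTensor_residue_residue_eq {ι : Type*} [Fintype ι] {α β : ℂ} (hα : α ≠ 0)
    (hβ : β ≠ 0) {hs hf hm : ι → ℂ → ℂ} {cs cf cm : ι → ℤ → ℂ}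
    (Hs : ∀ r, HasCoeffs (hs r) (cs r)) (Hf : ∀ r, HasCoeffs (hf r) (cf r))
    (Hm : ∀ r, HasCoeffs (hm r) (cm r)) (I₁ K₁ : Fin (n + 2)) (I₂ K₂ : Fin (n + 1))
    (f : Gam τ (n + 2)) (w : PiTensorProduct ℂ fun _ : Fin (n + 3) => V) (y : conf τ n)
    (hG : ∀ᶠ σ in 𝓝[≠] (0 : ℂ), ∀ᶠ φ in 𝓝[≠] (0 : ℂ),
      slice τ f I₁ K₁ (I₂.insertNth (α := fun _ => ℂ) (point y.1 K₂ + σ) y.1) φ =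
        ∑ r, hs r σ * hf r φ * hm r (α * σ + β * φ)) :
    evalTensor τ V y (residue τ V I₂ K₂ (residue τ V I₁ K₁ (f ⊗ₜ[ℂ] w))) =
      ∑ r, ∑ᶠ x : ℤ × ℤ × ℤ, (cs r x.1 * cf r x.2.1 * cm r x.2.2) • ∑ᶠ b : ℕ,
        kernel α β x.2.2 b •
          mergeMap V I₂ K₂ (x.1 + x.2.2 - b) (mergeMap V I₁ K₁ (x.2.1 + b) w) := by
  rw [evalTensor_residue_residue]
  refine iterated_residue hα hβ Hs Hf Hm hG
    (C := fun q => slice τ (laurentLin τ I₁ K₁ q f) I₂ K₂ y.1)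
    (A := fun p q => evalAt τ y (laurentLin τ I₂ K₂ p (laurentLin τ I₁ K₁ q f)))
    (X := fun p q => mergeMap V I₂ K₂ p (mergeMap V I₁ K₁ q w)) ?_ ?_ ?_
  · filter_upwards [eventually_insertNth_mem τ I₂ K₂ y.2] with σ hσ
    convert hasCoeffs_slice τ I₁ K₁ f ⟨_, hσ⟩ using 2 with q
    rw [slice, ext_of_mem τ _ hσ]
    rfl
  · exact fun q => hasCoeffs_slice τ I₂ K₂ _ y
  · exact admissible_mergeMap I₁ K₁ I₂ K₂ w

theorem finsum_eq_add_of_equiv {ι M : Type*} [AddCommGroup M] {F G H : ι → M} (e₁ e₂ : ι ≃ ι)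
    (hG : G.HasFiniteSupport) (hH : H.HasFiniteSupport) (h : ∀ x, F x = G (e₁ x) + H (e₂ x)) :
    ∑ᶠ x, F x = ∑ᶠ x, G x + ∑ᶠ x, H x := by
  rw [finsum_congr h, finsum_add_distrib (Set.Finite.preimage e₁.injective.injOn hG)
    (Set.Finite.preimage e₂.injective.injOn hH), finsum_comp_equiv e₁, finsum_comp_equiv e₂]

/-- The tensor left by two residues neither of which has the other one's variable as center. -/
theorem merge_merge (a : Fin (n + 3) → V) (I₁ : Fin (n + 2)) (I₂ k l : Fin (n + 1)) (p q : ℤ)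
    {b : Fin (n + 1) → V} (hb : I₂.castSucc.removeNth (I₁.castSucc.removeNth a) = b) :
    merge (merge a I₁ (I₂.castSucc.succAbove l) q) I₂ k p =
      Function.update (Function.update b l (nprod q (a I₁.castSucc) (b l))) k
        (nprod p (I₁.castSucc.removeNth a I₂.castSucc)
          (Function.update b l (nprod q (a I₁.castSucc) (b l)) k)) := by
  have e : I₂.castSucc.removeNth (merge a I₁ (I₂.castSucc.succAbove l) q) =
      Function.update b l (nprod q (a I₁.castSucc) (b l)) := by
    rw [merge, Fin.removeNth_update_succAbove, hb, ← hb]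
    rfl
  rw [merge, e, merge, Function.update_of_ne (Fin.succAbove_ne _ _).symm]

/-- The tensor left by the residue of `I₁` at the variable `I₂`, followed by the residue of `I₂` at
`l`. -/
theorem merge_merge_self (a : Fin (n + 3) → V) (I₁ : Fin (n + 2)) (I₂ l : Fin (n + 1)) (p q : ℤ)
    {b : Fin (n + 1) → V} (hb : I₂.castSucc.removeNth (I₁.castSucc.removeNth a) = b) :
    merge (merge a I₁ I₂.castSucc q) I₂ l p = Function.update b l
      (nprod p (nprod q (a I₁.castSucc) (I₁.castSucc.removeNth a I₂.castSucc)) (b l)) := by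
  rw [merge, merge, Fin.removeNth_update, hb, Function.update_self]

/-- Properties holding near the origin of `ℂ²` hold for iterated limits; besides the axes, the
lines `φ = σ` and `φ = -σ` may be avoided. -/
theorem eventually_eventually {P : ℂ × ℂ → Prop} (h : ∀ᶠ z in 𝓝 (0 : ℂ × ℂ), P z) :
    ∀ᶠ σ in 𝓝[≠] (0 : ℂ), ∀ᶠ φ in 𝓝[≠] (0 : ℂ),
      P (σ, φ) ∧ σ ≠ 0 ∧ φ ≠ 0 ∧ φ ≠ σ ∧ σ + φ ≠ 0 := by
  rw [Prod.zero_eq_mk, nhds_prod_eq] at h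
  filter_upwards [mem_nhdsWithin_of_mem_nhds h.curry, self_mem_nhdsWithin] with σ h1 h2
  have h2 : σ ≠ 0 := h2
  have h3 : ∀ᶠ φ in 𝓝 (0 : ℂ), φ ≠ σ := eventually_ne_nhds h2.symm
  have h4 : ∀ᶠ φ in 𝓝 (0 : ℂ), φ ≠ -σ := eventually_ne_nhds (by simpa using h2)
  filter_upwards [mem_nhdsWithin_of_mem_nhds h1, self_mem_nhdsWithin,
    mem_nhdsWithin_of_mem_nhds h3, mem_nhdsWithin_of_mem_nhds h4] with φ a b c d
  exact ⟨a, h2, b, c, fun e => d (eq_neg_of_add_eq_zero_right e)⟩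

/-- The commutator formula: exchanging two residues produces an iterated residue along the
diagonal, if both are taken at the same center. The function is a sum of products
`h₁(s) h₂(t) h₃(s - t)` near the stratum. Expanding the factor which mixes the two variables, in the
domain belonging to each of the three iterated residues, turns the claim into the Borcherds
identity, for each term and all exponents. -/
theorem residue_comp_residue {i j : Fin (n + 1)} (hij : i ≤ j) (k l : Fin (n + 1)) :
    residue τ V i k ∘ₗ residue τ V j.succ (i.castSucc.succAbove l) =
      residue τ V j l ∘ₗ residue τ V i.castSucc (j.castSucc.succAbove k) +
        if k = l then residue τ V j l ∘ₗ residue τ V i.castSucc j.castSucc else 0 := by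
  refine TensorProduct.ext' fun f w => ?_
  induction w using PiTensorProduct.induction_on with
  | add x y hx hy => rw [TensorProduct.tmul_add, map_add, hx, hy, map_add]
  | smul_tprod c a =>
  rw [TensorProduct.tmul_smul, map_smul, map_smul]
  congr 1
  refine ext_evalTensor τ fun y => ?_
  obtain ⟨ι, hι, h₁, h₂, h₃, c₁, c₂, c₃, H₁, H₂, H₃, H, he⟩ :=
    separable τ (i := i) (j := j) y.2 k l f
  -- the factors of the tensor, and the remaining ones
  set u := a j.succ.castSucc with hu
  set v := a i.castSucc.castSucc with hv
  set b := i.castSucc.removeNth (j.succ.castSucc.removeNth a) with hb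
  have hb' : j.castSucc.removeNth (i.castSucc.castSucc.removeNth a) = b := by
    funext p
    exact congrArg a (succAbove_succAbove_comm (i := i.castSucc) (j := j.castSucc)
      (by simpa using hij) p).symm
  have hv' : j.succ.castSucc.removeNth a i.castSucc = v :=
    congrArg a (Fin.succAbove_of_castSucc_lt _ _ (by simpa [Fin.lt_def, Nat.lt_succ_iff] using hij))
  have hu' : i.castSucc.castSucc.removeNth a j.castSucc = u :=
    congrArg a (Fin.succAbove_of_le_castSucc _ _ (by simpa using hij))
  have hcomm : ∀ s t : ℂ, nearby i j k l y.1 s t = i.castSucc.insertNth (α := fun _ => ℂ)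
      (point y.1 k + s) (j.insertNth (α := fun _ => ℂ) (point y.1 l + t) y.1) := fun s t =>
    insertNth_insertNth_comm hij _ _ _
  -- the domain `|t| < |s|`: `t` is integrated first
  have EA := evalTensor_residue_residue_eq τ (V := V) (α := 1) (β := -1) one_ne_zero (by simp)
    H₁ H₂ H₃ j.succ (i.castSucc.succAbove l) i k f (PiTensorProduct.tprod ℂ a) y (by
      filter_upwards [eventually_eventually he] with σ h
      filter_upwards [h] with φ ⟨h, hσ, hφ, hne, _⟩
      rw [slice, point_insertNth, Fin.insertNth_apply_succAbove,
        show (1 : ℂ) * σ + -1 * φ = σ - φ by ring]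
      exact h hσ hφ hne.symm)
  have hswap : Tendsto (fun z : ℂ × ℂ => (z.2, z.1)) (𝓝 0) (𝓝 0) := by
    have : Continuous fun z : ℂ × ℂ => (z.2, z.1) := by fun_prop
    exact this.tendsto' 0 0 rfl
  -- the domain `|s| < |t|`: `s` is integrated first
  have EB := evalTensor_residue_residue_eq τ (V := V) (α := -1) (β := 1) (by simp) one_ne_zero
    H₂ H₁ H₃ i.castSucc (j.castSucc.succAbove k) j l f (PiTensorProduct.tprod ℂ a) y (by
      filter_upwards [eventually_eventually (hswap.eventually he)] with σ h
      filter_upwards [h] with φ ⟨h, hσ, hφ, hne, _⟩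
      have h := h hφ hσ hne
      rw [hcomm] at h
      rw [slice, point_insertNth, Fin.insertNth_apply_succAbove,
        show (-1 : ℂ) * σ + 1 * φ = φ - σ by ring, h]
      exact Finset.sum_congr rfl fun r _ => by ring)
  have XA : ∀ p q, mergeMap V i k p (mergeMap V j.succ (i.castSucc.succAbove l) q
      (PiTensorProduct.tprod ℂ a)) = PiTensorProduct.tprod ℂ (Function.update
        (Function.update b l (nprod q u (b l))) k
          (nprod p v (Function.update b l (nprod q u (b l)) k))) := fun p q => by
    rw [mergeMap_tprod, mergeMap_tprod, merge_merge a j.succ i k l p q hb.symm, hv']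
  have XB : ∀ p q, mergeMap V j l p (mergeMap V i.castSucc (j.castSucc.succAbove k) q
      (PiTensorProduct.tprod ℂ a)) = PiTensorProduct.tprod ℂ (Function.update
        (Function.update b k (nprod q v (b k))) l
          (nprod p u (Function.update b k (nprod q v (b k)) l))) := fun p q => by
    rw [mergeMap_tprod, mergeMap_tprod, merge_merge a i.castSucc j l k p q hb', hu']
  -- exchanging the roles of the two displacements
  let e₁ : ℤ × ℤ × ℤ ≃ ℤ × ℤ × ℤ :=
    ⟨fun x => (x.2.1, x.1, x.2.2), fun x => (x.2.1, x.1, x.2.2), fun _ => rfl, fun _ => rfl⟩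
  rw [LinearMap.add_apply, map_add, LinearMap.comp_apply, LinearMap.comp_apply, EA, EB]
  obtain rfl | hkl := eq_or_ne k l
  · have hadd : Tendsto (fun z : ℂ × ℂ => (z.1 + z.2, z.1)) (𝓝 0) (𝓝 0) := by
      have : Continuous fun z : ℂ × ℂ => (z.1 + z.2, z.1) := by fun_prop
      exact this.tendsto' 0 0 (by simp)
    -- the domain `|s - t| < |t|`: `w = s - t` is integrated first, and `s = t + w`
    have EC := evalTensor_residue_residue_eq τ (V := V) (α := 1) (β := 1) one_ne_zero one_ne_zero
      H₂ H₃ H₁ i.castSucc j.castSucc j k f (PiTensorProduct.tprod ℂ a) y (by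
        filter_upwards [eventually_eventually (hadd.eventually he)] with σ h
        filter_upwards [h] with φ ⟨h, hσ, hφ, _, hne⟩
        have h := h hne hσ (by simpa using hφ)
        simp only [hcomm, add_sub_cancel_left] at h
        rw [slice, point_insertNth, Fin.insertNth_apply_same, one_mul, one_mul,
          add_assoc (point y.1 k), h]
        exact Finset.sum_congr rfl fun r _ => by ring)
    have XC : ∀ p q, mergeMap V j k p (mergeMap V i.castSucc j.castSucc q
        (PiTensorProduct.tprod ℂ a)) = PiTensorProduct.tprod ℂ (Function.update b k
          (nprod p (nprod q v u) (b k))) := fun p q => by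
      rw [mergeMap_tprod, mergeMap_tprod, merge_merge_self a i.castSucc j k p q hb', hu']
    let e₂ : ℤ × ℤ × ℤ ≃ ℤ × ℤ × ℤ :=
      ⟨fun x => (x.2.1, x.2.2, x.1), fun x => (x.2.2, x.1, x.2.1), fun _ => rfl, fun _ => rfl⟩
    rw [if_pos rfl, LinearMap.comp_apply, EC, ← Finset.sum_add_distrib]
    refine Finset.sum_congr rfl fun r _ => ?_
    have fB := (summand_finite_outer (α := -1) (β := 1) (H₂ r).exists_bound (H₁ r).exists_bound
      (H₃ r).exists_bound (admissible_mergeMap i.castSucc (j.castSucc.succAbove k) j k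
        (PiTensorProduct.tprod ℂ a))).1
    have fC := (summand_finite_outer (α := 1) (β := 1) (H₂ r).exists_bound (H₃ r).exists_bound
      (H₁ r).exists_bound (admissible_mergeMap i.castSucc j.castSucc j k
        (PiTensorProduct.tprod ℂ a))).1
    refine finsum_eq_add_of_equiv e₁ e₂ fB fC fun ⟨m, q, n⟩ => ?_
    have hc : c₂ r q * c₁ r m * c₃ r n = c₁ r m * c₂ r q * c₃ r n := by ring
    have hc' : c₂ r q * c₃ r n * c₁ r m = c₁ r m * c₂ r q * c₃ r n := by ring
    simp only [e₁, e₂, Equiv.coe_fn_mk, hc, hc', ← smul_add]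
    congr 1
    simp only [XA, XB, XC, Function.update_idem, Function.update_self]
    exact borcherds_kernel ((PiTensorProduct.tprod ℂ).toLinearMap b k) v u (b k) m n q
  · rw [if_neg hkl, LinearMap.zero_apply, map_zero, add_zero]
    refine Finset.sum_congr rfl fun r _ => ?_
    refine Eq.trans ?_ (finsum_comp_equiv e₁)
    refine finsum_congr fun ⟨m, q, n⟩ => ?_
    simp only [e₁, Equiv.coe_fn_mk]
    rcases lt_or_ge n 0 with hn | hn
    -- at different centers `h₃` has no pole, and for `n ≥ 0` there is only one expansion
    · rw [H hkl r n hn, mul_zero, mul_zero, zero_smul, zero_smul]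
    rw [mul_comm (c₂ r q)]
    congr 1
    simp only [XA, XB, Function.update_of_ne hkl, Function.update_of_ne hkl.symm]
    rw [finsum_kernel_comm (fun p p' => PiTensorProduct.tprod ℂ (Function.update
      (Function.update b l (nprod p' u (b l))) k (nprod p v (b k)))) m q hn]
    refine finsum_congr fun t => ?_
    rw [Function.update_comm hkl]

end ChiralHomology

/-! ### The complex -/

namespace ChiralHomology

/-- The faces satisfy the simplicial identities, so that their alternating sums square to zero. -/
theorem differential_comp_differential (τ : ℍ) (V : Type*) [AddCommGroup V] [Module ℂ V]
    [VertexAlgebra V] (n : ℕ) : differential τ V n ∘ₗ differential τ V (n + 1) = 0 :=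
  alternating_sum_comp_eq_zero (face τ V n) (face τ V (n + 1)) fun _ _ hij =>
    face_comp_face τ hij (residue_comp_residue τ hij)

end ChiralHomology

end

theorem mainTheorem7 (τ : UpperHalfPlane) (V : Type*) [AddCommGroup V] [Module ℂ V]
    [GradedVertexAlgebra V] :
    -- the Laurent coefficients along `x_i = x_j` and along `x_i = 0` are well defined elements
    -- of the coordinate ring in one variable less
    (∀ (n : ℕ) (f : ChiralHomology.Gam τ (n + 1)) (i : Fin (n + 1)),
      (∀ k : Fin n, ∃! g, ChiralHomology.IsLaurentExpansion τ f i (fun y => y k) g) ∧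
      ∃! g, ChiralHomology.IsLaurentExpansion τ f i (fun _ => 0) g) ∧
    -- the residue formula defines linear maps `d` upstairs
    ∃ δ : ∀ n : ℕ, ChiralHomology.CTilde τ V (n + 1) →ₗ[ℂ] ChiralHomology.CTilde τ V n,
      ChiralHomology.IsChiralDifferential τ δ ∧
      (∀ δ' : ∀ n : ℕ, ChiralHomology.CTilde τ V (n + 1) →ₗ[ℂ] ChiralHomology.CTilde τ V n,
        ChiralHomology.IsChiralDifferential τ δ' → δ' = δ) ∧
      -- which descend to the quotients, where they square to zero
      ∃ d : ∀ n : ℕ, ChiralHomology.C τ V (n + 1) →ₗ[ℂ] ChiralHomology.C τ V n,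
        (∀ n : ℕ, d n ∘ₗ (ChiralHomology.relations τ V (n + 1)).mkQ =
          (ChiralHomology.relations τ V n).mkQ ∘ₗ δ n) ∧
        ∀ n : ℕ, d n ∘ₗ d (n + 1) = 0 := by

  open ChiralHomology in
  refine ⟨fun n f i => ⟨fun k => ?_, ?_⟩, differential τ V, isChiralDifferential_differential τ,
    fun δ' h' => IsChiralDifferential.unique τ (isChiralDifferential_differential τ) h',
    fun n => Submodule.mapQ _ _ (differential τ V n) (differential_mem_relations τ n),
    fun n => Submodule.mapQ_mkQ _ _ _, fun n => ?_⟩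
  · simpa using existsUnique_isLaurentExpansion τ f i k.castSucc
  · simpa using existsUnique_isLaurentExpansion τ f i (Fin.last n)
  · refine Submodule.linearMap_qext _ (LinearMap.ext fun x => ?_)
    have h := LinearMap.congr_fun (differential_comp_differential τ V n) x
    simp only [LinearMap.comp_apply, LinearMap.zero_apply] at h
    simp [Submodule.mapQ_apply, h]
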